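/- **Setting.** Let $n,d\ge 1$ and let $0\le K\le k\le d$ be integers. In sparse linear regression one observes a matrix $A\in\mathbb R^{n\times d}$ with rows $a_1,\dots,a_n$ and $y=Ax^*+\varepsilon$, where $x^*\in\mathbb R^d$ is fixed with $\|x^*\|_0\le K$ and $\|x^*\|_2\le\omega$. The entries of $A$ are i.i.d., centered and $\sigma$-sub-Gaussian, the entries of $\varepsilon$ are i.i.d., centered and $\sigma_0$-sub-Gaussian, and $\varepsilon$ is independent of $A$. Here a centered $\theta$ is $\sigma$-sub-Gaussian if $\mathbb E e^{z\theta}\le e^{\sigma^2z^2/2}$ for all $z\in\mathbb R$. For $\gamma\ge 0$ and $\omega>0$ put $f_i(x)=\frac12(y_i-a_i\cdot x)^2+\frac\gamma2\|x\|_2^2$ and $F=\frac1n\sum_{i=1}^n f_i$, and let $\hat x$ be a global optimum of $\min F(x)$ subject to $\|x\|_0\le K$, $\|x\|_2\le\omega$. **Curvature.** A differentiable $f$ satisfies RSC at level $r$ with parameter $\alpha>0$ if $f(x')-f(x)-\langle\nabla f(x),x'-x\rangle\ge\frac\alpha2\|x'-x\|_2^2$ whenever $\|x-x'\|_0\le r$.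 It satisfies RSS at level $r$ with parameter $L$ if $\|\nabla f(x')-\nabla f(x)\|_2\le L\|x'-x\|_2$ whenever $\|x-x'\|_0\le r$. **HT-SVRG** has a step size $\eta>0$, an update frequency $m\ge1$, a sparsity parameter $k$, the radius $\omega$, and an initial point $\tilde x^0$ with $\|\tilde x^0\|_0\le k$, $\|\tilde x^0\|_2\le\omega$. In stage $s\ge 1$ put $\tilde x=\tilde x^{s-1}$, $\tilde\mu=\nabla F(\tilde x)$, $x^0=\tilde x$. For $t=1,\dots,m$ draw $i_t$ uniformly from $\{1,\dots,n\}$ and set $x^t=\Pi_\omega\big(H_k\big(x^{t-1}-\eta(\nabla f_{i_t}(x^{t-1})-\nabla f_{i_t}(\tilde x)+\tilde\mu)\big)\big)$. Here $H_k$ keeps the $k$ largest entries in magnitude (ties going to the smaller index) and sets the others to zero, and $\Pi_\omega(v)=v/\max\{1,\|v\|_2/\omega\}$. Finally $\tilde x^s=x^{j}$ with $j$ uniform on $\{0,\dots,m-1\}$. All these draws are independent. **Parameters.** Let $$\nu=1+\frac{\rho+\sqrt{(4+\rho)\rho}}2,\qquad \rho=\frac{\min\{K,d-k\}}{k-K+\min\{K,d-k\}}$$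 (with $\rho=0$ when $k=K=0$ or $k=K=d$). Let $$\beta=\frac1{\nu\eta\alpha(1-2\eta L)m}+\frac{2\eta L}{1-2\eta L}\quad\text{if }\nu\le\frac1{1-\eta\alpha},$$ $$\beta=\frac1{Dm}+\frac{2\nu\eta^2\alpha L}{D},\quad D=2\nu\eta\alpha-2\nu\eta^2\alpha L-\nu+1,\quad\text{otherwise.}$$ Assume $0<\eta<1/(4L)$, $\nu<4L/(4L-\alpha)$ and $0<\beta<1$ (the requirement that the update frequency $m$ be large enough). **Statement.** There is an absolute constant $C_0>0$ such that for every $C_\gamma>0$ there is a constant $C$, depending only on $C_\gamma,\omega,\alpha,L,\eta,\beta$ (in particular not on $n,d,k,K,m,\sigma,\sigma_0,x^*$), with the following property. If $$n\ge C_0(3k+K)\log d,\qquad \gamma\le C_\gamma\sqrt{\frac{(3k+K)\log d}{n}},$$ then there is an event of probability at least $1-2d^{-1}$ over $(A,\varepsilon)$ on which the following holds. Whenever $F$ satisfies RSC at level $k+K$ with parameter $\alpha$ and every $f_i$ satisfies RSS at level $3k+K$ with parameter $L$, HT-SVRG converges linearly to every global optimum $\hat x$, from every admissible $\tilde x^0$: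 there is $\tau\ge0$ such that for all $s\ge0$ $$\mathbb E\big[F(\tilde x^s)-F(\hat x)\big]\le\beta^s\big[F(\tilde x^0)-F(\hat x)\big]+\tau,\qquad \tau\le C\,\max\{\sigma,\sigma_0\}\,\sigma\,\sqrt{\frac{(3k+K)\log d}{n}},$$ where the expectation is over the random choices of the algorithm. -/

import Mathlib

open MeasureTheory ProbabilityTheory

noncomputable section

namespace HTSVRG

/-- `ℝ^d` with the Euclidean norm. -/
abbrev Vec (d : ℕ) : Type := EuclideanSpace ℝ (Fin d)

/-- The support of a vector. -/
def supp {d : ℕ} (x : Vec d) : Finset (Fin d) := Finset.univ.filter fun i => x i ≠ 0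

/-- The number of nonzero entries of a vector. -/
def l0 {d : ℕ} (x : Vec d) : ℕ := (supp x).card

/-- `P_Γ`: keeps the entries indexed by `Γ` and sets the others to zero. -/
def proj {d : ℕ} (Γ : Finset (Fin d)) (v : Vec d) : Vec d :=
  WithLp.toLp 2 fun i => if i ∈ Γ then v i else 0

/-- The indices of the `k` entries of `v` that are largest in magnitude, ties being broken in
favour of the smaller index: `i` is kept when fewer than `k` indices come before it. -/
def topIndices {d : ℕ} (k : ℕ) (v : Vec d) : Finset (Fin d) :=
  Finset.univ.filter fun i =>
    (Finset.univ.filter fun j => |v i| < |v j| ∨ (|v j| = |v i| ∧ j < i)).card < k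

/-- The hard thresholding operator `H_k`. -/
def hardThreshold {d : ℕ} (k : ℕ) (v : Vec d) : Vec d := proj (topIndices k v) v

/-- `Π_R(v) = v / max {1, ‖v‖ / R}`, the projection onto the ball of radius `R`. -/
def ballProj {d : ℕ} (R : ℝ) (v : Vec d) : Vec d := (max 1 (‖v‖ / R))⁻¹ • v

/-- Restricted strong convexity at sparsity level `r` with positive parameter `α`. -/
def RSC {d : ℕ} (f : Vec d → ℝ) (r : ℕ) (α : ℝ) : Prop :=
  Differentiable ℝ f ∧ 0 < α ∧ ∀ x x' : Vec d, l0 (x - x') ≤ r →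
    α / 2 * ‖x' - x‖ ^ 2 ≤ f x' - f x - inner ℝ (gradient f x) (x' - x)

/-- Restricted smoothness at sparsity level `r` with parameter `L`. -/
def RSS {d : ℕ} (f : Vec d → ℝ) (r : ℕ) (L : ℝ) : Prop :=
  Differentiable ℝ f ∧ ∀ x x' : Vec d, l0 (x - x') ≤ r →
    ‖gradient f x' - gradient f x‖ ≤ L * ‖x' - x‖

/-- The objective `F = n⁻¹ ∑ i, f i`. -/
def objective {n d : ℕ} (f : Fin n → Vec d → ℝ) (x : Vec d) : ℝ := (n : ℝ)⁻¹ * ∑ i, f i x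

/-- `x̂` is a global optimum of `min F(x)` subject to `‖x‖₀ ≤ K` and `‖x‖₂ ≤ R`. -/
def IsGlobalOptimum {d : ℕ} (F : Vec d → ℝ) (K : ℕ) (R : ℝ) (xhat : Vec d) : Prop :=
  (l0 xhat ≤ K ∧ ‖xhat‖ ≤ R) ∧ ∀ x : Vec d, l0 x ≤ K → ‖x‖ ≤ R → F xhat ≤ F x

/-! ### The algorithm -/

/-- One inner update of HT-SVRG with snapshot `xs` (the last stage's output), current inner
iterate `x` and sampled index `i`. -/
def innerStep {n d : ℕ} (f : Fin n → Vec d → ℝ) (k : ℕ) (R η : ℝ) (xs x : Vec d) (i : Fin n) :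
    Vec d :=
  ballProj R (hardThreshold k
    (x - η • (gradient (f i) x - gradient (f i) xs
      + (n : ℝ)⁻¹ • ∑ l, gradient (f l) xs)))

/-- The inner iterates `x^0, …, x^m` of a stage, `I` being the sampled indices `i_1, …, i_m`. -/
def innerIter {n d m : ℕ} (f : Fin n → Vec d → ℝ) (k : ℕ) (R η : ℝ) (xs : Vec d)
    (I : Fin m → Fin n) : Fin (m + 1) → Vec d :=
  Fin.induction (motive := fun _ => Vec d) xs fun t x => innerStep f k R η xs x (I t)

/-- The random choices of one stage: the `m` sampled indices, and the index
`j ∈ {0, …, m - 1}` of the inner iterate that is the output of the stage. -/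
abbrev StageChoice (n m : ℕ) : Type := (Fin m → Fin n) × Fin m

/-- The output of a stage that starts from the snapshot `xs`. -/
def stage {n d m : ℕ} (f : Fin n → Vec d → ℝ) (k : ℕ) (R η : ℝ) (xs : Vec d)
    (c : StageChoice n m) : Vec d :=
  innerIter f k R η xs c.1 c.2.castSucc

/-- The output of HT-SVRG after `s` stages, as a function of the choices made in them. -/
def output {n d m : ℕ} (f : Fin n → Vec d → ℝ) (k : ℕ) (R η : ℝ) (x0 : Vec d) :
    (s : ℕ) → (Fin s → StageChoice n m) → Vec d
  | 0, _ => x0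
  | s + 1, c => stage f k R η (output f k R η x0 s (Fin.init c)) (c (Fin.last s))

/-- `E[F(x̃^s) - F(x̂)]` over the choices of the first `s` stages, which are independent and
uniform; that is, over the uniform distribution on the finite set of choice sequences. -/
def expectedGap {n d : ℕ} (f : Fin n → Vec d → ℝ) (k m : ℕ) (R η : ℝ) (x0 xhat : Vec d)
    (s : ℕ) : ℝ :=
  (∑ c : Fin s → StageChoice n m,
      (objective f (output f k R η x0 s c) - objective f xhat))
    / (Fintype.card (Fin s → StageChoice n m) : ℝ)

/-- HT-SVRG, started at `x0`, converges linearly to `xhat` with convergence coefficient `β` and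
optimization error `τ`. -/
def ConvergesLinearly {n d : ℕ} (f : Fin n → Vec d → ℝ) (k m : ℕ) (R η : ℝ)
    (x0 xhat : Vec d) (β τ : ℝ) : Prop :=
  0 < β ∧ β < 1 ∧ 0 ≤ τ ∧ ∀ s : ℕ,
    expectedGap f k m R η x0 xhat s ≤ β ^ s * (objective f x0 - objective f xhat) + τ

/-! ### The parameters -/

/-- `ρ = min {K, d - k} / (k - K + min {K, d - k})`. -/
def rho (d k K : ℕ) : ℝ :=
  min (K : ℝ) ((d : ℝ) - k) / ((k : ℝ) - K + min (K : ℝ) ((d : ℝ) - k))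

/-- The expansiveness factor `ν` of hard thresholding. -/
def expansiveness (d k K : ℕ) : ℝ :=
  1 + (rho d k K + Real.sqrt ((4 + rho d k K) * rho d k K)) / 2

/-- The convergence coefficient, in the two regimes of `ν`. -/
def convCoeff (ν η α L : ℝ) (m : ℕ) : ℝ :=
  if ν ≤ 1 / (1 - η * α) then
    1 / (ν * η * α * (1 - 2 * η * L) * m) + 2 * η * L / (1 - 2 * η * L)
  else
    1 / ((2 * ν * η * α - 2 * ν * η ^ 2 * α * L - ν + 1) * m)
      + 2 * ν * η ^ 2 * α * L / (2 * ν * η * α - 2 * ν * η ^ 2 * α * L - ν + 1)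

/-! ### Sparse linear regression -/

/-- `f_i(x) = (y_i - a_i · x)² / 2 + (γ / 2) ‖x‖²`, whose average over `i` is the
`ℓ₂`-regularized least-squares objective. -/
def regLoss {n d : ℕ} (A : Matrix (Fin n) (Fin d) ℝ) (y : Fin n → ℝ) (γ : ℝ) (i : Fin n)
    (x : Vec d) : ℝ :=
  (y i - A.mulVec x.ofLp i) ^ 2 / 2 + γ / 2 * ‖x‖ ^ 2

/-- A centered random variable is `σ`-sub-Gaussian if `E exp(z θ) ≤ exp(σ² z² / 2)` for all `z`. -/
def IsSubGaussian {Ω : Type*} [MeasurableSpace Ω] (θ : Ω → ℝ) (σ : NNReal) (P : Measure Ω) :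
    Prop :=
  (∫ o, θ o ∂P) = 0 ∧ HasSubgaussianMGF θ (σ ^ 2) P

/-- The random variables `θ i` are i.i.d., centered and `σ`-sub-Gaussian. -/
def IIDSubGaussian {ι Ω : Type*} [MeasurableSpace Ω] (θ : ι → Ω → ℝ) (σ : NNReal)
    (P : Measure Ω) : Prop :=
  (∀ i, Measurable (θ i)) ∧ iIndepFun θ P ∧ (∀ i j, IdentDistrib (θ i) (θ j) P P) ∧
    ∀ i, IsSubGaussian (θ i) σ P

end HTSVRG

end

noncomputable section

namespace HTSVRG

/-! ### Coordinate projections -/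

section Vectors

variable {d : ℕ}

/-! The losses are quadratic, so with `G = ∇F(x̂)` and `z = x - x̂` the gap is exactly `F(x) - F(x̂)
= ⟪z, G⟫ + q(z) / 2`, where `q` (`quadForm`) is the quadratic form of the averaged Hessian. The SVRG
argument is run on `q`, which is nonnegative, instead of on the gap, whose sign is unknown because
`x̂` is only `K`-sparse. Passing between the two costs a multiple of `R g`, with `g` a bound for `G`
on sparse coordinate sets.

One update (`avg_norm_sq_innerStep_le`): hard thresholding expands squared distances to `x̂` by at
most `ν`, and restricted co-coercivity of each Hessian replaces the variance bound of SVRG. The set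
kept by thresholding depends on the sampled index, so averaging over that index is legitimate only
on the fixed set `supp x ∪ supp x̃ ∪ supp x̂`. The rest `T` of the kept set is treated as an error:
there `∇F(x̃)` is the restriction of `G` plus an off-support piece of the Hessian applied to `x̃ -
x̂`, bounded by `h`. Telescoping over a stage gives contraction by `β` (`le_convCoeff_mul_add`,
`sum_stage_le`), and iterating gives `β ^ s` plus an error made from `g` and `h`
(`convergesLinearly_of_bounds`).

It remains to see that `g` and `h` are of order `B = max σ σ₀ * σ * s`, with `s = √((3k+K) log d /
n)`. Since `n⁻¹ AᵀA` is within `O(σ² s)` of `v • id` on sparse vectors, its off-support part is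
small, and the regularizer contributes nothing off the support. For `g`, optimality at `x̂` bounds
`G` by the noise and by the Gram matrix applied to `x̂ - x*`; `γ` enters only through `‖x̂ - x*‖`.
This matters because the bound on `γ` carries no factor `σ`. Terms quadratic in `B` are harmless
when `B ≤ 1`; when `B ≥ 1` the diameter bound `q ≤ 4 L R²` suffices.

The probability is standard: products of sub-Gaussian variables are sub-exponential, a Bernstein
bound controls their averages, and a union bound runs over supports and over `1 / 2`-nets of the
sparse balls (`exists_gram_event`), or over single coordinates for the noise (`exists_noise_event`).
-/

@[simp] lemma proj_apply (Γ : Finset (Fin d)) (v : Vec d) (i : Fin d) :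
    proj Γ v i = if i ∈ Γ then v i else 0 := rfl

@[simp] lemma mem_supp {x : Vec d} {i : Fin d} : i ∈ supp x ↔ x i ≠ 0 := by simp [supp]

lemma inner_eq_sum (x y : Vec d) : inner ℝ x y = ∑ i, x i * y i := by
  simp [PiLp.inner_apply, mul_comm]

lemma norm_sq_eq_sum (x : Vec d) : ‖x‖ ^ 2 = ∑ i, x i ^ 2 := by
  simp [EuclideanSpace.norm_sq_eq]

lemma proj_add (Γ : Finset (Fin d)) (x y : Vec d) : proj Γ (x + y) = proj Γ x + proj Γ y := by
  ext i; by_cases h : i ∈ Γ <;> simp [h]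

lemma proj_sub (Γ : Finset (Fin d)) (x y : Vec d) : proj Γ (x - y) = proj Γ x - proj Γ y := by
  ext i; by_cases h : i ∈ Γ <;> simp [h]

lemma proj_smul (Γ : Finset (Fin d)) (c : ℝ) (x : Vec d) : proj Γ (c • x) = c • proj Γ x := by
  ext i; by_cases h : i ∈ Γ <;> simp [h]

lemma proj_eq_self {Γ : Finset (Fin d)} {x : Vec d} (h : supp x ⊆ Γ) : proj Γ x = x := by
  ext i
  by_cases hi : i ∈ Γ
  · simp [hi]
  · have : x i = 0 := by
      by_contra h0
      exact hi (h (mem_supp.2 h0))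
    simp [this]

lemma proj_eq_zero {Γ : Finset (Fin d)} {x : Vec d} (h : Disjoint Γ (supp x)) :
    proj Γ x = 0 := by
  ext i
  by_cases hi : i ∈ Γ
  · have : x i = 0 := by
      by_contra h0
      exact Finset.disjoint_left.1 h hi (mem_supp.2 h0)
    simp [this]
  · simp [hi]

lemma supp_proj_subset (Γ : Finset (Fin d)) (x : Vec d) : supp (proj Γ x) ⊆ Γ := by
  intro i hi
  by_contra h
  simp [h] at hi

lemma inner_proj_left (Γ : Finset (Fin d)) (x y : Vec d) :
    inner ℝ (proj Γ x) y = inner ℝ x (proj Γ y) := by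
  simp only [inner_eq_sum, proj_apply]
  refine Finset.sum_congr rfl fun i _ => ?_
  by_cases h : i ∈ Γ <;> simp [h]

lemma inner_proj_proj (Γ : Finset (Fin d)) (x y : Vec d) :
    inner ℝ (proj Γ x) (proj Γ y) = inner ℝ (proj Γ x) y := by
  simp only [inner_eq_sum, proj_apply]
  refine Finset.sum_congr rfl fun i _ => ?_
  by_cases h : i ∈ Γ <;> simp [h]

lemma inner_eq_inner_proj {Γ : Finset (Fin d)} {x : Vec d} (h : supp x ⊆ Γ) (y : Vec d) :
    inner ℝ x y = inner ℝ x (proj Γ y) := by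
  rw [← inner_proj_left, proj_eq_self h]

lemma norm_sq_proj (Γ : Finset (Fin d)) (x : Vec d) : ‖proj Γ x‖ ^ 2 = ∑ i ∈ Γ, x i ^ 2 := by
  rw [norm_sq_eq_sum]
  simp [ite_pow, Finset.sum_ite_mem]

lemma norm_proj_le (Γ : Finset (Fin d)) (x : Vec d) : ‖proj Γ x‖ ≤ ‖x‖ := by
  refine le_of_sq_le_sq ?_ (norm_nonneg _)
  rw [norm_sq_proj, norm_sq_eq_sum]
  exact Finset.sum_le_sum_of_subset_of_nonneg (Finset.subset_univ _) fun i _ _ => sq_nonneg _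

lemma proj_mono {Γ Γ' : Finset (Fin d)} (h : Γ ⊆ Γ') (x : Vec d) : ‖proj Γ x‖ ≤ ‖proj Γ' x‖ := by
  refine le_of_sq_le_sq ?_ (norm_nonneg _)
  rw [norm_sq_proj, norm_sq_proj]
  exact Finset.sum_le_sum_of_subset_of_nonneg h fun i _ _ => sq_nonneg _

lemma norm_sq_proj_union {Γ Γ' : Finset (Fin d)} (h : Disjoint Γ Γ') (x : Vec d) :
    ‖proj (Γ ∪ Γ') x‖ ^ 2 = ‖proj Γ x‖ ^ 2 + ‖proj Γ' x‖ ^ 2 := by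
  simp only [norm_sq_proj, Finset.sum_union h]

lemma proj_union {Γ Γ' : Finset (Fin d)} (h : Disjoint Γ Γ') (x : Vec d) :
    proj (Γ ∪ Γ') x = proj Γ x + proj Γ' x := by
  ext i
  by_cases h1 : i ∈ Γ
  · simp [h1, Finset.disjoint_left.1 h h1]
  · by_cases h2 : i ∈ Γ' <;> simp [h1, h2]

lemma supp_sub_subset (x y : Vec d) : supp (x - y) ⊆ supp x ∪ supp y := by
  intro i hi
  by_contra h
  simp only [Finset.mem_union, mem_supp, not_or, not_not] at h
  simp [h.1, h.2] at hi

lemma l0_sub_le (x y : Vec d) : l0 (x - y) ≤ l0 x + l0 y :=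
  (Finset.card_le_card (supp_sub_subset x y)).trans (Finset.card_union_le _ _)

lemma l0_sub_comm (x y : Vec d) : l0 (x - y) = l0 (y - x) := by
  unfold l0
  congr 1
  ext i
  rw [mem_supp, mem_supp]
  exact not_congr (sub_eq_zero.trans (eq_comm.trans sub_eq_zero.symm))

lemma eq_zero_of_l0 {x : Vec d} (h : l0 x ≤ 0) : x = 0 := by
  have : supp x = ∅ := Finset.card_eq_zero.1 (Nat.le_zero.1 h)
  ext i
  by_contra h0
  have : i ∈ supp x := mem_supp.2 h0
  simp_all

lemma l0_proj_le (Γ : Finset (Fin d)) (x : Vec d) : l0 (proj Γ x) ≤ Γ.card :=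
  Finset.card_le_card (supp_proj_subset Γ x)

lemma l0_smul_le (c : ℝ) (x : Vec d) : l0 (c • x) ≤ l0 x := by
  refine Finset.card_le_card fun i hi => ?_
  simp only [mem_supp, PiLp.smul_apply, smul_eq_mul] at hi ⊢
  exact right_ne_zero_of_mul hi

/-! ### Hard thresholding -/

/-- The number of indices that come before `i` in the order by decreasing magnitude. -/
def magnitudeRank (v : Vec d) (i : Fin d) : ℕ :=
  (Finset.univ.filter fun j => |v i| < |v j| ∨ (|v j| = |v i| ∧ j < i)).card

lemma magnitudeRank_lt {v : Vec d} {i j : Fin d}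
    (h : |v i| < |v j| ∨ (|v j| = |v i| ∧ j < i)) : magnitudeRank v j < magnitudeRank v i := by
  refine Finset.card_lt_card (Finset.ssubset_iff_of_subset ?_ |>.2 ⟨j, by simpa using h, by simp⟩)
  intro l hl
  simp only [Finset.mem_filter, Finset.mem_univ, true_and] at hl ⊢
  rcases hl with hl | ⟨hl, hl'⟩ <;> rcases h with h | ⟨h, h'⟩
  · exact Or.inl (h.trans hl)
  · exact Or.inl (h ▸ hl)
  · exact Or.inl (hl ▸ h)
  · exact Or.inr ⟨hl.trans h, hl'.trans h'⟩

lemma magnitudeRank_injective (v : Vec d) : Function.Injective (magnitudeRank v) := by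
  intro i j hij
  by_contra hne
  rcases lt_trichotomy |v i| |v j| with h | h | h
  · exact (magnitudeRank_lt (Or.inl h)).ne' hij
  · rcases lt_or_gt_of_ne hne with h' | h'
    · exact (magnitudeRank_lt (Or.inr ⟨h, h'⟩)).ne hij
    · exact (magnitudeRank_lt (Or.inr ⟨h.symm, h'⟩)).ne' hij
  · exact (magnitudeRank_lt (Or.inl h)).ne hij

lemma magnitudeRank_lt_dim (v : Vec d) (i : Fin d) : magnitudeRank v i < d := by
  have : magnitudeRank v i < (Finset.univ : Finset (Fin d)).card := by
    refine Finset.card_lt_card (Finset.ssubset_iff_of_subset (Finset.subset_univ _) |>.2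
      ⟨i, by simp, by simp⟩)
  simpa using this

/-- Tie-breaking makes the rank injective, hence a bijection onto `{0, …, d - 1}`, and exactly `k`
ranks lie below `k`. -/
lemma card_topIndices {k : ℕ} (hk : k ≤ d) (v : Vec d) : (topIndices k v).card = k := by
  have himg : Finset.univ.image (magnitudeRank v) = Finset.range d := by
    refine Finset.eq_of_subset_of_card_le ?_ ?_
    · intro r hr
      obtain ⟨i, -, rfl⟩ := Finset.mem_image.1 hr
      exact Finset.mem_range.2 (magnitudeRank_lt_dim v i)
    · rw [Finset.card_image_of_injective _ (magnitudeRank_injective v)]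
      simp
  have : (topIndices k v).image (magnitudeRank v) = Finset.range k := by
    ext r
    simp only [Finset.mem_image, Finset.mem_range]
    constructor
    · rintro ⟨i, hi, rfl⟩
      exact (Finset.mem_filter.1 hi).2
    · intro hr
      have : r ∈ Finset.univ.image (magnitudeRank v) := by
        rw [himg]; exact Finset.mem_range.2 (hr.trans_le hk)
      obtain ⟨i, -, rfl⟩ := Finset.mem_image.1 this
      exact ⟨i, Finset.mem_filter.2 ⟨Finset.mem_univ _, hr⟩, rfl⟩
  rw [← Finset.card_image_of_injective _ (magnitudeRank_injective v), this, Finset.card_range]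

lemma abs_le_of_mem_topIndices {k : ℕ} {v : Vec d} {i j : Fin d} (hi : i ∈ topIndices k v)
    (hj : j ∉ topIndices k v) : |v j| ≤ |v i| := by
  have hi : magnitudeRank v i < k := (Finset.mem_filter.1 hi).2
  have hj : ¬ magnitudeRank v j < k := fun h => hj (Finset.mem_filter.2 ⟨Finset.mem_univ _, h⟩)
  by_contra h
  have := magnitudeRank_lt (v := v) (Or.inl (not_le.1 h))
  omega

lemma rho_nonneg {d k K : ℕ} (hK : K ≤ k) (hk : k ≤ d) : 0 ≤ rho d k K := by
  have h1 : (K : ℝ) ≤ k := by exact_mod_cast hK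
  have h2 : (k : ℝ) ≤ d := by exact_mod_cast hk
  have h3 : 0 ≤ min (K : ℝ) ((d : ℝ) - k) := le_min (by positivity) (by linarith)
  unfold rho
  exact div_nonneg h3 (by linarith)

lemma one_le_expansiveness {d k K : ℕ} (hK : K ≤ k) (hk : k ≤ d) : 1 ≤ expansiveness d k K := by
  have := rho_nonneg hK hk
  unfold expansiveness
  have := Real.sqrt_nonneg ((4 + rho d k K) * rho d k K)
  linarith

/-- This quadratic equation is the only property of the closed formula for `ν` that the thresholding
bound needs besides `1 ≤ ν`. -/
lemma expansiveness_sub_one_sq {d k K : ℕ} (hK : K ≤ k) (hk : k ≤ d) :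
    (expansiveness d k K - 1) ^ 2 = rho d k K * expansiveness d k K := by
  have := rho_nonneg hK hk
  unfold expansiveness
  have := Real.sq_sqrt (show 0 ≤ (4 + rho d k K) * rho d k K by positivity)
  nlinarith

/-- The tight bound of hard thresholding. -/
lemma norm_sq_proj_top_sub_le {k K : ℕ} (hK : K ≤ k) (hk : k ≤ d) {T : Finset (Fin d)}
    (hT : T.card = k) {b x : Vec d} (hb : ∀ i ∈ T, ∀ j ∉ T, |b j| ≤ |b i|) (hx : l0 x ≤ K) :
    ‖proj T b - x‖ ^ 2 ≤ expansiveness d k K * ‖b - x‖ ^ 2 := by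
  set ν := expansiveness d k K
  have hν1 : 1 ≤ ν := one_le_expansiveness hK hk
  have hνsq : (ν - 1) ^ 2 = rho d k K * ν := expansiveness_sub_one_sq hK hk
  have hρ0 := rho_nonneg hK hk
  set ρ := rho d k K with hρ
  set U := T \ supp x
  set W := supp x \ T
  set Y := ∑ i ∈ U, b i ^ 2
  set B := ∑ i ∈ W, b i ^ 2
  have hcardU : k ≤ U.card + (K - W.card) ∧ W.card ≤ K ∧ W.card ≤ d - k := by
    have h1 := Finset.card_sdiff_add_card_inter T (supp x)
    have h2 := Finset.card_sdiff_add_card_inter (supp x) T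
    rw [Finset.inter_comm] at h2
    have h3 : W.card ≤ (Tᶜ).card := Finset.card_le_card fun i hi => by
      simp only [W, Finset.mem_sdiff] at hi
      exact Finset.mem_compl.2 hi.2
    rw [Finset.card_compl, hT, Fintype.card_fin] at h3
    have h4 : (supp x).card ≤ K := hx
    change U.card + _ = _ at h1
    change W.card + _ = _ at h2
    omega
  -- Every entry of `b` missed on `W` is at most every entry kept on `U`, so `B / |W| ≤ Y / |U|`.
  -- Counting gives `|U| ≥ k - K + |W|` and `|W| ≤ min K (d - k)`, and `w / (k - K + w)` increases
  -- with `w` up to `ρ`.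
  have hBY : B ≤ ρ * Y := by
    by_cases hW : W.card = 0
    · have : W = ∅ := Finset.card_eq_zero.1 hW
      simp only [B, this, Finset.sum_empty]
      exact mul_nonneg hρ0 (Finset.sum_nonneg fun i _ => sq_nonneg _)
    · obtain ⟨h1, h2, h3⟩ := hcardU
      have hpair : (U.card : ℝ) * B ≤ W.card * Y := by
        have : ∑ i ∈ U, ∑ j ∈ W, b j ^ 2 ≤ ∑ i ∈ U, ∑ j ∈ W, b i ^ 2 := by
          refine Finset.sum_le_sum fun i hi => Finset.sum_le_sum fun j hj => ?_
          exact sq_le_sq.2 (hb i (Finset.mem_sdiff.1 hi).1 j (Finset.mem_sdiff.1 hj).2)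
        simpa [B, Y, ← Finset.mul_sum] using this
      have hY : 0 ≤ Y := Finset.sum_nonneg fun i _ => sq_nonneg _
      set w : ℝ := (W.card : ℝ)
      set M : ℝ := min (K : ℝ) ((d : ℝ) - k) with hM
      have hKk : (K : ℝ) ≤ k := by exact_mod_cast hK
      have hw : 0 < w := by simp only [w]; exact_mod_cast Nat.pos_of_ne_zero hW
      have hwM : w ≤ M := by
        refine le_min (by simp only [w]; exact_mod_cast h2) ?_
        have : W.card + k ≤ d := by omega
        have : w + k ≤ d := by simp only [w]; exact_mod_cast this
        linarith
      have hU : (k : ℝ) - K + w ≤ U.card := by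
        have : k + W.card ≤ U.card + K := by omega
        have : (k : ℝ) + w ≤ U.card + K := by simp only [w]; exact_mod_cast this
        linarith
      have hB : 0 ≤ B := Finset.sum_nonneg fun i _ => sq_nonneg _
      have e1 : ((k : ℝ) - K + w) * B ≤ w * Y := (mul_le_mul_of_nonneg_right hU hB).trans hpair
      have hden : 0 < (k : ℝ) - K + M := by linarith
      have hρe : ρ = M / ((k : ℝ) - K + M) := rfl
      have e2 : B ≤ w / ((k : ℝ) - K + w) * Y := by
        rw [div_mul_eq_mul_div, le_div_iff₀ (by linarith)]
        linarith
      refine e2.trans (mul_le_mul_of_nonneg_right ?_ hY)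
      rw [hρe, div_le_div_iff₀ (by linarith) hden]
      nlinarith
  -- Young's inequality with the weight for which the difference of the two sides is exactly `((ν -
  -- 1)(b - x) + b)²`. After summation `ν B ≤ ν ρ Y = (ν - 1)² Y`, and a factor `ν - 1` cancels; `ν
  -- = 1` forces `B = 0` and is treated apart.
  have hterm : ∀ i ∈ W, (ν - 1) * x i ^ 2 ≤ (ν - 1) * ν * (b i - x i) ^ 2 + ν * b i ^ 2 := by
    intro i _
    nlinarith [sq_nonneg ((ν - 1) * (b i - x i) + b i)]
  have hW : Y + ∑ i ∈ W, x i ^ 2 ≤ ν * (Y + ∑ i ∈ W, (b i - x i) ^ 2) := by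
    have hY : 0 ≤ Y := Finset.sum_nonneg fun i _ => sq_nonneg _
    rcases hν1.eq_or_lt with h | h
    · have hρz : ρ = 0 := by
        rw [← h] at hνsq
        linarith
      rw [hρz, zero_mul] at hBY
      have hB0 : ∀ i ∈ W, b i ^ 2 = 0 := by
        refine (Finset.sum_eq_zero_iff_of_nonneg fun i _ => sq_nonneg _).1 (le_antisymm hBY ?_)
        exact Finset.sum_nonneg fun i _ => sq_nonneg _
      rw [← h, one_mul]
      refine add_le_add_right (Finset.sum_le_sum fun i hi => ?_) _
      have := pow_eq_zero_iff (two_ne_zero) |>.1 (hB0 i hi)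
      rw [this]
      nlinarith
    · have := Finset.sum_le_sum hterm
      rw [Finset.sum_add_distrib, ← Finset.mul_sum, ← Finset.mul_sum, ← Finset.mul_sum] at this
      change _ ≤ _ + ν * B at this
      have h2 : ν * B ≤ ν * (ρ * Y) := mul_le_mul_of_nonneg_left hBY (by linarith)
      refine le_of_mul_le_mul_left ?_ (sub_pos.2 h)
      nlinarith
  have hsplit : ∀ g : Fin d → ℝ, ∑ i, g i =
      (∑ i ∈ T ∩ supp x, g i + ∑ i ∈ U, g i) + (∑ i ∈ W, g i + ∑ i ∈ Tᶜ \ supp x, g i) := by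
    intro g
    rw [← Finset.sum_add_sum_compl T g]
    congr 1
    · exact (Finset.sum_inter_add_sum_sdiff T (supp x) g).symm
    · rw [← Finset.sum_inter_add_sum_sdiff Tᶜ (supp x) g]
      congr 1
      refine Finset.sum_congr ?_ fun _ _ => rfl
      ext i
      simp [W, and_comm]
  rw [norm_sq_eq_sum, norm_sq_eq_sum, hsplit, hsplit]
  have a1 : ∑ i ∈ T ∩ supp x, (proj T b - x) i ^ 2 = ∑ i ∈ T ∩ supp x, (b - x) i ^ 2 :=
    Finset.sum_congr rfl fun i hi => by simp [(Finset.mem_inter.1 hi).1]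
  have a2 : ∑ i ∈ U, (proj T b - x) i ^ 2 = Y := Finset.sum_congr rfl fun i hi => by
    have := Finset.mem_sdiff.1 hi
    have h0 : x i = 0 := by simpa using this.2
    simp [this.1, h0]
  have a3 : ∑ i ∈ U, (b - x) i ^ 2 = Y := Finset.sum_congr rfl fun i hi => by
    have := Finset.mem_sdiff.1 hi
    have h0 : x i = 0 := by simpa using this.2
    simp [h0]
  have a4 : ∑ i ∈ W, (proj T b - x) i ^ 2 = ∑ i ∈ W, x i ^ 2 :=
    Finset.sum_congr rfl fun i hi => by simp [(Finset.mem_sdiff.1 hi).2]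
  have a5 : ∑ i ∈ Tᶜ \ supp x, (proj T b - x) i ^ 2 = 0 :=
    Finset.sum_eq_zero fun i hi => by
      have := Finset.mem_sdiff.1 hi
      have h0 : x i = 0 := by simpa using this.2
      simp [Finset.mem_compl.1 this.1, h0]
  have a6 : ∑ i ∈ W, (b - x) i ^ 2 = ∑ i ∈ W, (b i - x i) ^ 2 := rfl
  have a7 : 0 ≤ ∑ i ∈ Tᶜ \ supp x, (b - x) i ^ 2 := Finset.sum_nonneg fun i _ => sq_nonneg _
  have a8 : 0 ≤ ∑ i ∈ T ∩ supp x, (b - x) i ^ 2 := Finset.sum_nonneg fun i _ => sq_nonneg _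
  rw [a1, a2, a3, a4, a5, a6]
  nlinarith

/-- The kept indices lie in `Γ`, so they remain the largest entries of `proj Γ b` and thresholding
does not see the rest of `b`. Applying the tight bound to `proj Γ b` localizes the right-hand side
to a sparse set, where RSS is available. -/
lemma norm_sq_hardThreshold_sub_le {k K : ℕ} (hK : K ≤ k) (hk : k ≤ d) {b x : Vec d}
    (hx : l0 x ≤ K) {Γ : Finset (Fin d)} (hΓ : topIndices k b ⊆ Γ) (hxΓ : supp x ⊆ Γ) :
    ‖hardThreshold k b - x‖ ^ 2 ≤ expansiveness d k K * ‖proj Γ (b - x)‖ ^ 2 := by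
  have h := norm_sq_proj_top_sub_le hK hk (card_topIndices hk b) (b := proj Γ b) (x := x) ?_ hx
  · have e : proj (topIndices k b) (proj Γ b) = hardThreshold k b := by
      ext i
      by_cases hi : i ∈ topIndices k b
      · simp [hardThreshold, hi, hΓ hi]
      · simp [hardThreshold, hi]
    rwa [e, ← proj_eq_self hxΓ, ← proj_sub, proj_eq_self hxΓ] at h
  · intro i hi j hj
    have := abs_le_of_mem_topIndices hi hj
    by_cases hjΓ : j ∈ Γ <;> simp [hΓ hi, hjΓ, this]

lemma norm_ballProj_le {R : ℝ} (hR : 0 < R) (v : Vec d) : ‖ballProj R v‖ ≤ R := by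
  have hm : 0 < max 1 (‖v‖ / R) := lt_max_of_lt_left one_pos
  rw [ballProj, norm_smul, norm_inv, Real.norm_of_nonneg hm.le, inv_mul_le_iff₀ hm]
  calc ‖v‖ = ‖v‖ / R * R := by field_simp
    _ ≤ _ := mul_le_mul_of_nonneg_right (le_max_right _ _) hR.le

lemma norm_ballProj_sub_le {R : ℝ} (hR : 0 < R) (v : Vec d) {x : Vec d} (hx : ‖x‖ ≤ R) :
    ‖ballProj R v - x‖ ≤ ‖v - x‖ := by
  unfold ballProj
  rcases le_total (‖v‖ / R) 1 with h | h
  · simp [max_eq_left h]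
  · rw [max_eq_right h, inv_div]
    have hv : R ≤ ‖v‖ := by rwa [le_div_iff₀ hR, one_mul] at h
    have hv0 : 0 < ‖v‖ := hR.trans_le hv
    set c := R / ‖v‖
    have hc : c * ‖v‖ = R := by simp only [c]; field_simp
    have hc1 : c ≤ 1 := (div_le_one hv0).2 hv
    refine le_of_sq_le_sq ?_ (norm_nonneg _)
    rw [norm_sub_sq_real, norm_sub_sq_real, norm_smul, real_inner_smul_left, Real.norm_of_nonneg
      (by positivity)]
    -- As `R = c ‖v‖`, this makes the difference of the squared distances at least `(1 - c)² ‖v‖²`.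
    have h1 : inner ℝ v x ≤ ‖v‖ * R := (real_inner_le_norm _ _).trans (by gcongr)
    rw [← hc] at h1
    nlinarith [mul_nonneg (sub_nonneg.2 hc1) (sub_nonneg.2 h1),
      mul_nonneg (sub_nonneg.2 hc1) (mul_nonneg (sub_nonneg.2 hc1) (sq_nonneg ‖v‖))]

end Vectors

/-! ### Regularized least squares -/

section LeastSquares

variable {n d : ℕ}

/-- The Hessian of `(y - ⟪a, x⟫)² / 2 + γ / 2 ‖x‖²`, applied to `z`. -/
def hess (γ : ℝ) (a z : Vec d) : Vec d := (inner ℝ a z) • a + γ • z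

/-- The gradient of `(y - ⟪a, x⟫)² / 2 + γ / 2 ‖x‖²` at `x`. -/
def lsGrad (γ : ℝ) (a : Vec d) (y : ℝ) (x : Vec d) : Vec d := hess γ a x - y • a

/-- The average of a finite family of vectors. -/
def avg {E : Type*} [AddCommGroup E] [Module ℝ E] (g : Fin n → E) : E := (n : ℝ)⁻¹ • ∑ i, g i

lemma avg_add {E : Type*} [AddCommGroup E] [Module ℝ E] (g h : Fin n → E) :
    avg (fun i => g i + h i) = avg g + avg h := by
  simp [avg, Finset.sum_add_distrib]

lemma avg_sub {E : Type*} [AddCommGroup E] [Module ℝ E] (g h : Fin n → E) :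
    avg (fun i => g i - h i) = avg g - avg h := by
  simp [avg, Finset.sum_sub_distrib, smul_sub]

lemma avg_smul {E : Type*} [AddCommGroup E] [Module ℝ E] (c : ℝ) (g : Fin n → E) :
    avg (fun i => c • g i) = c • avg g := by
  simp only [avg, ← Finset.smul_sum]
  rw [smul_comm]

lemma avg_mul_left (c : ℝ) (g : Fin n → ℝ) : avg (fun i => c * g i) = c * avg g :=
  avg_smul c g

lemma avg_const {E : Type*} [AddCommGroup E] [Module ℝ E] (hn : 0 < n) (c : E) :
    avg (fun _ : Fin n => c) = c := by
  have : (n : ℝ) ≠ 0 := by exact_mod_cast hn.ne'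
  simp [avg, ← Nat.cast_smul_eq_nsmul ℝ, smul_smul, inv_mul_cancel₀ this]

lemma avg_le_avg {g h : Fin n → ℝ} (H : ∀ i, g i ≤ h i) : avg g ≤ avg h :=
  mul_le_mul_of_nonneg_left (Finset.sum_le_sum fun i _ => H i) (by positivity)

lemma avg_le_of_forall_le (hn : 0 < n) {g : Fin n → ℝ} {c : ℝ} (H : ∀ i, g i ≤ c) :
    avg g ≤ c :=
  (avg_le_avg H).trans_eq (avg_const hn c)

lemma inner_avg (x : Vec d) (g : Fin n → Vec d) :
    inner ℝ x (avg g) = avg fun i => inner ℝ x (g i) := by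
  simp [avg, inner_smul_right, inner_sum]

lemma hess_sub (γ : ℝ) (a x y : Vec d) : hess γ a (x - y) = hess γ a x - hess γ a y := by
  simp only [hess, inner_sub_right]; module

lemma hess_smul (γ c : ℝ) (a x : Vec d) : hess γ a (c • x) = c • hess γ a x := by
  simp only [hess, inner_smul_right]; module

lemma lsGrad_sub (γ : ℝ) (a : Vec d) (y : ℝ) (x x' : Vec d) :
    lsGrad γ a y x - lsGrad γ a y x' = hess γ a (x - x') := by
  simp [lsGrad, hess_sub]

lemma inner_hess_self (γ : ℝ) (a z : Vec d) :
    inner ℝ z (hess γ a z) = (inner ℝ a z) ^ 2 + γ * ‖z‖ ^ 2 := by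
  simp only [hess, inner_add_right, inner_smul_right, real_inner_self_eq_norm_sq,
    real_inner_comm a z]
  ring

lemma hasGradientAt_leastSquares (γ : ℝ) (a : Vec d) (y : ℝ) (x : Vec d) :
    HasGradientAt (fun x => (y - inner ℝ a x) ^ 2 / 2 + γ / 2 * ‖x‖ ^ 2) (lsGrad γ a y x) x := by
  have h1 : HasFDerivAt (fun x : Vec d => y - inner ℝ a x) (-(innerSL ℝ a)) x :=
    ((innerSL ℝ a).hasFDerivAt (x := x)).const_sub y
  have h2 := (hasStrictFDerivAt_norm_sq x).hasFDerivAt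
  have h3 := ((h1.pow 2).mul_const (1 / 2 : ℝ)).add (h2.const_mul (γ / 2))
  rw [hasGradientAt_iff_hasFDerivAt]
  have h4 : (fun x : Vec d => (y - inner ℝ a x) ^ 2 / 2 + γ / 2 * ‖x‖ ^ 2) =
      ((fun x : Vec d => (y - inner ℝ a x) ^ 2 * (1 / 2)) + fun x => γ / 2 * ‖x‖ ^ 2) := by
    ext x; simp only [Pi.add_apply]; ring
  rw [h4]
  refine h3.congr_fderiv ?_
  ext z
  simp [lsGrad, hess]
  ring

variable {γ : ℝ} {a : Fin n → Vec d} {y : Fin n → ℝ}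

/-- The gradient of the averaged objective. -/
def avgGrad (γ : ℝ) (a : Fin n → Vec d) (y : Fin n → ℝ) (x : Vec d) : Vec d :=
  avg fun i => lsGrad γ (a i) (y i) x

/-- The averaged Hessian applied to `z`. -/
def avgHess (γ : ℝ) (a : Fin n → Vec d) (z : Vec d) : Vec d := avg fun i => hess γ (a i) z

/-- The quadratic form of the averaged Hessian. -/
def quadForm (γ : ℝ) (a : Fin n → Vec d) (z : Vec d) : ℝ := inner ℝ z (avgHess γ a z)

lemma quadForm_eq_avg (z : Vec d) :
    quadForm γ a z = avg fun i => inner ℝ z (hess γ (a i) z) := inner_avg _ _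

lemma avgGrad_sub (x x' : Vec d) :
    avgGrad γ a y x - avgGrad γ a y x' = avgHess γ a (x - x') := by
  simp only [avgGrad, avgHess, ← avg_sub, lsGrad_sub]

lemma quadForm_smul (c : ℝ) (z : Vec d) : quadForm γ a (c • z) = c ^ 2 * quadForm γ a z := by
  simp only [quadForm_eq_avg, hess_smul, real_inner_smul_left, real_inner_smul_right, avg_mul_left]
  ring

lemma quadForm_nonneg (hγ : 0 ≤ γ) (z : Vec d) : 0 ≤ quadForm γ a z := by
  rw [quadForm_eq_avg]
  refine mul_nonneg (by positivity) (Finset.sum_nonneg fun i _ => ?_)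
  rw [inner_hess_self]
  positivity

/-- The losses of regularized least squares with design rows `a i` and responses `y i`. -/
def lsLoss (γ : ℝ) (a : Fin n → Vec d) (y : Fin n → ℝ) (i : Fin n) (x : Vec d) : ℝ :=
  (y i - inner ℝ (a i) x) ^ 2 / 2 + γ / 2 * ‖x‖ ^ 2

lemma gradient_lsLoss (i : Fin n) (x : Vec d) :
    gradient (lsLoss γ a y i) x = lsGrad γ (a i) (y i) x :=
  (hasGradientAt_leastSquares γ (a i) (y i) x).gradient

lemma gradient_objective (x : Vec d) :
    gradient (objective (lsLoss γ a y)) x = avgGrad γ a y x := by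
  refine HasGradientAt.gradient ?_
  rw [hasGradientAt_iff_hasFDerivAt]
  have h : HasFDerivAt (fun x => ∑ i, lsLoss γ a y i x)
      (∑ i, InnerProductSpace.toDual ℝ (Vec d) (lsGrad γ (a i) (y i) x)) x :=
    HasFDerivAt.fun_sum fun i _ =>
      hasGradientAt_iff_hasFDerivAt.1 (hasGradientAt_leastSquares γ (a i) (y i) x)
  refine (h.const_mul (n : ℝ)⁻¹).congr_fderiv ?_
  simp [avgGrad, avg, map_sum]

/-- The second-order expansion is exact for a quadratic, so gap and quadratic form differ only by
the linear term. -/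
lemma objective_sub (x x' : Vec d) :
    objective (lsLoss γ a y) x - objective (lsLoss γ a y) x' =
      inner ℝ (x - x') (avgGrad γ a y x') + quadForm γ a (x - x') / 2 := by
  have h : ∀ i, lsLoss γ a y i x - lsLoss γ a y i x' =
      inner ℝ (x - x') (lsGrad γ (a i) (y i) x') +
        (1 / 2) * inner ℝ (x - x') (hess γ (a i) (x - x')) := by
    intro i
    rw [inner_hess_self]
    simp only [lsLoss, lsGrad, hess, inner_sub_right, inner_add_right, inner_smul_right,
      inner_sub_left, norm_sub_sq_real, real_inner_self_eq_norm_sq, real_inner_comm (a i)]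
    ring
  rw [quadForm_eq_avg, avgGrad, inner_avg, div_eq_inv_mul, ← one_div, ← avg_mul_left, ← avg_add]
  simp only [← h]
  exact (avg_sub (fun i => lsLoss γ a y i x) fun i => lsLoss γ a y i x').symm

/-- The Hessian is constant, so testing the curvature condition at the base point `0` loses nothing;
the same holds for RSS below. -/
lemma quadForm_ge_of_RSC {r : ℕ} {α : ℝ} (h : RSC (objective (lsLoss γ a y)) r α) {z : Vec d}
    (hz : l0 z ≤ r) : α * ‖z‖ ^ 2 ≤ quadForm γ a z := by
  have h1 := h.2.2 0 z (by rwa [l0_sub_comm, sub_zero])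
  rw [gradient_objective, objective_sub, real_inner_comm] at h1
  simp only [sub_zero] at h1
  linarith

lemma norm_hess_le_of_RSS {r : ℕ} {L : ℝ} {i : Fin n} (h : RSS (lsLoss γ a y i) r L) {z : Vec d}
    (hz : l0 z ≤ r) : ‖hess γ (a i) z‖ ≤ L * ‖z‖ := by
  have h1 := h.2 0 z (by rwa [l0_sub_comm, sub_zero])
  rw [gradient_lsLoss, gradient_lsLoss, lsGrad_sub] at h1
  simpa using h1

/-- Restricted co-coercivity. -/
lemma norm_sq_proj_hess_le {r : ℕ} {L : ℝ} (hγ : 0 ≤ γ) {b : Vec d}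
    (hL : ∀ z : Vec d, l0 z ≤ r → ‖hess γ b z‖ ≤ L * ‖z‖) {Γ : Finset (Fin d)} (hΓ : Γ.card ≤ r)
    {z : Vec d} (hz : supp z ⊆ Γ) :
    ‖proj Γ (hess γ b z)‖ ^ 2 ≤ L * inner ℝ z (hess γ b z) := by
  set w := proj Γ (hess γ b z)
  have hwΓ : supp w ⊆ Γ := supp_proj_subset _ _
  have hw : l0 w ≤ r := (Finset.card_le_card hwΓ).trans hΓ
  have h1 : inner ℝ w (hess γ b z) = ‖w‖ ^ 2 := by
    rw [← real_inner_self_eq_norm_sq, inner_eq_inner_proj hwΓ]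
  have h2 : inner ℝ w (hess γ b w) ≤ L * ‖w‖ ^ 2 :=
    (real_inner_le_norm _ _).trans (by nlinarith [hL w hw, norm_nonneg w])
  -- Cauchy–Schwarz for the positive semidefinite form of the Hessian. With `w` sparse, the left
  -- side is `‖w‖⁴` and the first factor on the right is at most `L ‖w‖²`.
  have h3 : (inner ℝ w (hess γ b z)) ^ 2 ≤
      inner ℝ w (hess γ b w) * inner ℝ z (hess γ b z) := by
    rw [inner_hess_self, inner_hess_self]
    simp only [hess, inner_add_right, inner_smul_right, real_inner_comm b w]
    have hc : (inner ℝ w z) ^ 2 ≤ ‖w‖ ^ 2 * ‖z‖ ^ 2 := by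
      rw [← mul_pow]
      exact sq_le_sq.2 ((abs_real_inner_le_norm w z).trans (le_abs_self _))
    set p := inner ℝ b w
    set q := inner ℝ b z
    set t := inner ℝ w z
    have h5 : 2 * p * q * t ≤ p ^ 2 * ‖z‖ ^ 2 + q ^ 2 * ‖w‖ ^ 2 := by
      refine (le_abs_self _).trans (abs_le_of_sq_le_sq ?_ (by positivity))
      have : (2 * p * q * t) ^ 2 ≤ 4 * p ^ 2 * q ^ 2 * (‖w‖ ^ 2 * ‖z‖ ^ 2) := by
        nlinarith [mul_nonneg (sq_nonneg p) (sq_nonneg q), mul_le_mul_of_nonneg_left hc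
          (mul_nonneg (sq_nonneg p) (sq_nonneg q))]
      nlinarith [sq_nonneg (p ^ 2 * ‖z‖ ^ 2 - q ^ 2 * ‖w‖ ^ 2)]
    nlinarith [mul_le_mul_of_nonneg_left h5 hγ, mul_le_mul_of_nonneg_left hc (sq_nonneg γ)]
  have hz0 : 0 ≤ inner ℝ z (hess γ b z) := by
    rw [inner_hess_self]; positivity
  rw [h1] at h3
  rcases eq_or_ne w 0 with h0 | h0
  · rcases le_or_gt 0 L with hLn | hLn
    · rw [h0]; simpa using mul_nonneg hLn hz0
    · have : ‖z‖ ≤ 0 := by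
        have := (norm_nonneg _).trans (hL z ((Finset.card_le_card hz).trans hΓ))
        nlinarith [norm_nonneg z]
      have hz : z = 0 := norm_le_zero_iff.1 this
      rw [h0, hz]; simp
  · have hpos : 0 < ‖w‖ ^ 2 := by positivity
    refine le_of_mul_le_mul_left ?_ hpos
    nlinarith [mul_le_mul_of_nonneg_right h2 hz0]

end LeastSquares

/-! ### One inner update -/

section Step

variable {n d : ℕ} {γ : ℝ} {a : Fin n → Vec d} {y : Fin n → ℝ}

lemma innerStep_lsLoss (k : ℕ) (R η : ℝ) (xs x : Vec d) (i : Fin n) :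
    innerStep (lsLoss γ a y) k R η xs x i =
      ballProj R (hardThreshold k (x - η • (hess γ (a i) (x - xs) + avgGrad γ a y xs))) := by
  simp only [innerStep, gradient_lsLoss, lsGrad_sub]
  rfl

lemma norm_innerStep_le {f : Fin n → Vec d → ℝ} {k : ℕ} {R η : ℝ} (hR : 0 < R) (xs x : Vec d)
    (i : Fin n) : ‖innerStep f k R η xs x i‖ ≤ R :=
  norm_ballProj_le hR _

lemma l0_innerStep_le {f : Fin n → Vec d → ℝ} {k : ℕ} {R η : ℝ} (hk : k ≤ d) (xs x : Vec d)
    (i : Fin n) : l0 (innerStep f k R η xs x i) ≤ k :=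
  (l0_smul_le _ _).trans ((l0_proj_le _ _).trans (card_topIndices hk _).le)

lemma norm_sub_le_two_mul {R : ℝ} {x x' : Vec d} (hx : ‖x‖ ≤ R) (hx' : ‖x'‖ ≤ R) :
    ‖x - x'‖ ≤ 2 * R := by
  have := norm_sub_le x x'
  linarith

lemma norm_sq_sub_le_two (u v : Vec d) : ‖u - v‖ ^ 2 ≤ 2 * ‖u‖ ^ 2 + 2 * ‖v‖ ^ 2 := by
  have := parallelogram_law_with_norm ℝ u v
  nlinarith [sq_nonneg ‖u + v‖]

lemma abs_inner_le_of_proj {z v : Vec d} {g : ℝ} {R : ℝ} (hz : ‖z‖ ≤ R)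
    (h : ‖proj (supp z) v‖ ≤ g) : |inner ℝ z v| ≤ R * g := by
  rw [inner_eq_inner_proj subset_rfl]
  exact (abs_real_inner_le_norm _ _).trans
    (mul_le_mul hz h (norm_nonneg _) ((norm_nonneg _).trans hz))

/-- The error term of one inner update: `g` bounds the restricted gradient at the optimum, `h`
bounds the off-support part of the averaged Hessian. -/
def stepError (L R η g h : ℝ) : ℝ :=
  4 * η * R * g + η ^ 2 * (2 * g ^ 2 + 8 * L * R * (h + g) + 2 * (h + g) ^ 2)

/-- The square is expanded on `Γ₀ ∪ T`, where `T` collects the kept indices outside `Γ₀` and depends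
on `i`. Splitting `G` into its parts on `Γ₀` and on `T` leaves a cross term with a fixed vector,
which averages exactly, and one with a small vector, which is bounded for each `i`. -/
lemma avg_norm_sq_innerStep_le {k K : ℕ} {R η α L g h : ℝ} (hn : 0 < n) (hK : K ≤ k) (hk : k ≤ d)
    (hγ : 0 ≤ γ) (hR : 0 < R) (hη : 0 < η) (hL0 : 0 ≤ L) (hh0 : 0 ≤ h)
    (hL : ∀ i, ∀ z : Vec d, l0 z ≤ 3 * k + K → ‖hess γ (a i) z‖ ≤ L * ‖z‖)
    (hα : ∀ z : Vec d, l0 z ≤ k + K → α * ‖z‖ ^ 2 ≤ quadForm γ a z)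
    {xhat : Vec d} (hxK : l0 xhat ≤ K) (hxR : ‖xhat‖ ≤ R)
    (hg : ∀ Γ : Finset (Fin d), Γ.card ≤ 3 * k + K → ‖proj Γ (avgGrad γ a y xhat)‖ ≤ g)
    (hh : ∀ (T : Finset (Fin d)) (z : Vec d), T.card ≤ k → l0 z ≤ k + K → Disjoint T (supp z) →
      ‖z‖ ≤ 2 * R → ‖proj T (avgHess γ a z)‖ ≤ h)
    {xs x : Vec d} (hxs : l0 xs ≤ k) (hxsR : ‖xs‖ ≤ R) (hx : l0 x ≤ k) (hxR' : ‖x‖ ≤ R) :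
    avg (fun i => ‖innerStep (lsLoss γ a y) k R η xs x i - xhat‖ ^ 2) ≤
      expansiveness d k K * ((1 - η * α) * ‖x - xhat‖ ^ 2
        - η * (1 - 2 * η * L) * quadForm γ a (x - xhat)
        + 2 * η ^ 2 * L * quadForm γ a (xs - xhat) + stepError L R η g h) := by
  have hg0 : 0 ≤ g := (norm_nonneg _).trans (hg ∅ (by simp))
  have hν : 0 ≤ expansiveness d k K := zero_le_one.trans (one_le_expansiveness hK hk)
  set ν := expansiveness d k K
  set z := x - xhat with hz
  set zs := xs - xhat with hzs
  set Γ₀ := (supp x ∪ supp xs) ∪ supp xhat with hΓ₀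
  set G := avgGrad γ a y xs with hG
  have hzΓ : supp z ⊆ Γ₀ := (supp_sub_subset _ _).trans (by
    intro j; simp only [hΓ₀, Finset.mem_union]; tauto)
  have hzsΓ : supp zs ⊆ Γ₀ := (supp_sub_subset _ _).trans (by
    intro j; simp only [hΓ₀, Finset.mem_union]; tauto)
  have hΓcard : Γ₀.card ≤ 2 * k + K := by
    have h1 := Finset.card_union_le (supp x ∪ supp xs) (supp xhat)
    have h2 := Finset.card_union_le (supp x) (supp xs)
    change Γ₀.card ≤ _ at h1
    unfold l0 at hx hxs hxK
    omega
  have hz0 : l0 z ≤ k + K := (l0_sub_le _ _).trans (by omega)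
  have hzs0 : l0 zs ≤ k + K := (l0_sub_le _ _).trans (by omega)
  have hzR : ‖z‖ ≤ 2 * R := norm_sub_le_two_mul hxR' hxR
  have hzsR : ‖zs‖ ≤ 2 * R := norm_sub_le_two_mul hxsR hxR
  have hGsub : G - avgGrad γ a y xhat = avgHess γ a zs := avgGrad_sub _ _
  have key : ∀ i, ‖innerStep (lsLoss γ a y) k R η xs x i - xhat‖ ^ 2 ≤
      ν * ((‖z‖ ^ 2 + η ^ 2 * (2 * ‖proj Γ₀ G‖ ^ 2 + 8 * L * R * (h + g) + 2 * (h + g) ^ 2))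
        + ((-2 * η) * inner ℝ z (hess γ (a i) (x - xs) + G)
        + ((2 * η ^ 2 * L) * inner ℝ z (hess γ (a i) z)
        + ((2 * η ^ 2 * L) * inner ℝ zs (hess γ (a i) zs)
        + (-4 * η ^ 2) * inner ℝ (proj Γ₀ G) (hess γ (a i) zs))))) := by
    intro i
    rw [innerStep_lsLoss]
    set v := hess γ (a i) (x - xs) + G with hv
    set T := topIndices k (x - η • v) \ Γ₀ with hT
    have hTcard : T.card ≤ k :=
      (Finset.card_le_card Finset.sdiff_subset).trans (card_topIndices hk _).le
    have hdisj : Disjoint Γ₀ T := Finset.disjoint_sdiff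
    have hΓT : (Γ₀ ∪ T).card ≤ 3 * k + K := (Finset.card_union_le _ _).trans (by omega)
    have hsubΓ : Γ₀ ⊆ Γ₀ ∪ T := Finset.subset_union_left
    have h1 : ‖ballProj R (hardThreshold k (x - η • v)) - xhat‖ ^ 2 ≤
        ν * ‖proj (Γ₀ ∪ T) (x - η • v - xhat)‖ ^ 2 := by
      refine (pow_le_pow_left₀ (norm_nonneg _) (norm_ballProj_sub_le hR _ hxR) 2).trans ?_
      refine norm_sq_hardThreshold_sub_le hK hk hxK ?_ ?_
      · intro j hj
        by_cases hjΓ : j ∈ Γ₀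
        · exact Finset.mem_union_left _ hjΓ
        · exact Finset.mem_union_right _ (Finset.mem_sdiff.2 ⟨hj, hjΓ⟩)
      · intro j hj
        simp only [hΓ₀, Finset.mem_union]; tauto
    have h2 : ‖proj (Γ₀ ∪ T) (x - η • v - xhat)‖ ^ 2 =
        ‖z‖ ^ 2 - 2 * η * inner ℝ z v + η ^ 2 * ‖proj (Γ₀ ∪ T) v‖ ^ 2 := by
      have : x - η • v - xhat = z - η • v := by rw [hz]; abel
      rw [this, proj_sub, proj_smul, proj_eq_self (hzΓ.trans hsubΓ), norm_sub_sq_real,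
        inner_smul_right, ← inner_eq_inner_proj (hzΓ.trans hsubΓ), norm_smul, mul_pow,
        Real.norm_eq_abs, sq_abs]
      ring
    have h3 : ‖proj (Γ₀ ∪ T) v‖ ^ 2 ≤ 2 * ‖proj (Γ₀ ∪ T) (hess γ (a i) z)‖ ^ 2 +
        2 * ‖proj (Γ₀ ∪ T) (hess γ (a i) zs - G)‖ ^ 2 := by
      have : v = hess γ (a i) z - (hess γ (a i) zs - G) := by
        rw [hv, hz, hzs, hess_sub, hess_sub, hess_sub]; abel
      rw [this, proj_sub]
      exact norm_sq_sub_le_two _ _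
    have h4 := norm_sq_proj_hess_le hγ (hL i) hΓT (hzΓ.trans hsubΓ)
    have h5 := norm_sq_proj_hess_le hγ (hL i) hΓT (hzsΓ.trans hsubΓ)
    -- `G` is the gradient at `x̂` plus the averaged Hessian at `zs`, and `T` avoids the support of
    -- `zs`: only off-diagonal blocks of the Hessian appear.
    have h6 : ‖proj T G‖ ≤ h + g := by
      have hTz : Disjoint T (supp zs) := (hdisj.mono_left hzsΓ).symm
      have e : G = avgHess γ a zs + avgGrad γ a y xhat := by rw [← hGsub]; abel
      rw [e, proj_add]
      exact (norm_add_le _ _).trans (add_le_add (hh T zs hTcard hzs0 hTz hzsR)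
        (hg T (by omega)))
    have h7 : ‖proj (Γ₀ ∪ T) (hess γ (a i) zs - G)‖ ^ 2 =
        ‖proj (Γ₀ ∪ T) (hess γ (a i) zs)‖ ^ 2 - 2 * inner ℝ (proj Γ₀ G) (hess γ (a i) zs)
          - 2 * inner ℝ (proj T G) (hess γ (a i) zs) + (‖proj Γ₀ G‖ ^ 2 + ‖proj T G‖ ^ 2) := by
      rw [proj_sub, norm_sub_sq_real, ← norm_sq_proj_union hdisj, inner_proj_proj,
        inner_proj_left, real_inner_comm, proj_union hdisj G, inner_add_left]
      ring
    have h8 : -(2 * L * R * (h + g)) ≤ inner ℝ (proj T G) (hess γ (a i) zs) := by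
      have e1 : ‖hess γ (a i) zs‖ ≤ L * (2 * R) :=
        (hL i zs (by omega)).trans (mul_le_mul_of_nonneg_left hzsR hL0)
      have e2 := abs_le.1 (abs_real_inner_le_norm (proj T G) (hess γ (a i) zs))
      have e3 : ‖proj T G‖ * ‖hess γ (a i) zs‖ ≤ (h + g) * (L * (2 * R)) :=
        mul_le_mul h6 e1 (norm_nonneg _) (by linarith)
      linarith [e2.1]
    have h9 : ‖proj T G‖ ^ 2 ≤ (h + g) ^ 2 := pow_le_pow_left₀ (norm_nonneg _) h6 2
    rw [h2] at h1
    refine h1.trans (mul_le_mul_of_nonneg_left ?_ hν)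
    have h10 : ‖proj (Γ₀ ∪ T) v‖ ^ 2 ≤ 2 * L * inner ℝ z (hess γ (a i) z)
        + 2 * L * inner ℝ zs (hess γ (a i) zs) - 4 * inner ℝ (proj Γ₀ G) (hess γ (a i) zs)
        + 2 * ‖proj Γ₀ G‖ ^ 2 + 8 * L * R * (h + g) + 2 * (h + g) ^ 2 := by
      rw [h7] at h3
      linarith
    have := mul_le_mul_of_nonneg_left h10 (sq_nonneg η)
    linarith
  refine (avg_le_avg key).trans ?_
  rw [avg_mul_left]
  refine mul_le_mul_of_nonneg_left ?_ hν
  simp only [avg_add, avg_mul_left, avg_const hn]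
  rw [← quadForm_eq_avg, ← quadForm_eq_avg, ← inner_avg, ← inner_avg]
  have m1 : avg (fun i => hess γ (a i) (x - xs) + G) = avgGrad γ a y xhat + avgHess γ a z := by
    rw [avg_add, avg_const hn, hz, ← avgGrad_sub (y := y)]
    change avgHess γ a (x - xs) + G = _
    rw [← avgGrad_sub (y := y)]
    abel
  have m2 : avg (fun i => hess γ (a i) zs) = G - avgGrad γ a y xhat := hGsub.symm
  rw [m1, m2, inner_add_right, inner_sub_right]
  change _ + (-2 * η * (_ + quadForm γ a z) + _) ≤ _
  have n1 : inner ℝ (proj Γ₀ G) G = ‖proj Γ₀ G‖ ^ 2 := by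
    rw [← inner_proj_proj, real_inner_self_eq_norm_sq]
  have n2 : inner ℝ (proj Γ₀ G) (avgGrad γ a y xhat) ≤ ‖proj Γ₀ G‖ * g := by
    rw [← inner_proj_proj]
    exact (real_inner_le_norm _ _).trans
      (mul_le_mul_of_nonneg_left (hg Γ₀ (by omega)) (norm_nonneg _))
  have n3 := (abs_le.1 (abs_inner_le_of_proj hzR (hg (supp z) (hz0.trans (by omega))))).1
  have n4 := hα z hz0
  -- The averaged cross term contributes `-4 ‖proj Γ₀ G‖²`, more than compensating the `+2 ‖proj Γ₀
  -- G‖²` from the expansion; completing the square leaves `2 g²`.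
  have n5 : η ^ 2 * (4 * (‖proj Γ₀ G‖ * g) - 2 * ‖proj Γ₀ G‖ ^ 2) ≤ η ^ 2 * (2 * g ^ 2) :=
    mul_le_mul_of_nonneg_left (by nlinarith [sq_nonneg (‖proj Γ₀ G‖ - g)]) (sq_nonneg _)
  have n6 := mul_le_mul_of_nonneg_left n2 (show 0 ≤ 4 * η ^ 2 by positivity)
  -- Half of the term `-2 η q(z)` is spent on strong convexity (`n8`); the other half absorbs `2 η²
  -- L q(z)`.
  have n7 := mul_le_mul_of_nonneg_left n3 hη.le
  have n8 := mul_le_mul_of_nonneg_left n4 hη.le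
  rw [n1]
  unfold stepError
  nlinarith

end Step

/-! ### Averaging over the random choices -/

section Expectation

variable {n d m : ℕ}

lemma innerIter_zero (f : Fin n → Vec d → ℝ) (k : ℕ) (R η : ℝ) (xs : Vec d) (I : Fin m → Fin n) :
    innerIter f k R η xs I 0 = xs := rfl

lemma innerIter_succ (f : Fin n → Vec d → ℝ) (k : ℕ) (R η : ℝ) (xs : Vec d) (I : Fin m → Fin n)
    (t : Fin m) : innerIter f k R η xs I t.succ =
      innerStep f k R η xs (innerIter f k R η xs I t.castSucc) (I t) := rfl

/-- The index `I t` is first used in passing from iterate `t` to iterate `t + 1`, so iterates up to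
and including `t` do not see it. -/
lemma innerIter_update (f : Fin n → Vec d → ℝ) (k : ℕ) (R η : ℝ) (xs : Vec d) (I : Fin m → Fin n)
    (t : Fin m) (i : Fin n) (j : Fin (m + 1)) (hj : j ≤ t.castSucc) :
    innerIter f k R η xs (Function.update I t i) j = innerIter f k R η xs I j := by
  induction j using Fin.induction with
  | zero => rw [innerIter_zero, innerIter_zero]
  | succ j ih =>
    have hlt : j < t := by
      rw [Fin.le_def] at hj
      rw [Fin.lt_def]
      simpa [Nat.succ_le_iff] using hj
    rw [innerIter_succ, innerIter_succ, ih (Fin.castSucc_le_castSucc_iff.2 hlt.le),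
      Function.update_of_ne hlt.ne]

lemma l0_innerIter_le {f : Fin n → Vec d → ℝ} {k : ℕ} {R η : ℝ} (hk : k ≤ d) {xs : Vec d}
    (hxs : l0 xs ≤ k) (I : Fin m → Fin n) (j : Fin (m + 1)) :
    l0 (innerIter f k R η xs I j) ≤ k := by
  induction j using Fin.induction with
  | zero => exact hxs
  | succ j _ => exact l0_innerStep_le hk _ _ _

lemma norm_innerIter_le {f : Fin n → Vec d → ℝ} {k : ℕ} {R η : ℝ} (hR : 0 < R) {xs : Vec d}
    (hxs : ‖xs‖ ≤ R) (I : Fin m → Fin n) (j : Fin (m + 1)) :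
    ‖innerIter f k R η xs I j‖ ≤ R := by
  induction j using Fin.induction with
  | zero => exact hxs
  | succ j _ => exact norm_innerStep_le hR _ _ _

/-- A sampled index may be averaged out if everything else does not depend on it. -/
lemma sum_eq_sum_avg_of_update (hn : 0 < n) (t : Fin m) (φ : (Fin m → Fin n) → Fin n → ℝ)
    (hφ : ∀ I i, φ (Function.update I t i) = φ I) :
    ∑ I, φ I (I t) = ∑ I, avg (φ I) := by
  have h : ∑ p : (Fin m → Fin n) × Fin n, φ p.1 p.2 =
      ∑ p : (Fin m → Fin n) × Fin n, φ p.1 (p.1 t) := by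
    -- Swapping the entry `I t` with a fresh index is an involution of the finite sample space. It
    -- replaces a conditional expectation.
    let e : (Fin m → Fin n) × Fin n → (Fin m → Fin n) × Fin n :=
      fun p => (Function.update p.1 t p.2, p.1 t)
    have he : Function.Involutive e := fun p => by simp [e]
    refine Fintype.sum_equiv he.toPerm _ _ fun p => ?_
    simp [e, hφ]
  rw [Fintype.sum_prod_type, Fintype.sum_prod_type] at h
  have hn' : (n : ℝ) ≠ 0 := by exact_mod_cast hn.ne'
  simp only [avg, ← Finset.smul_sum, h]
  simp [← Finset.mul_sum, inv_mul_cancel_left₀ hn']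

lemma sum_innerIter_succ (hn : 0 < n) (f : Fin n → Vec d → ℝ) (k : ℕ) (R η : ℝ) (xs : Vec d)
    (t : Fin m) (ψ : Vec d → ℝ) :
    ∑ I : Fin m → Fin n, ψ (innerIter f k R η xs I t.succ) =
      ∑ I : Fin m → Fin n,
        avg fun i => ψ (innerStep f k R η xs (innerIter f k R η xs I t.castSucc) i) := by
  simp only [innerIter_succ]
  refine sum_eq_sum_avg_of_update hn t
    (fun I i => ψ (innerStep f k R η xs (innerIter f k R η xs I t.castSucc) i)) fun I i => ?_
  ext i'
  rw [innerIter_update _ _ _ _ _ _ _ _ _ le_rfl]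

/-- Here `S` and `Q` are averages over a stage of the squared distance and of the quadratic form. If
`ν (1 - η α) ≤ 1`, the coefficient of `S` is nonpositive and `S` is dropped; otherwise `S ≤ Q / α`
moves it to the left. These are the two regimes of `convCoeff`, and the bound on the error
coefficient depends only on `η`, `L` and `convCoeff`, not on `ν` or `m` separately. -/
lemma le_convCoeff_mul_add {ν η α L Q S q e : ℝ} {m : ℕ} (hm : 0 < m) (hν : 1 ≤ ν) (hη : 0 < η)
    (hα : 0 < α) (hL : 0 < L) (hηL : η < 1 / (4 * L)) (hηα : η * α < 1)
    (hβ : 0 < convCoeff ν η α L m) (hS0 : 0 ≤ S) (he : 0 ≤ e) (hS : α * S ≤ Q)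
    (h : ν * η * (1 - 2 * η * L) * Q ≤
      (ν * (1 - η * α) - 1) * S + q / (α * m) + ν * (2 * η ^ 2 * L * q + e)) :
    Q ≤ convCoeff ν η α L m * q +
      e * (2 / η + convCoeff ν η α L m / (2 * η ^ 2 * L)) := by
  have hm' : (0 : ℝ) < m := by exact_mod_cast hm
  have hηL' : 4 * (η * L) < 1 := by
    rw [lt_div_iff₀ (by positivity)] at hηL
    linarith
  have hν0 : 0 < ν := by linarith
  have hηL0 : 0 < η * L := mul_pos hη hL
  have h12 : (1 : ℝ) / 2 < 1 - 2 * η * L := by linarith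
  by_cases hc : ν ≤ 1 / (1 - η * α)
  · have hc' : ν * (1 - η * α) ≤ 1 := by rwa [le_div_iff₀ (by linarith)] at hc
    have h1 : ν * η * (1 - 2 * η * L) * Q ≤ q / (α * m) + ν * (2 * η ^ 2 * L * q + e) := by
      nlinarith
    have hpos : 0 < ν * η * (1 - 2 * η * L) := by
      have : 0 < 1 - 2 * η * L := by linarith
      positivity
    have hne : (1 - 2 * η * L) ≠ 0 := by linarith
    have h2 : Q ≤ convCoeff ν η α L m * q + e / (η * (1 - 2 * η * L)) := by
      refine le_of_mul_le_mul_left (h1.trans_eq ?_) hpos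
      rw [convCoeff, if_pos hc]
      field_simp
      ring
    refine h2.trans (add_le_add_right ?_ _)
    rw [mul_add]
    have h3 : e / (η * (1 - 2 * η * L)) ≤ e * (2 / η) := by
      rw [div_le_iff₀ (by nlinarith)]
      have : e * (2 / η) * (η * (1 - 2 * η * L)) = e * (2 * (1 - 2 * η * L)) := by field_simp
      rw [this]
      nlinarith
    have : 0 ≤ e * (convCoeff ν η α L m / (2 * η ^ 2 * L)) := by positivity
    linarith
  · have hc' : 1 < ν * (1 - η * α) := by
      rw [not_le, div_lt_iff₀ (by linarith)] at hc
      linarith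
    set D := 2 * ν * η * α - 2 * ν * η ^ 2 * α * L - ν + 1 with hD
    have hβe : convCoeff ν η α L m = 1 / (D * m) + 2 * ν * η ^ 2 * α * L / D := by
      rw [convCoeff, if_neg hc]
    -- With `D ≤ 0` both summands of the coefficient would be nonpositive (division by zero giving
    -- `0`), against `0 < β`.
    have hDpos : 0 < D := by
      by_contra hneg
      have hneg := not_lt.1 hneg
      have h1 : 1 / (D * m) ≤ 0 :=
        div_nonpos_of_nonneg_of_nonpos zero_le_one (mul_nonpos_of_nonpos_of_nonneg hneg hm'.le)
      have h2 : 2 * ν * η ^ 2 * α * L / D ≤ 0 :=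
        div_nonpos_of_nonneg_of_nonpos (by positivity) hneg
      rw [hβe] at hβ
      linarith
    have h1 : D * Q ≤ q / m + 2 * ν * η ^ 2 * α * L * q + ν * α * e := by
      have e1 := mul_le_mul_of_nonneg_left h hα.le
      have e2 := mul_le_mul_of_nonneg_left hS (sub_nonneg.2 hc'.le)
      have e3 : α * (q / (α * m)) = q / m := by field_simp
      nlinarith
    have h2 : Q ≤ convCoeff ν η α L m * q + ν * α * e / D := by
      refine le_of_mul_le_mul_left (h1.trans_eq ?_) hDpos
      rw [hβe]
      field_simp
    refine h2.trans (add_le_add_right ?_ _)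
    -- `D` may be close to zero, but then `β` is large: the second summand of `β` controls `ν α /
    -- D`.
    have h3 : 2 * ν * η ^ 2 * α * L / D ≤ convCoeff ν η α L m := by
      rw [hβe]
      have : 0 ≤ 1 / (D * m) := by positivity
      linarith
    have h4 : ν * α * e / D = e * (2 * ν * η ^ 2 * α * L / D / (2 * η ^ 2 * L)) := by
      field_simp
    rw [h4]
    refine mul_le_mul_of_nonneg_left ?_ he
    have : 2 * ν * η ^ 2 * α * L / D / (2 * η ^ 2 * L) ≤
        convCoeff ν η α L m / (2 * η ^ 2 * L) := by gcongr
    have : 0 < 2 / η := by positivity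
    linarith

variable {γ : ℝ} {a : Fin n → Vec d} {y : Fin n → ℝ}

/-- The error term of one stage. -/
def stageError (L R η β g h : ℝ) : ℝ := stepError L R η g h * (2 / η + β / (2 * η ^ 2 * L))

/-- One stage contracts the quadratic form of the error by the factor `convCoeff`. -/
lemma sum_stage_le {k K : ℕ} {R η α L g h : ℝ} (hn : 0 < n) (hm : 0 < m) (hK : K ≤ k)
    (hk : k ≤ d) (hγ : 0 ≤ γ) (hR : 0 < R) (hη : 0 < η) (hα0 : 0 < α) (hL0 : 0 < L)
    (hηL : η < 1 / (4 * L)) (hηα : η * α < 1) (hh0 : 0 ≤ h)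
    (hβ : 0 < convCoeff (expansiveness d k K) η α L m)
    (hL : ∀ i, ∀ z : Vec d, l0 z ≤ 3 * k + K → ‖hess γ (a i) z‖ ≤ L * ‖z‖)
    (hα : ∀ z : Vec d, l0 z ≤ k + K → α * ‖z‖ ^ 2 ≤ quadForm γ a z)
    {xhat : Vec d} (hxK : l0 xhat ≤ K) (hxR : ‖xhat‖ ≤ R)
    (hg : ∀ Γ : Finset (Fin d), Γ.card ≤ 3 * k + K → ‖proj Γ (avgGrad γ a y xhat)‖ ≤ g)
    (hh : ∀ (T : Finset (Fin d)) (z : Vec d), T.card ≤ k → l0 z ≤ k + K → Disjoint T (supp z) →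
      ‖z‖ ≤ 2 * R → ‖proj T (avgHess γ a z)‖ ≤ h)
    {xs : Vec d} (hxs : l0 xs ≤ k) (hxsR : ‖xs‖ ≤ R) :
    ∑ c : StageChoice n m, quadForm γ a (stage (lsLoss γ a y) k R η xs c - xhat) ≤
      Fintype.card (StageChoice n m) *
        (convCoeff (expansiveness d k K) η α L m * quadForm γ a (xs - xhat) +
          stageError L R η (convCoeff (expansiveness d k K) η α L m) g h) := by
  have hg0 : 0 ≤ g := (norm_nonneg _).trans (hg ∅ (by simp))
  have hν1 := one_le_expansiveness hK hk
  set ν := expansiveness d k K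
  set f := lsLoss γ a y
  let X : (Fin m → Fin n) → Fin (m + 1) → Vec d := fun I => innerIter f k R η xs I
  let S : Fin (m + 1) → ℝ := fun t => ∑ I, ‖X I t - xhat‖ ^ 2
  let Q : Fin (m + 1) → ℝ := fun t => ∑ I, quadForm γ a (X I t - xhat)
  set N : ℝ := (n : ℝ) ^ m with hN
  have hNpos : 0 < N := by positivity
  have hm' : (0 : ℝ) < m := by exact_mod_cast hm
  set q := quadForm γ a (xs - xhat)
  set e := stepError L R η g h with he
  have he0 : 0 ≤ e := by rw [he, stepError]; positivity
  have hXk : ∀ I t, l0 (X I t) ≤ k := fun I t => l0_innerIter_le hk hxs I t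
  have hXR : ∀ I t, ‖X I t‖ ≤ R := fun I t => norm_innerIter_le hR hxsR I t
  have hcard : (Fintype.card (Fin m → Fin n) : ℝ) = N := by simp [hN]
  have hrec : ∀ t : Fin m, S t.succ ≤ ν * (1 - η * α) * S t.castSucc
      - ν * η * (1 - 2 * η * L) * Q t.castSucc + N * (ν * (2 * η ^ 2 * L * q + e)) := by
    intro t
    have h1 := sum_innerIter_succ hn f k R η xs t fun v => ‖v - xhat‖ ^ 2
    change S t.succ = _ at h1
    rw [h1]
    refine (Finset.sum_le_sum fun I _ => avg_norm_sq_innerStep_le hn hK hk hγ hR hη hL0.le hh0 hL hα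
      hxK hxR hg hh hxs hxsR (hXk I t.castSucc) (hXR I t.castSucc)).trans_eq ?_
    simp only [mul_add, mul_sub, Finset.sum_add_distrib, Finset.sum_sub_distrib, ← Finset.mul_sum,
      Finset.sum_const, Finset.card_univ, nsmul_eq_mul, hcard]
    simp only [S, Q, X]
    ring
  have hsum := Finset.sum_le_sum fun t (_ : t ∈ (Finset.univ : Finset (Fin m))) => hrec t
  simp only [Finset.sum_add_distrib, Finset.sum_sub_distrib, ← Finset.mul_sum, Finset.sum_const,
    Finset.card_univ, nsmul_eq_mul, Fintype.card_fin] at hsum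
  set Ssum := ∑ t : Fin m, S t.castSucc
  set Qsum := ∑ t : Fin m, Q t.castSucc with hQsum
  -- The two sides differ by the discarded last distance, which is nonnegative.
  have htel : Ssum ≤ S 0 + ∑ t : Fin m, S t.succ := by
    rw [← Fin.sum_univ_succ, Fin.sum_univ_castSucc]
    have : 0 ≤ S (Fin.last m) := Finset.sum_nonneg fun I _ => by positivity
    linarith
  have hS0 : α * S 0 ≤ N * q := by
    have : S 0 = N * ‖xs - xhat‖ ^ 2 := by simp [S, X, innerIter_zero, hN]
    rw [this]
    have := hα (xs - xhat) ((l0_sub_le _ _).trans (by omega))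
    nlinarith
  have hSQ : α * Ssum ≤ Qsum := by
    simp only [Ssum, Qsum, S, Q, Finset.mul_sum]
    exact Finset.sum_le_sum fun t _ => Finset.sum_le_sum fun I _ =>
      hα _ ((l0_sub_le _ _).trans (add_le_add (hXk _ _) hxK))
  have hS0' : 0 ≤ Ssum := Finset.sum_nonneg fun t _ => Finset.sum_nonneg fun I _ => by positivity
  -- Since the output index is uniform on `{0, …, m - 1}`, summing over it yields precisely the sum
  -- in the telescoped inequality, without the last iterate.
  have hlhs : ∑ c : StageChoice n m, quadForm γ a (stage f k R η xs c - xhat) = Qsum := by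
    rw [Fintype.sum_prod_type_right]
    rfl
  have hcard2 : (Fintype.card (StageChoice n m) : ℝ) = N * m := by simp [hN]
  rw [hlhs, hcard2]
  have hfin := le_convCoeff_mul_add (q := q) (Q := Qsum / (N * m)) (S := Ssum / (N * m)) hm hν1 hη
    hα0 hL0
    hηL hηα hβ (by positivity) he0 (by rw [← mul_div_assoc]; gcongr) ?_
  · rw [div_le_iff₀ (by positivity)] at hfin
    unfold stageError
    linarith
  · have h1 : ν * η * (1 - 2 * η * L) * Qsum ≤ (ν * (1 - η * α) - 1) * Ssum + N * q / α
        + m * (N * (ν * (2 * η ^ 2 * L * q + e))) := by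
      have : S 0 ≤ N * q / α := by rw [le_div_iff₀ hα0]; linarith
      linarith
    have hNm : 0 < N * m := by positivity
    refine le_of_mul_le_mul_left ?_ hNm
    calc N * m * (ν * η * (1 - 2 * η * L) * (Qsum / (N * m)))
        = ν * η * (1 - 2 * η * L) * Qsum := by field_simp
      _ ≤ _ := h1
      _ = _ := by field_simp

lemma l0_output_le {f : Fin n → Vec d → ℝ} {k : ℕ} {R η : ℝ} (hk : k ≤ d) {x0 : Vec d}
    (hx0 : l0 x0 ≤ k) (s : ℕ) (c : Fin s → StageChoice n m) : l0 (output f k R η x0 s c) ≤ k := by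
  induction s with
  | zero => exact hx0
  | succ s ih => exact l0_innerIter_le hk (ih _) _ _

lemma norm_output_le {f : Fin n → Vec d → ℝ} {k : ℕ} {R η : ℝ} (hR : 0 < R) {x0 : Vec d}
    (hx0 : ‖x0‖ ≤ R) (s : ℕ) (c : Fin s → StageChoice n m) : ‖output f k R η x0 s c‖ ≤ R := by
  induction s with
  | zero => exact hx0
  | succ s ih => exact norm_innerIter_le hR (ih _) _ _

lemma sum_output_succ (f : Fin n → Vec d → ℝ) (k : ℕ) (R η : ℝ) (x0 : Vec d) (s : ℕ)
    (ψ : Vec d → ℝ) :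
    ∑ c : Fin (s + 1) → StageChoice n m, ψ (output f k R η x0 (s + 1) c) =
      ∑ c : Fin s → StageChoice n m, ∑ c' : StageChoice n m,
        ψ (stage f k R η (output f k R η x0 s c) c') := by
  rw [← (Fin.snocEquiv fun _ : Fin (s + 1) => StageChoice n m).sum_comp, Fintype.sum_prod_type,
    Finset.sum_comm]
  refine Finset.sum_congr rfl fun c _ => Finset.sum_congr rfl fun c' _ => ?_
  simp [output, Fin.snocEquiv]

/-- HT-SVRG converges linearly, with an optimization error controlled by the restricted gradient at
the optimum and by the off-support part of the Hessian. -/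
theorem convergesLinearly_of_bounds {k K : ℕ} {R η α L g h : ℝ} (hn : 0 < n) (hm : 0 < m)
    (hK : K ≤ k) (hk : k ≤ d) (hγ : 0 ≤ γ) (hR : 0 < R) (hη : 0 < η) (hα0 : 0 < α) (hL0 : 0 < L)
    (hηL : η < 1 / (4 * L)) (hηα : η * α < 1) (hh0 : 0 ≤ h) {β : ℝ}
    (hβe : convCoeff (expansiveness d k K) η α L m = β) (hβ0 : 0 < β) (hβ1 : β < 1)
    (hL : ∀ i, ∀ z : Vec d, l0 z ≤ 3 * k + K → ‖hess γ (a i) z‖ ≤ L * ‖z‖)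
    (hα : ∀ z : Vec d, l0 z ≤ k + K → α * ‖z‖ ^ 2 ≤ quadForm γ a z)
    {xhat : Vec d} (hxK : l0 xhat ≤ K) (hxR : ‖xhat‖ ≤ R)
    (hg : ∀ Γ : Finset (Fin d), Γ.card ≤ 3 * k + K → ‖proj Γ (avgGrad γ a y xhat)‖ ≤ g)
    (hh : ∀ (T : Finset (Fin d)) (z : Vec d), T.card ≤ k → l0 z ≤ k + K → Disjoint T (supp z) →
      ‖z‖ ≤ 2 * R → ‖proj T (avgHess γ a z)‖ ≤ h)
    {x0 : Vec d} (hx0 : l0 x0 ≤ k) (hx0R : ‖x0‖ ≤ R) :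
    ConvergesLinearly (lsLoss γ a y) k m R η x0 xhat β
      (4 * R * g + min (stageError L R η β g h / (1 - β)) (4 * L * R ^ 2) / 2) := by
  have hg0 : 0 ≤ g := (norm_nonneg _).trans (hg ∅ (by simp))
  have he0 : 0 ≤ stageError L R η β g h := by
    unfold stageError stepError; positivity
  have h1β : 0 < 1 - β := by linarith
  set e := stageError L R η β g h
  set f := lsLoss γ a y with hf
  have : Nonempty (StageChoice n m) := ⟨(fun _ => ⟨0, hn⟩, ⟨0, hm⟩)⟩
  set N : ℝ := (Fintype.card (StageChoice n m) : ℝ) with hN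
  have hNpos : 0 < N := by rw [hN]; exact_mod_cast Fintype.card_pos
  have hcard : ∀ s, (Fintype.card (Fin s → StageChoice n m) : ℝ) = N ^ s := by
    intro s
    rw [Fintype.card_fun, Fintype.card_fin, Nat.cast_pow]
  let X : ∀ s, (Fin s → StageChoice n m) → Vec d := fun s c => output f k R η x0 s c
  have hXk : ∀ s c, l0 (X s c) ≤ k := fun s c => l0_output_le hk hx0 s c
  have hXR : ∀ s c, ‖X s c‖ ≤ R := fun s c => norm_output_le hR hx0R s c
  have hXz : ∀ s c, l0 (X s c - xhat) ≤ k + K := fun s c =>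
    (l0_sub_le _ _).trans (add_le_add (hXk s c) hxK)
  have hXzR : ∀ s c, ‖X s c - xhat‖ ≤ 2 * R := fun s c => norm_sub_le_two_mul (hXR s c) hxR
  set q0 := quadForm γ a (x0 - xhat) with hq0
  have hq0' : 0 ≤ q0 := quadForm_nonneg hγ _
  -- The number `e / (1 - β)` is the fixed point of `t ↦ β t + e`.
  have hE1 : ∀ s, ∑ c, quadForm γ a (X s c - xhat) ≤ N ^ s * (β ^ s * q0 + e / (1 - β)) := by
    intro s
    induction s with
    | zero =>
      have : 0 ≤ e / (1 - β) := by positivity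
      simp [X, output]
      linarith
    | succ s ih =>
      have h1 := sum_output_succ (m := m) f k R η x0 s fun v => quadForm γ a (v - xhat)
      refine h1.trans_le ((Finset.sum_le_sum fun c _ => sum_stage_le hn hm hK hk hγ hR hη hα0 hL0
        hηL hηα hh0 (hβe ▸ hβ0) hL hα hxK hxR hg hh (hXk s c) (hXR s c)).trans ?_)
      rw [hβe, ← Finset.mul_sum, Finset.sum_add_distrib, ← Finset.mul_sum, Finset.sum_const,
        Finset.card_univ, nsmul_eq_mul, hcard, pow_succ' N, mul_assoc]
      refine mul_le_mul_of_nonneg_left ?_ hNpos.le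
      have h2 := mul_le_mul_of_nonneg_left ih hβ0.le
      have h3 : e = (1 - β) * (e / (1 - β)) := by field_simp
      refine (add_le_add_left h2 _).trans_eq ?_
      change _ + N ^ s * e = _
      nth_rewrite 2 [h3]
      ring
  -- A bound by smoothness and the diameter `2 R` alone. It serves when the statistical error is too
  -- large for `hE1` to be useful.
  have hE2 : ∀ s, ∑ c, quadForm γ a (X s c - xhat) ≤ N ^ s * (4 * L * R ^ 2) := by
    intro s
    rw [← hcard s, ← nsmul_eq_mul, ← Finset.card_univ]
    refine Finset.sum_le_card_nsmul _ _ _ fun c _ => ?_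
    rw [quadForm_eq_avg]
    refine avg_le_of_forall_le hn fun i => ?_
    have h1 := hL i _ ((hXz s c).trans (by omega))
    refine (real_inner_le_norm _ _).trans ?_
    have h2 := hXzR s c
    have h3 := norm_nonneg (X s c - xhat)
    calc ‖X s c - xhat‖ * ‖hess γ (a i) (X s c - xhat)‖
        ≤ (2 * R) * (L * (2 * R)) := by gcongr; exact h1.trans (by gcongr)
      _ = _ := by ring
  have hE : ∀ s, ∑ c, quadForm γ a (X s c - xhat) ≤
      N ^ s * (β ^ s * q0 + min (e / (1 - β)) (4 * L * R ^ 2)) := by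
    intro s
    have hNs : 0 < N ^ s := by positivity
    rcases min_cases (e / (1 - β)) (4 * L * R ^ 2) with h | h
    · rw [h.1]; exact hE1 s
    · rw [h.1]
      refine (hE2 s).trans (mul_le_mul_of_nonneg_left ?_ hNs.le)
      have : 0 ≤ β ^ s * q0 := by positivity
      linarith
  have hmin : 0 ≤ min (e / (1 - β)) (4 * L * R ^ 2) := le_min (by positivity) (by positivity)
  refine ⟨hβ0, hβ1, by positivity, fun s => ?_⟩
  have hNs : 0 < N ^ s := by positivity
  have hin : ∀ z : Vec d, l0 z ≤ k + K → ‖z‖ ≤ 2 * R →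
      |inner ℝ z (avgGrad γ a y xhat)| ≤ 2 * R * g := fun z hz hzR =>
    abs_inner_le_of_proj hzR (hg (supp z) (hz.trans (by omega)))
  have hgap0 : q0 / 2 ≤ objective f x0 - objective f xhat + 2 * R * g := by
    rw [hf, objective_sub]
    have := (abs_le.1 (hin (x0 - xhat) ((l0_sub_le _ _).trans (add_le_add hx0 hxK))
      (norm_sub_le_two_mul hx0R hxR))).1
    linarith
  have hgap : expectedGap f k m R η x0 xhat s ≤
      2 * R * g + (β ^ s * q0 + min (e / (1 - β)) (4 * L * R ^ 2)) / 2 := by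
    rw [expectedGap, hcard, div_le_iff₀ hNs]
    have h1 : ∑ c : Fin s → StageChoice n m, (objective f (X s c) - objective f xhat) ≤
        ∑ c : Fin s → StageChoice n m, (2 * R * g + 1 / 2 * quadForm γ a (X s c - xhat)) := by
      refine Finset.sum_le_sum fun c _ => ?_
      rw [hf, objective_sub]
      have := (abs_le.1 (hin _ (hXz s c) (hXzR s c))).2
      linarith
    refine h1.trans ?_
    rw [Finset.sum_add_distrib, Finset.sum_const, ← Finset.mul_sum, Finset.card_univ, nsmul_eq_mul,
      hcard]
    have := hE s
    linarith
  have hβs : β ^ s ≤ 1 := pow_le_one₀ hβ0.le hβ1.le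
  have hβs0 : 0 ≤ β ^ s := by positivity
  have h5 := mul_le_mul_of_nonneg_left hgap0 hβs0
  have h6 : β ^ s * (2 * R * g) ≤ 2 * R * g := mul_le_of_le_one_left (by positivity) hβs
  linarith

end Expectation

/-! ### The restricted gradient at the global optimum -/

section Optimum

variable {n d : ℕ}

/-- `n⁻¹ AᵀA z`, where `A` has the rows `a i`. -/
def gram (a : Fin n → Vec d) (z : Vec d) : Vec d := avg fun i => (inner ℝ (a i) z) • a i

/-- `n⁻¹ Aᵀ e`, where `A` has the rows `a i`. -/
def noiseGrad (a : Fin n → Vec d) (e : Fin n → ℝ) : Vec d := avg fun i => e i • a i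

/-- `y = A xstar + e`, where `A` has the rows `a i`. -/
def response (a : Fin n → Vec d) (xstar : Vec d) (e : Fin n → ℝ) (i : Fin n) : ℝ :=
  inner ℝ (a i) xstar + e i

variable {γ : ℝ} {a : Fin n → Vec d} {e : Fin n → ℝ} {xstar : Vec d}

lemma avgHess_eq (hn : 0 < n) (z : Vec d) : avgHess γ a z = gram a z + γ • z := by
  simp only [avgHess, gram, hess]
  rw [avg_add, avg_const hn]

lemma avgGrad_response (hn : 0 < n) (x : Vec d) :
    avgGrad γ a (response a xstar e) x = gram a (x - xstar) + γ • x - noiseGrad a e := by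
  have h : ∀ i, lsGrad γ (a i) (response a xstar e i) x =
      (inner ℝ (a i) (x - xstar)) • a i + γ • x - e i • a i := by
    intro i
    simp only [lsGrad, hess, response, inner_sub_right]
    module
  simp only [avgGrad, h, gram, noiseGrad]
  rw [avg_sub, avg_add, avg_const hn]

lemma nonneg_of_forall_le_quadratic {A B : ℝ} (h : ∀ t : ℝ, 0 < t → t ≤ 1 → 0 ≤ t * A + t ^ 2 * B) :
    0 ≤ A := by
  by_contra hA
  have hA := not_le.1 hA
  have hB := h 1 one_pos le_rfl
  have hBpos : 0 < B := by linarith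
  -- The minimizer of `t A + t² B`; it is at most `1` because `t = 1` gives `-A ≤ B`.
  have ht := h (-A / (2 * B)) (div_pos (by linarith) (by linarith))
    ((div_le_one (by linarith)).2 (by linarith))
  have e1 : -A / (2 * B) * A + (-A / (2 * B)) ^ 2 * B = -(A ^ 2 / (4 * B)) := by field_simp; ring
  rw [e1] at ht
  have : 0 < A ^ 2 / (4 * B) := div_pos (by nlinarith) (by linarith)
  linarith

/-- The first-order optimality condition on the support of a global optimum. -/
lemma norm_proj_supp_avgGrad_le {K : ℕ} {R : ℝ} {y : Fin n → ℝ} (hR : 0 < R) (hγ : 0 ≤ γ)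
    {xhat w : Vec d} (hopt : IsGlobalOptimum (objective (lsLoss γ a y)) K R xhat)
    (hw : avgGrad γ a y xhat = γ • xhat - w) :
    ‖proj (supp xhat) (avgGrad γ a y xhat)‖ ≤ ‖proj (supp xhat) w‖ := by
  set G := avgGrad γ a y xhat
  set S := supp xhat with hS
  set p := proj S G
  obtain ⟨⟨hK, hxR⟩, hmin⟩ := hopt
  rcases eq_or_ne p 0 with hp | hp
  · rw [hp]; simp
  have hp0 : 0 < ‖p‖ := norm_pos_iff.2 hp
  -- The feasible point supported in `S` that minimizes the linear functional `⟪·, G⟫`. Comparing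
  -- along the segment from `x̂` to `u` is valid whether or not the norm constraint is active at
  -- `x̂`, where the gradient on the support need not vanish.
  set u : Vec d := (-(R / ‖p‖)) • p with hu
  have huS : supp u ⊆ S := by
    intro j hj
    refine supp_proj_subset S G ?_
    simp only [hu, mem_supp, PiLp.smul_apply, smul_eq_mul] at hj ⊢
    exact right_ne_zero_of_mul hj
  have huR : ‖u‖ = R := by
    rw [hu, norm_smul, norm_neg, Real.norm_of_nonneg (by positivity)]
    field_simp
  have hA : 0 ≤ inner ℝ (u - xhat) G := by
    refine nonneg_of_forall_le_quadratic (B := quadForm γ a (u - xhat) / 2) fun t ht0 ht1 => ?_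
    have e1 : (1 - t) • xhat + t • u - xhat = t • (u - xhat) := by module
    have hsupp : supp ((1 - t) • xhat + t • u) ⊆ S := by
      intro j hj
      by_contra hjS
      have h1 : xhat j = 0 := by simpa [hS] using hjS
      have h2 : u j = 0 := by
        by_contra h
        exact hjS (huS (mem_supp.2 h))
      simp [h1, h2] at hj
    have hnorm : ‖(1 - t) • xhat + t • u‖ ≤ R := by
      refine (norm_add_le _ _).trans ?_
      rw [norm_smul, norm_smul, huR, Real.norm_of_nonneg (by linarith), Real.norm_of_nonneg ht0.le]
      nlinarith
    have h1 := hmin _ ((Finset.card_le_card hsupp).trans hK) hnorm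
    have h2 := objective_sub (γ := γ) (a := a) (y := y) ((1 - t) • xhat + t • u) xhat
    rw [e1, quadForm_smul, real_inner_smul_left] at h2
    change _ = t * inner ℝ (u - xhat) G + _ at h2
    linarith
  have h1 : inner ℝ u G = -(R * ‖p‖) := by
    rw [hu, real_inner_smul_left, ← inner_proj_proj, real_inner_self_eq_norm_sq]
    change -(R / ‖p‖) * ‖p‖ ^ 2 = _
    field_simp
  -- The regularizer contributes `-γ ‖x̂‖²`, which has the right sign and is dropped, so no `γ`
  -- survives.
  have h2 : -inner ℝ xhat G ≤ R * ‖proj S w‖ := by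
    rw [hw, inner_sub_right, inner_smul_right, real_inner_self_eq_norm_sq,
      inner_eq_inner_proj (Γ := S) subset_rfl w]
    have h3 := real_inner_le_norm xhat (proj S w)
    have h4 := mul_le_mul_of_nonneg_right hxR (norm_nonneg (proj S w))
    have : 0 ≤ γ * ‖xhat‖ ^ 2 := by positivity
    linarith
  rw [inner_sub_left, h1] at hA
  exact le_of_mul_le_mul_left (by linarith) hR

lemma norm_proj_le_of_supp_bound {S Γ : Finset (Fin d)} {v : Vec d} :
    ‖proj Γ v‖ ≤ ‖proj S v‖ + ‖proj (Γ \ S) v‖ := by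
  have h := proj_union (Finset.disjoint_sdiff (s := S) (t := Γ)) v
  calc ‖proj Γ v‖ ≤ ‖proj (S ∪ Γ \ S) v‖ := proj_mono (fun j hj => by
        by_cases hjS : j ∈ S <;> simp [hj, hjS]) v
    _ ≤ _ := by rw [h]; exact norm_add_le _ _

/-- On the support of `x̂` the optimality condition removes `γ`; off the support `γ • x̂` is zero.
Each part is then bounded by `w`, the noise minus the Gram term, hence the factor `2`. -/
lemma norm_proj_avgGrad_optimum_le {K r : ℕ} {R p₀ Λ : ℝ} (hn : 0 < n) (hR : 0 < R) (hγ : 0 ≤ γ)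
    (hKr : K ≤ r) {xhat : Vec d}
    (hopt : IsGlobalOptimum (objective (lsLoss γ a (response a xstar e))) K R xhat)
    (hnoise : ∀ Γ : Finset (Fin d), Γ.card ≤ r → ‖proj Γ (noiseGrad a e)‖ ≤ p₀)
    (hgram : ∀ Γ : Finset (Fin d), Γ.card ≤ r →
      ‖proj Γ (gram a (xhat - xstar))‖ ≤ Λ * ‖xhat - xstar‖)
    {Γ : Finset (Fin d)} (hΓ : Γ.card ≤ r) :
    ‖proj Γ (avgGrad γ a (response a xstar e) xhat)‖ ≤ 2 * (p₀ + Λ * ‖xhat - xstar‖) := by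
  set w := noiseGrad a e - gram a (xhat - xstar) with hw
  have hG : avgGrad γ a (response a xstar e) xhat = γ • xhat - w := by
    rw [avgGrad_response hn, hw]; abel
  have hwb : ∀ Γ : Finset (Fin d), Γ.card ≤ r →
      ‖proj Γ w‖ ≤ p₀ + Λ * ‖xhat - xstar‖ := fun Γ hΓ => by
    rw [hw, proj_sub]
    exact (norm_sub_le _ _).trans (add_le_add (hnoise Γ hΓ) (hgram Γ hΓ))
  have h1 := norm_proj_supp_avgGrad_le hR hγ hopt hG
  have h2 : proj (Γ \ supp xhat) (avgGrad γ a (response a xstar e) xhat) =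
      -proj (Γ \ supp xhat) w := by
    rw [hG, proj_sub, proj_smul, proj_eq_zero (Finset.sdiff_disjoint), smul_zero, zero_sub]
  have h3 := norm_proj_le_of_supp_bound (S := supp xhat) (Γ := Γ)
    (v := avgGrad γ a (response a xstar e) xhat)
  rw [h2, norm_neg] at h3
  have h4 := hwb (supp xhat) (hopt.1.1.trans hKr)
  have h5 := hwb (Γ \ supp xhat) ((Finset.card_le_card Finset.sdiff_subset).trans hΓ)
  linarith

/-- From `F(x̂) ≤ F(x*)` the curvature term is at most `-⟪z, ∇F(x*)⟫`, and `∇F(x*)` is `γ • x*`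
minus the noise; one factor `‖z‖` cancels. -/
lemma norm_optimum_sub_le {k K r : ℕ} {R α p₀ : ℝ} (hn : 0 < n) (hα0 : 0 < α) (hγ : 0 ≤ γ)
    (hK : K ≤ k) (hr : k + K ≤ r) {xhat : Vec d}
    (hα : ∀ z : Vec d, l0 z ≤ k + K → α * ‖z‖ ^ 2 ≤ quadForm γ a z)
    (hopt : IsGlobalOptimum (objective (lsLoss γ a (response a xstar e))) K R xhat)
    (hnoise : ∀ Γ : Finset (Fin d), Γ.card ≤ r → ‖proj Γ (noiseGrad a e)‖ ≤ p₀)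
    (hstarK : l0 xstar ≤ K) (hstarR : ‖xstar‖ ≤ R) :
    ‖xhat - xstar‖ ≤ 2 / α * (γ * R + p₀) := by
  set z := xhat - xstar
  have hz : l0 z ≤ k + K := (l0_sub_le _ _).trans (add_le_add (hopt.1.1.trans hK) hstarK)
  have h1 := hopt.2 xstar hstarK hstarR
  have h2 := objective_sub (γ := γ) (a := a) (y := response a xstar e) xhat xstar
  have h3 : avgGrad γ a (response a xstar e) xstar = γ • xstar - noiseGrad a e := by
    rw [avgGrad_response hn, sub_self]
    have : gram a (0 : Vec d) = 0 := by simp [gram, avg]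
    rw [this, zero_add]
  change _ = inner ℝ z _ + quadForm γ a z / 2 at h2
  rw [h3, inner_sub_right, inner_smul_right, inner_eq_inner_proj (x := z) subset_rfl
    (noiseGrad a e)] at h2
  have h4 := abs_le.1 (abs_real_inner_le_norm z xstar)
  have h5 : inner ℝ z (proj (supp z) (noiseGrad a e)) ≤ ‖z‖ * p₀ :=
    (real_inner_le_norm _ _).trans
      (mul_le_mul_of_nonneg_left (hnoise _ (hz.trans hr)) (norm_nonneg _))
  have h6 := hα z hz
  have h7 : -(‖z‖ * R) ≤ inner ℝ z xstar := by
    have := mul_le_mul_of_nonneg_left hstarR (norm_nonneg z)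
    linarith
  have h8 := mul_le_mul_of_nonneg_left h7 hγ
  have h9 : α / 2 * ‖z‖ * ‖z‖ ≤ (γ * R + p₀) * ‖z‖ := by nlinarith
  have hp0 : 0 ≤ γ * R + p₀ := by
    have := (norm_nonneg _).trans (hnoise ∅ (by simp))
    have := (norm_nonneg _).trans hstarR
    positivity
  rcases (norm_nonneg z).eq_or_lt with h | h
  · rw [← h]; positivity
  · have := le_of_mul_le_mul_right h9 h
    rw [div_mul_eq_mul_div, le_div_iff₀ hα0]
    linarith

/-- The averaged Gram matrix is close to `v` times the identity on sparse vectors. -/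
def GramConcentrated (a : Fin n → Vec d) (r : ℕ) (v p : ℝ) : Prop :=
  ∀ (Γ : Finset (Fin d)) (z : Vec d), Γ.card ≤ r → supp z ⊆ Γ →
    ‖proj Γ (gram a z) - v • z‖ ≤ p * ‖z‖

/-- The multiple `v • z` of the identity vanishes off the support of `z`, so only the deviation
remains. -/
lemma GramConcentrated.norm_proj_le_of_disjoint {r : ℕ} {v p : ℝ} (h : GramConcentrated a r v p)
    {T : Finset (Fin d)} {z : Vec d} (hT : T.card + l0 z ≤ r) (hd : Disjoint T (supp z)) :
    ‖proj T (gram a z)‖ ≤ p * ‖z‖ := by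
  have h1 := h (T ∪ supp z) z ((Finset.card_union_le _ _).trans hT) Finset.subset_union_right
  have h2 : proj T (proj (T ∪ supp z) (gram a z) - v • z) = proj T (gram a z) := by
    rw [proj_sub, proj_smul, proj_eq_zero hd, smul_zero, sub_zero]
    ext j
    by_cases hj : j ∈ T <;> simp [hj]
  rw [← h2]
  exact (norm_proj_le _ _).trans h1

lemma GramConcentrated.norm_proj_le {r : ℕ} {v p : ℝ} (hv : 0 ≤ v) (h : GramConcentrated a r v p)
    {T : Finset (Fin d)} {z : Vec d} (hT : T.card + l0 z ≤ r) :
    ‖proj T (gram a z)‖ ≤ (p + v) * ‖z‖ := by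
  have h1 := h (T ∪ supp z) z ((Finset.card_union_le _ _).trans hT) Finset.subset_union_right
  calc ‖proj T (gram a z)‖ ≤ ‖proj (T ∪ supp z) (gram a z)‖ :=
        proj_mono Finset.subset_union_left _
    _ = ‖(proj (T ∪ supp z) (gram a z) - v • z) + v • z‖ := by rw [sub_add_cancel]
    _ ≤ _ := norm_add_le _ _
    _ ≤ p * ‖z‖ + v * ‖z‖ := add_le_add h1 (by rw [norm_smul, Real.norm_of_nonneg hv])
    _ = _ := by ring

/-- On sparse vectors `γ ‖z‖² ≤ ⟪z, hess z⟫ ≤ L ‖z‖²`, so removing the regularizer at most doubles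
the bound. It does not grow with `σ`. -/
lemma norm_gram_le {r : ℕ} {L : ℝ} (hn : 0 < n) (hγ : 0 ≤ γ)
    (hL : ∀ i, ∀ z : Vec d, l0 z ≤ r → ‖hess γ (a i) z‖ ≤ L * ‖z‖) {z : Vec d} (hz : l0 z ≤ r) :
    ‖gram a z‖ ≤ 2 * L * ‖z‖ := by
  have h1 : ‖avgHess γ a z‖ ≤ L * ‖z‖ := by
    have : ‖avgHess γ a z‖ ≤ avg fun i => ‖hess γ (a i) z‖ := by
      rw [avgHess, avg, norm_smul, Real.norm_of_nonneg (by positivity)]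
      exact mul_le_mul_of_nonneg_left (norm_sum_le _ _) (by positivity)
    exact this.trans (avg_le_of_forall_le hn fun i => hL i z hz)
  have h2 : γ * ‖z‖ ≤ L * ‖z‖ := by
    have i : Fin n := ⟨0, hn⟩
    have h3 := hL i z hz
    have h4 := real_inner_le_norm z (hess γ (a i) z)
    rw [inner_hess_self] at h4
    rcases (norm_nonneg z).eq_or_lt with h | h
    · rw [← h]; simp
    · refine le_of_mul_le_mul_left ?_ h
      have := mul_le_mul_of_nonneg_left h3 h.le
      nlinarith [sq_nonneg (inner ℝ (a i) z)]
  have h3 : gram a z = avgHess γ a z - γ • z := by rw [avgHess_eq hn]; abel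
  rw [h3]
  refine (norm_sub_le _ _).trans ?_
  rw [norm_smul, Real.norm_of_nonneg hγ]
  linarith

/-- All terms are linear or quadratic in `(g, h)`, and `B² ≤ B` when `B ≤ 1`. -/
lemma stepError_le {L R η g h g' h' B : ℝ} (hL : 0 ≤ L) (hR : 0 ≤ R) (hη : 0 ≤ η) (hg : 0 ≤ g)
    (hh : 0 ≤ h) (hg' : g ≤ g' * B) (hh' : h ≤ h' * B)
    (hB : 0 ≤ B) (hB1 : B ≤ 1) :
    stepError L R η g h ≤ stepError L R η g' h' * B := by
  have h1 : g ^ 2 ≤ g' ^ 2 * B := by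
    calc g ^ 2 ≤ (g' * B) ^ 2 := pow_le_pow_left₀ hg hg' 2
      _ = g' ^ 2 * (B * B) := by ring
      _ ≤ g' ^ 2 * B := mul_le_mul_of_nonneg_left (mul_le_of_le_one_left hB hB1) (sq_nonneg _)
  have h2 : (h + g) ^ 2 ≤ (h' + g') ^ 2 * B := by
    calc (h + g) ^ 2 ≤ ((h' + g') * B) ^ 2 := pow_le_pow_left₀ (by linarith) (by linarith) 2
      _ = (h' + g') ^ 2 * (B * B) := by ring
      _ ≤ (h' + g') ^ 2 * B :=
        mul_le_mul_of_nonneg_left (mul_le_of_le_one_left hB hB1) (sq_nonneg _)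
  have h3 : 8 * L * R * (h + g) ≤ 8 * L * R * (h' + g') * B := by
    have := mul_le_mul_of_nonneg_left (add_le_add hh' hg') (show 0 ≤ 8 * L * R by positivity)
    linarith
  have h4 : 4 * η * R * g ≤ 4 * η * R * g' * B := by
    have := mul_le_mul_of_nonneg_left hg' (show 0 ≤ 4 * η * R by positivity)
    linarith
  unfold stepError
  have h5 := mul_le_mul_of_nonneg_left (add_le_add (add_le_add h1 h3) h2) (sq_nonneg η)
  nlinarith [mul_le_mul_of_nonneg_left h1 (sq_nonneg η), mul_le_mul_of_nonneg_left h2 (sq_nonneg η)]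

/-- Because `ν ≥ 1`, the bound on `ν` forces `α < 4 L`: otherwise its right-hand side would be
nonpositive, or `0` by division by zero. -/
lemma mul_lt_one_of_expansiveness_lt {ν η α L : ℝ} (hν : 1 ≤ ν) (hη : 0 < η)
    (hL : 0 < L) (hηL : η < 1 / (4 * L)) (h : ν < 4 * L / (4 * L - α)) : η * α < 1 := by
  have h1 : 0 < 4 * L - α := by
    by_contra hneg
    have : 4 * L / (4 * L - α) ≤ 0 :=
      div_nonpos_of_nonneg_of_nonpos (by positivity) (not_lt.1 hneg)
    linarith
  rw [lt_div_iff₀ (by positivity)] at hηL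
  nlinarith

/-- The constant in the bound on the restricted gradient at the optimum. -/
def gradConst (R Cγ α L κ : ℝ) : ℝ := 2 * (κ + (κ + 2 + 2 * L) * (2 / α * (Cγ * R + κ)))

/-- The constant in the bound on the optimization error. -/
def errorConst (R Cγ α L η β κ : ℝ) : ℝ :=
  4 * R * gradConst R Cγ α L κ +
    (stageError L R η β (gradConst R Cγ α L κ) (2 * R * κ) / (1 - β) + 4 * L * R ^ 2) / 2

/-- Linear convergence on the event that the Gram matrix and the noise are concentrated. -/
theorem convergesLinearly_of_concentrated {k K m : ℕ} {R Cγ η α L κ s v β : ℝ} {σ σ₀ : ℝ}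
    (hn : 0 < n) (hm : 0 < m) (hK : K ≤ k) (hk : k ≤ d) (hγ : 0 ≤ γ) (hR : 0 < R) (hCγ : 0 ≤ Cγ)
    (hη : 0 < η) (hα0 : 0 < α) (hL0 : 0 < L) (hηL : η < 1 / (4 * L))
    (hν : expansiveness d k K < 4 * L / (4 * L - α))
    (hβe : convCoeff (expansiveness d k K) η α L m = β) (hβ0 : 0 < β) (hβ1 : β < 1)
    (hs : 0 ≤ s) (hs1 : s ≤ 1) (hκ : 0 ≤ κ) (hγs : γ ≤ Cγ * s) (hσ : 0 ≤ σ) (hσ₀ : 0 ≤ σ₀)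
    (hv : 0 ≤ v) (hvσ : v ≤ 2 * σ ^ 2)
    (hgram : GramConcentrated a (2 * (3 * k + K)) v (κ * σ ^ 2 * s))
    (hnoise : ∀ Γ : Finset (Fin d), Γ.card ≤ 3 * k + K →
      ‖proj Γ (noiseGrad a e)‖ ≤ κ * (σ * σ₀) * s)
    (hRSC : RSC (objective (lsLoss γ a (response a xstar e))) (k + K) α)
    (hRSS : ∀ i, RSS (lsLoss γ a (response a xstar e) i) (3 * k + K) L)
    (hstarK : l0 xstar ≤ K) (hstarR : ‖xstar‖ ≤ R) {xhat x0 : Vec d}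
    (hopt : IsGlobalOptimum (objective (lsLoss γ a (response a xstar e))) K R xhat)
    (hx0 : l0 x0 ≤ k) (hx0R : ‖x0‖ ≤ R) :
    ∃ τ : ℝ, ConvergesLinearly (lsLoss γ a (response a xstar e)) k m R η x0 xhat β τ ∧
      τ ≤ errorConst R Cγ α L η β κ * (max σ σ₀ * σ * s) := by
  have hL : ∀ i, ∀ z : Vec d, l0 z ≤ 3 * k + K → ‖hess γ (a i) z‖ ≤ L * ‖z‖ :=
    fun i z hz => norm_hess_le_of_RSS (hRSS i) hz
  have hα : ∀ z : Vec d, l0 z ≤ k + K → α * ‖z‖ ^ 2 ≤ quadForm γ a z :=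
    fun z hz => quadForm_ge_of_RSC hRSC hz
  have hηα := mul_lt_one_of_expansiveness_lt (one_le_expansiveness hK hk) hη hL0 hηL hν
  set B := max σ σ₀ * σ * s with hB
  have hmax : 0 ≤ max σ σ₀ := le_max_of_le_left hσ
  have hB0 : 0 ≤ B := by positivity
  have hB1 : σ ^ 2 * s ≤ B := by
    have := mul_le_mul_of_nonneg_right (le_max_left σ σ₀) (mul_nonneg hσ hs)
    rw [hB]; nlinarith
  have hB2 : σ * σ₀ * s ≤ B := by
    have := mul_le_mul_of_nonneg_right (le_max_right σ σ₀) (mul_nonneg hσ hs)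
    rw [hB]; nlinarith
  set δ := xhat - xstar with hδdef
  have hδ0 : l0 δ ≤ 2 * K := (l0_sub_le _ _).trans (by have := hopt.1.1; omega)
  have hδ : ‖δ‖ ≤ 2 / α * (Cγ * R + κ * (σ * σ₀)) * s := by
    refine (norm_optimum_sub_le (r := 3 * k + K) hn hα0 hγ hK (by omega) hα hopt hnoise hstarK
      hstarR).trans ?_
    rw [mul_assoc (2 / α)]
    refine mul_le_mul_of_nonneg_left ?_ (by positivity)
    have := mul_le_mul_of_nonneg_right hγs hR.le
    linarith
  obtain ⟨Λ, hΛ, hΛδ⟩ : ∃ Λ : ℝ, (∀ Γ : Finset (Fin d), Γ.card ≤ 3 * k + K →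
      ‖proj Γ (gram a δ)‖ ≤ Λ * ‖δ‖) ∧
      Λ * ‖δ‖ ≤ (κ + 2 + 2 * L) * (2 / α * (Cγ * R + κ)) * B := by
    have hc : 0 ≤ 2 / α := by positivity
    have hCR : 0 ≤ Cγ * R := by positivity
    -- The product `Λ ‖δ‖` must carry a factor `σ²` on the term from `γ`, but no extra power of `σ`
    -- on the noise term. For `σ ≤ 1` concentration gives `Λ` of order `σ²`; for `σ ≥ 1` smoothness
    -- gives `Λ = 2 L`, and `s ≤ σ² s` supplies the missing factor.
    rcases le_total σ 1 with h1 | h1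
    · refine ⟨κ * σ ^ 2 * s + v, fun Γ hΓ => hgram.norm_proj_le hv (by omega), ?_⟩
      have e1 : κ * σ ^ 2 * s + v ≤ (κ + 2 + 2 * L) * σ ^ 2 := by
        have : κ * σ ^ 2 * s ≤ κ * σ ^ 2 := mul_le_of_le_one_right (show 0 ≤ κ * σ ^ 2 by positivity) hs1
        have : 0 ≤ 2 * L * σ ^ 2 := by positivity
        linarith
      have e2 : σ ^ 2 * (Cγ * R + κ * (σ * σ₀)) * s ≤ (Cγ * R + κ) * B := by
        have t1 := mul_le_mul_of_nonneg_left hB1 hCR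
        have t0 : σ ^ 2 ≤ 1 := pow_le_one₀ hσ h1
        have t2 : σ ^ 2 * (σ * σ₀ * s) ≤ B :=
          (mul_le_of_le_one_left (by positivity) t0).trans hB2
        have t3 := mul_le_mul_of_nonneg_left t2 hκ
        linarith
      calc (κ * σ ^ 2 * s + v) * ‖δ‖
          ≤ ((κ + 2 + 2 * L) * σ ^ 2) * (2 / α * (Cγ * R + κ * (σ * σ₀)) * s) := by gcongr
        _ = (κ + 2 + 2 * L) * (2 / α) * (σ ^ 2 * (Cγ * R + κ * (σ * σ₀)) * s) := by ring
        _ ≤ (κ + 2 + 2 * L) * (2 / α) * ((Cγ * R + κ) * B) :=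
          mul_le_mul_of_nonneg_left e2 (by positivity)
        _ = _ := by ring
    · refine ⟨2 * L, fun Γ _ => (norm_proj_le _ _).trans
        (norm_gram_le hn hγ hL (hδ0.trans (by omega))), ?_⟩
      have e2 : (Cγ * R + κ * (σ * σ₀)) * s ≤ (Cγ * R + κ) * B := by
        have t0 : s ≤ B := (le_mul_of_one_le_left hs (show 1 ≤ σ ^ 2 from one_le_pow₀ h1)).trans hB1
        have t1 := mul_le_mul_of_nonneg_left t0 hCR
        have t3 := mul_le_mul_of_nonneg_left hB2 hκ
        linarith
      calc 2 * L * ‖δ‖ ≤ (κ + 2 + 2 * L) * (2 / α * (Cγ * R + κ * (σ * σ₀)) * s) := by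
            gcongr; linarith
        _ = (κ + 2 + 2 * L) * (2 / α) * ((Cγ * R + κ * (σ * σ₀)) * s) := by ring
        _ ≤ (κ + 2 + 2 * L) * (2 / α) * ((Cγ * R + κ) * B) :=
          mul_le_mul_of_nonneg_left e2 (by positivity)
        _ = _ := by ring
  set p₀ := κ * (σ * σ₀) * s with hp₀
  have hp₀B : p₀ ≤ κ * B := by
    have := mul_le_mul_of_nonneg_left hB2 hκ
    rw [hp₀]; linarith
  set g := 2 * (p₀ + Λ * ‖δ‖) with hgdef
  have hg : ∀ Γ : Finset (Fin d), Γ.card ≤ 3 * k + K →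
      ‖proj Γ (avgGrad γ a (response a xstar e) xhat)‖ ≤ g := fun Γ hΓ =>
    norm_proj_avgGrad_optimum_le hn hR hγ (by omega) hopt hnoise hΛ hΓ
  have hg0 : 0 ≤ g := (norm_nonneg _).trans (hg ∅ (by simp))
  set h := 2 * R * (κ * σ ^ 2 * s) with hhdef
  have hh0 : 0 ≤ h := by positivity
  have hh : ∀ (T : Finset (Fin d)) (z : Vec d), T.card ≤ k → l0 z ≤ k + K → Disjoint T (supp z) →
      ‖z‖ ≤ 2 * R → ‖proj T (avgHess γ a z)‖ ≤ h := by
    intro T z hT hz hd hzR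
    rw [avgHess_eq hn, proj_add, proj_smul, proj_eq_zero hd, smul_zero, add_zero]
    refine (hgram.norm_proj_le_of_disjoint (by omega) hd).trans ?_
    rw [hhdef, mul_comm]
    exact mul_le_mul_of_nonneg_right hzR (by positivity)
  refine ⟨_, convergesLinearly_of_bounds hn hm hK hk hγ hR hη hα0 hL0 hηL hηα hh0 hβe hβ0 hβ1 hL hα
    hopt.1.1 hopt.1.2 hg hh hx0 hx0R, ?_⟩
  set Cg := gradConst R Cγ α L κ with hCg
  have hCg0 : 0 ≤ Cg := by rw [hCg, gradConst]; positivity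
  have hgB : g ≤ Cg * B := by
    rw [hgdef, hCg, gradConst]
    linarith
  have hhB : h ≤ 2 * R * κ * B := by
    have := mul_le_mul_of_nonneg_left hB1 (show 0 ≤ 2 * R * κ by positivity)
    rw [hhdef]; linarith
  have h1β : 0 < 1 - β := by linarith
  have hst0 : 0 ≤ stageError L R η β Cg (2 * R * κ) / (1 - β) := by
    unfold stageError stepError; positivity
  have hmin : min (stageError L R η β g h / (1 - β)) (4 * L * R ^ 2) ≤
      (stageError L R η β Cg (2 * R * κ) / (1 - β) + 4 * L * R ^ 2) * B := by
    have hLR : 0 ≤ 4 * L * R ^ 2 := by positivity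
    rcases le_total B 1 with h1 | h1
    · refine (min_le_left _ _).trans ?_
      have h2 := stepError_le hL0.le hR.le hη.le hg0 hh0 hgB hhB hB0 h1
      have h3 : stageError L R η β g h / (1 - β) ≤
          stageError L R η β Cg (2 * R * κ) / (1 - β) * B := by
        rw [div_mul_eq_mul_div]
        refine div_le_div_of_nonneg_right ?_ h1β.le
        unfold stageError
        exact (mul_le_mul_of_nonneg_right h2
          (show 0 ≤ 2 / η + β / (2 * η ^ 2 * L) by positivity)).trans_eq (by ring)
      have : 0 ≤ 4 * L * R ^ 2 * B := by positivity
      linarith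
    · refine (min_le_right _ _).trans ?_
      have t1 := le_mul_of_one_le_right hLR h1
      have t2 : 0 ≤ stageError L R η β Cg (2 * R * κ) / (1 - β) * B := by positivity
      linarith
  have h4 := mul_le_mul_of_nonneg_left hgB (show 0 ≤ 4 * R by positivity)
  unfold errorConst
  linarith

end Optimum

/-! ### Concentration of averages of products of sub-Gaussian variables -/

section Concentration

open Real

lemma integral_exp_neg_sq_add (x : ℝ) :
    ∫ t : ℝ, exp (-t ^ 2 + t * x) = √π * exp (x ^ 2 / 4) := by
  have h : ∀ t : ℝ, exp (-t ^ 2 + t * x) = exp (-1 * (t - x / 2) ^ 2) * exp (x ^ 2 / 4) := by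
    intro t; rw [← exp_add]; congr 1; ring
  simp only [h]
  rw [integral_mul_const, integral_sub_right_eq_self (fun t => exp (-1 * t ^ 2)),
    integral_gaussian, div_one]

lemma integrable_exp_neg_sq_add (x : ℝ) : Integrable fun t : ℝ => exp (-t ^ 2 + t * x) := by
  have h : ∀ t : ℝ, exp (-t ^ 2 + t * x) = exp (-1 * (t - x / 2) ^ 2) * exp (x ^ 2 / 4) := by
    intro t; rw [← exp_add]; congr 1; ring
  simp only [h]
  exact ((integrable_exp_neg_mul_sq one_pos).comp_sub_right (x / 2)).mul_const _

variable {Ω : Type*} [MeasurableSpace Ω] {P : Measure Ω}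

/-- Writing `exp(x² / 4)` as a Gaussian average of `exp(t x)` and exchanging the integrals reduces
the bound to the moment generating function. The result is `√2 ≤ 3 / 2`. -/
lemma lintegral_exp_sq_le [IsProbabilityMeasure P] {X : Ω → ℝ} (hX : Measurable X) (h : HasSubgaussianMGF X 1 P) :
    ∫⁻ o, ENNReal.ofReal (exp (X o ^ 2 / 4)) ∂P ≤ ENNReal.ofReal (3 / 2) := by
  have hπ : 0 < √π := sqrt_pos.2 pi_pos
  have h1 : ∫⁻ o, ENNReal.ofReal (√π * exp (X o ^ 2 / 4)) ∂P ≤ ENNReal.ofReal (√(2 * π)) := by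
    calc ∫⁻ o, ENNReal.ofReal (√π * exp (X o ^ 2 / 4)) ∂P
        = ∫⁻ o, (∫⁻ t : ℝ, ENNReal.ofReal (exp (-t ^ 2 + t * X o))) ∂P := by
          refine lintegral_congr fun o => ?_
          rw [← integral_exp_neg_sq_add, ofReal_integral_eq_lintegral_ofReal
            (integrable_exp_neg_sq_add _) (ae_of_all _ fun t => (exp_pos _).le)]
      _ = ∫⁻ t : ℝ, ∫⁻ o, ENNReal.ofReal (exp (-t ^ 2 + t * X o)) ∂P := by
          refine lintegral_lintegral_swap (Measurable.aemeasurable ?_)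
          simp only [Function.uncurry_def]
          fun_prop
      _ ≤ ∫⁻ t : ℝ, ENNReal.ofReal (exp (-(1 / 2) * t ^ 2)) := by
          refine lintegral_mono fun t => ?_
          simp only [exp_add]
          rw [← ofReal_integral_eq_lintegral_ofReal ((h.integrable_exp_mul t).const_mul _)
            (ae_of_all _ fun o => by positivity), integral_const_mul]
          refine ENNReal.ofReal_le_ofReal ?_
          refine (mul_le_mul_of_nonneg_left (h.mgf_le t) (exp_pos _).le).trans_eq ?_
          rw [← exp_add]
          congr 1
          push_cast
          ring
      _ = ENNReal.ofReal (√(2 * π)) := by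
          rw [← ofReal_integral_eq_lintegral_ofReal (integrable_exp_neg_mul_sq (by norm_num))
            (ae_of_all _ fun t => (exp_pos _).le), integral_gaussian]
          congr 2
          ring
  have h2 : ∀ o, ENNReal.ofReal (√π * exp (X o ^ 2 / 4)) =
      ENNReal.ofReal √π * ENNReal.ofReal (exp (X o ^ 2 / 4)) := fun o =>
    ENNReal.ofReal_mul hπ.le
  simp only [h2] at h1
  rw [lintegral_const_mul _ (by fun_prop), mul_comm 2 π, sqrt_mul pi_pos.le,
    ENNReal.ofReal_mul hπ.le] at h1
  have h3 := (ENNReal.mul_le_mul_iff_right (ENNReal.ofReal_pos.2 hπ).ne' ENNReal.ofReal_ne_top).1 h1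
  refine h3.trans (ENNReal.ofReal_le_ofReal ?_)
  rw [sqrt_le_left (by norm_num)]
  norm_num

/-- By `|xy| ≤ (x² + y²) / 2` and the arithmetic-geometric mean inequality. No independence of `X`
and `Y` is used, so two projections of the same row are allowed. -/
lemma lintegral_exp_abs_mul_le [IsProbabilityMeasure P] {X Y : Ω → ℝ} (hXm : Measurable X) (hYm : Measurable Y)
    (hX : HasSubgaussianMGF X 1 P) (hY : HasSubgaussianMGF Y 1 P) :
    ∫⁻ o, ENNReal.ofReal (exp (|X o * Y o| / 4)) ∂P ≤ ENNReal.ofReal (3 / 2) := by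
  have hpt : ∀ o, ENNReal.ofReal (exp (|X o * Y o| / 4)) ≤
      ENNReal.ofReal (1 / 2) * (ENNReal.ofReal (exp (X o ^ 2 / 4)) +
        ENNReal.ofReal (exp (Y o ^ 2 / 4))) := by
    intro o
    rw [← ENNReal.ofReal_add (exp_pos _).le (exp_pos _).le, ← ENNReal.ofReal_mul (by norm_num)]
    refine ENNReal.ofReal_le_ofReal ?_
    have h1 : exp (|X o * Y o| / 4) ≤ exp (X o ^ 2 / 8) * exp (Y o ^ 2 / 8) := by
      rw [← exp_add]
      refine exp_le_exp.2 ?_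
      rw [abs_mul, ← sq_abs (X o), ← sq_abs (Y o)]
      nlinarith [sq_nonneg (|X o| - |Y o|)]
    have h2 : exp (X o ^ 2 / 4) = exp (X o ^ 2 / 8) ^ 2 := by
      rw [← exp_nat_mul]; congr 1; push_cast; ring
    have h3 : exp (Y o ^ 2 / 4) = exp (Y o ^ 2 / 8) ^ 2 := by
      rw [← exp_nat_mul]; congr 1; push_cast; ring
    rw [h2, h3]
    nlinarith [sq_nonneg (exp (X o ^ 2 / 8) - exp (Y o ^ 2 / 8))]
  refine (lintegral_mono hpt).trans ?_
  rw [lintegral_const_mul _ (by fun_prop), lintegral_add_left (by fun_prop)]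
  refine (mul_le_mul_right (add_le_add (lintegral_exp_sq_le hXm hX)
    (lintegral_exp_sq_le hYm hY)) _).trans_eq ?_
  rw [← ENNReal.ofReal_add (by norm_num) (by norm_num), ← ENNReal.ofReal_mul (by norm_num)]
  norm_num

/-- Sub-exponential variables in the form used here. -/
def ExpAbsBounded (Z : Ω → ℝ) (P : Measure Ω) : Prop :=
  Measurable Z ∧ ∫⁻ o, ENNReal.ofReal (exp (|Z o| / 4)) ∂P ≤ ENNReal.ofReal (3 / 2)

lemma ExpAbsBounded.neg {Z : Ω → ℝ} (h : ExpAbsBounded Z P) : ExpAbsBounded (-Z) P :=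
  ⟨h.1.neg, by simpa using h.2⟩

lemma ExpAbsBounded.integrable_exp_abs {Z : Ω → ℝ} (h : ExpAbsBounded Z P) :
    Integrable (fun o => exp (|Z o| / 4)) P := by
  have := h.1
  refine ⟨by fun_prop, ?_⟩
  rw [hasFiniteIntegral_iff_ofReal (ae_of_all _ fun o => (exp_pos _).le)]
  exact h.2.trans_lt ENNReal.ofReal_lt_top

lemma ExpAbsBounded.integral_exp_abs_le {Z : Ω → ℝ} (h : ExpAbsBounded Z P) :
    ∫ o, exp (|Z o| / 4) ∂P ≤ 3 / 2 := by
  have h1 := h.2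
  rw [← ofReal_integral_eq_lintegral_ofReal h.integrable_exp_abs
    (ae_of_all _ fun o => (exp_pos _).le)] at h1
  exact (ENNReal.ofReal_le_ofReal_iff (by norm_num)).1 h1

lemma ExpAbsBounded.integrable {Z : Ω → ℝ} (h : ExpAbsBounded Z P) : Integrable Z P := by
  refine (h.integrable_exp_abs.const_mul 4).mono' h.1.aestronglyMeasurable (ae_of_all _ fun o => ?_)
  have := add_one_le_exp (|Z o| / 4)
  rw [norm_eq_abs]
  linarith

lemma exp_le_one_add_add_sq_mul_exp_abs (x : ℝ) : exp x ≤ 1 + x + x ^ 2 * exp |x| := by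
  have h := Complex.norm_exp_sub_sum_le_norm_mul_exp (x : ℂ) 2
  have e : Complex.exp (x : ℂ) - ∑ m ∈ Finset.range 2, (x : ℂ) ^ m / (m.factorial : ℂ) =
      ((exp x - (1 + x) : ℝ) : ℂ) := by
    simp [Finset.sum_range_succ]
  rw [e, Complex.norm_real, Complex.norm_real, norm_eq_abs, norm_eq_abs, sq_abs] at h
  have := (abs_le.1 h).2
  linarith

lemma ExpAbsBounded.integrable_exp_mul {Z : Ω → ℝ} (h : ExpAbsBounded Z P) {l : ℝ}
    (hl : |l| ≤ 1 / 8) : Integrable (fun o => exp (l * Z o)) P := by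
  have := h.1
  refine h.integrable_exp_abs.mono' (by fun_prop) (ae_of_all _ fun o => ?_)
  rw [norm_of_nonneg (exp_pos _).le]
  refine exp_le_exp.2 ((le_abs_self _).trans ?_)
  rw [abs_mul]
  nlinarith [abs_nonneg (Z o)]

/-- Taylor expansion to second order. From `x² / 2 ≤ exp x` at `x = |Z| / 8` comes the factor `128`;
the remaining exponentials fit in `exp(|Z| / 4)` since `|l| ≤ 1 / 8`, and `192 = 128 * 3 / 2`. -/
lemma ExpAbsBounded.mgf_le [IsProbabilityMeasure P] {Z : Ω → ℝ} (h : ExpAbsBounded Z P) {l : ℝ} (hl : |l| ≤ 1 / 8) :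
    mgf Z P l ≤ exp (l * ∫ o, Z o ∂P + 192 * l ^ 2) := by
  have hpt : ∀ o, exp (l * Z o) ≤ (1 + l * Z o) + 128 * l ^ 2 * exp (|Z o| / 4) := by
    intro o
    refine (exp_le_one_add_add_sq_mul_exp_abs (l * Z o)).trans (add_le_add_right ?_ _)
    have h1 : exp |l * Z o| ≤ exp (|Z o| / 8) := by
      refine exp_le_exp.2 ?_
      rw [abs_mul]
      nlinarith [abs_nonneg (Z o)]
    have h2 : Z o ^ 2 ≤ 128 * exp (|Z o| / 8) := by
      have := quadratic_le_exp_of_nonneg (x := |Z o| / 8) (by positivity)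
      rw [← sq_abs]
      nlinarith [abs_nonneg (Z o)]
    have h3 : exp (|Z o| / 4) = exp (|Z o| / 8) * exp (|Z o| / 8) := by
      rw [← exp_add]; congr 1; ring
    rw [h3, mul_pow]
    calc l ^ 2 * Z o ^ 2 * exp |l * Z o|
        ≤ l ^ 2 * (128 * exp (|Z o| / 8)) * exp (|Z o| / 8) := by gcongr
      _ = _ := by ring
  have hint := h.integrable
  have hint2 := h.integrable_exp_abs
  calc mgf Z P l ≤ ∫ o, ((1 + l * Z o) + 128 * l ^ 2 * exp (|Z o| / 4)) ∂P :=
        integral_mono (h.integrable_exp_mul hl) (by fun_prop) hpt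
    _ = 1 + l * ∫ o, Z o ∂P + 128 * l ^ 2 * ∫ o, exp (|Z o| / 4) ∂P := by
        rw [integral_add (by fun_prop) (by fun_prop), integral_add (by fun_prop) (by fun_prop),
          integral_const_mul, integral_const_mul]
        simp
    _ ≤ (l * ∫ o, Z o ∂P + 192 * l ^ 2) + 1 := by
        have := mul_le_mul_of_nonneg_left h.integral_exp_abs_le
          (show 0 ≤ 128 * l ^ 2 by positivity)
        linarith
    _ ≤ _ := add_one_le_exp _

lemma measure_sum_sub_ge_le [IsProbabilityMeasure P] {n : ℕ} {Z : Fin n → Ω → ℝ} (hind : iIndepFun Z P)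
    (hZ : ∀ i, ExpAbsBounded (Z i) P) {t : ℝ} (ht0 : 0 ≤ t) (ht : t ≤ 48) :
    P.real {o | n * t ≤ ∑ i, (Z i o - ∫ o, Z i o ∂P)} ≤ exp (-(n * t ^ 2 / 768)) := by
  -- The minimizer of `-l t + 192 l²`, with value `-t² / 768`; the condition `t ≤ 48` says `l ≤ 1 /
  -- 8`.
  set l := t / 384 with hl
  have hl0 : 0 ≤ l := by positivity
  have hl8 : |l| ≤ 1 / 8 := by rw [abs_of_nonneg hl0]; linarith
  have hint : Integrable (fun o => exp (l * (∑ i, Z i) o)) P :=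
    hind.integrable_exp_mul_sum (fun i => (hZ i).1) fun i _ => (hZ i).integrable_exp_mul hl8
  set μ := ∑ i, ∫ o, Z i o ∂P with hμ
  have h1 := measure_ge_le_exp_mul_mgf (n * t + μ) hl0 hint
  have h2 : {o | n * t ≤ ∑ i, (Z i o - ∫ o, Z i o ∂P)} = {o | n * t + μ ≤ (∑ i, Z i) o} := by
    ext o
    simp only [Set.mem_ofPred_eq, Finset.sum_sub_distrib, Finset.sum_apply]
    constructor <;> intro h <;> linarith
  rw [h2]
  refine h1.trans ?_
  rw [hind.mgf_sum (fun i => (hZ i).1)]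
  have h3 : ∏ i, mgf (Z i) P l ≤ ∏ i : Fin n, exp (l * ∫ o, Z i o ∂P + 192 * l ^ 2) :=
    Finset.prod_le_prod (fun i _ => mgf_nonneg) fun i _ => (hZ i).mgf_le hl8
  refine (mul_le_mul_of_nonneg_left h3 (exp_pos _).le).trans_eq ?_
  rw [← exp_sum, ← exp_add, Finset.sum_add_distrib, ← Finset.mul_sum, ← hμ]
  congr 1
  simp only [Finset.sum_const, Finset.card_univ, Fintype.card_fin, nsmul_eq_mul, hl]
  ring

lemma measure_abs_sum_sub_gt_le [IsProbabilityMeasure P] {n : ℕ} {Z : Fin n → Ω → ℝ} (hind : iIndepFun Z P)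
    (hZ : ∀ i, ExpAbsBounded (Z i) P) {t : ℝ} (ht0 : 0 ≤ t) (ht : t ≤ 48) :
    P.real {o | n * t < |∑ i, (Z i o - ∫ o, Z i o ∂P)|} ≤ 2 * exp (-(n * t ^ 2 / 768)) := by
  have h1 := measure_sum_sub_ge_le hind hZ ht0 ht
  have h2 := measure_sum_sub_ge_le (Z := fun i => -Z i)
    (hind.comp (fun _ x => -x) fun _ => measurable_neg) (fun i => (hZ i).neg) ht0 ht
  rw [two_mul]
  refine le_trans (measureReal_mono ?_) ((measureReal_union_le _ _).trans (add_le_add h1 h2))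
  intro o ho
  have ho : n * t < |∑ i, (Z i o - ∫ o, Z i o ∂P)| := ho
  rcases lt_abs.1 ho with h | h
  · exact Or.inl h.le
  · refine Or.inr ?_
    simp only [Set.mem_ofPred_eq, Pi.neg_apply, integral_neg]
    rw [← Finset.sum_neg_distrib] at h
    refine h.le.trans_eq (Finset.sum_congr rfl fun i _ => by ring)

lemma hasSubgaussianMGF_inv_mul {c : NNReal} {X : Ω → ℝ} (hc : (0 : ℝ) < c)
    (hX : HasSubgaussianMGF X (c ^ 2) P) : HasSubgaussianMGF (fun o => (c : ℝ)⁻¹ * X o) 1 P := by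
  convert! hX.const_mul (c : ℝ)⁻¹ using 1
  apply NNReal.eq
  change 1 = (c : ℝ)⁻¹ ^ 2 * (c : ℝ) ^ 2
  field_simp

lemma expAbsBounded_inv_mul [IsProbabilityMeasure P] {U V : Ω → ℝ} {σ τ : NNReal}
    (hσ : (0 : ℝ) < σ) (hτ : (0 : ℝ) < τ) (hUm : Measurable U) (hVm : Measurable V)
    (hU : HasSubgaussianMGF U (σ ^ 2) P) (hV : HasSubgaussianMGF V (τ ^ 2) P) :
    ExpAbsBounded (fun o => (σ : ℝ)⁻¹ * (τ : ℝ)⁻¹ * (U o * V o)) P := by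
  refine ⟨by fun_prop, ?_⟩
  have h := lintegral_exp_abs_mul_le (by fun_prop) (by fun_prop) (hasSubgaussianMGF_inv_mul hσ hU)
    (hasSubgaussianMGF_inv_mul hτ hV)
  refine le_of_eq_of_le (lintegral_congr fun o => ?_) h
  congr 4
  ring

lemma integral_sq_le_of_hasSubgaussianMGF [IsProbabilityMeasure P] {X : Ω → ℝ} {σ : NNReal}
    (hXm : Measurable X) (hX : HasSubgaussianMGF X (σ ^ 2) P) :
    ∫ o, X o ^ 2 ∂P ≤ 2 * (σ : ℝ) ^ 2 := by
  by_cases h0 : σ = 0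
  · have h1 : ∫ o, X o ^ 2 ∂P = ∫ _, (0 : ℝ) ∂P := by
      refine integral_congr_ae ?_
      rw [h0] at hX
      filter_upwards [(show HasSubgaussianMGF X 0 P by
        simpa using hX).ae_eq_zero_of_hasSubgaussianMGF_zero] with o ho
      simp [ho]
    rw [h1, integral_zero]
    positivity
  · have hσ : (0 : ℝ) < σ := by exact_mod_cast pos_iff_ne_zero.2 h0
    have hb := expAbsBounded_inv_mul hσ hσ hXm hXm hX hX
    have h1 : ∫ o, (σ : ℝ)⁻¹ * (σ : ℝ)⁻¹ * (X o * X o) ∂P ≤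
        ∫ o, 4 * (Real.exp (|(σ : ℝ)⁻¹ * (σ : ℝ)⁻¹ * (X o * X o)| / 4) - 1) ∂P := by
      refine integral_mono hb.integrable
        ((hb.integrable_exp_abs.sub (integrable_const 1)).const_mul 4) fun o => ?_
      have h2 := add_one_le_exp (|(σ : ℝ)⁻¹ * (σ : ℝ)⁻¹ * (X o * X o)| / 4)
      have h3 := le_abs_self ((σ : ℝ)⁻¹ * (σ : ℝ)⁻¹ * (X o * X o))
      simp only
      linarith
    rw [integral_const_mul, integral_const_mul, integral_sub hb.integrable_exp_abs
      (integrable_const 1)] at h1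
    have h2 := hb.integral_exp_abs_le
    have h3 : (σ : ℝ)⁻¹ * (σ : ℝ)⁻¹ * ∫ o, X o * X o ∂P ≤ 2 := by
      refine h1.trans ?_
      simp only [integral_const, probReal_univ, smul_eq_mul]
      linarith
    have h4 : ∫ o, X o ^ 2 ∂P = ∫ o, X o * X o ∂P := by simp only [pow_two]
    rw [h4]
    have e : (σ : ℝ)⁻¹ * (σ : ℝ)⁻¹ * ∫ o, X o * X o ∂P = (∫ o, X o * X o ∂P) / (σ : ℝ) ^ 2 := by
      field_simp
    rw [e, div_le_iff₀ (by positivity)] at h3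
    exact h3

/-- Concentration of averages of products of sub-Gaussian variables. -/
lemma measure_abs_avg_mul_gt_le [IsProbabilityMeasure P] {n : ℕ} (hn : 0 < n) {U V : Fin n → Ω → ℝ} {σ τ : NNReal}
    (hUm : ∀ i, Measurable (U i)) (hVm : ∀ i, Measurable (V i))
    (hU : ∀ i, HasSubgaussianMGF (U i) (σ ^ 2) P) (hV : ∀ i, HasSubgaussianMGF (V i) (τ ^ 2) P)
    (hind : iIndepFun (fun i o => U i o * V i o) P) {t : ℝ} (ht0 : 0 ≤ t) (ht : t ≤ 48) :
    P.real {o | σ * τ * t < |avg fun i => (U i o * V i o - ∫ o, U i o * V i o ∂P)|} ≤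
      2 * exp (-(n * t ^ 2 / 768)) := by
  have hn' : (0 : ℝ) < n := by exact_mod_cast hn
  by_cases h0 : σ = 0 ∨ τ = 0
  -- Normalization by `σ τ` is impossible here. The products vanish almost surely, and the strict
  -- inequality makes the event null.
  · have hae : ∀ᵐ o ∂P, ∀ i, U i o * V i o = 0 := by
      rw [ae_all_iff]
      intro i
      rcases h0 with h0 | h0
      · have := hU i
        rw [h0] at this
        filter_upwards [(show HasSubgaussianMGF (U i) 0 P by
          simpa using this).ae_eq_zero_of_hasSubgaussianMGF_zero] with o ho
        simp [ho]
      · have := hV i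
        rw [h0] at this
        filter_upwards [(show HasSubgaussianMGF (V i) 0 P by
          simpa using this).ae_eq_zero_of_hasSubgaussianMGF_zero] with o ho
        simp [ho]
    have hint : ∀ i, ∫ o, U i o * V i o ∂P = 0 := fun i => by
      rw [integral_congr_ae (g := fun _ => (0 : ℝ)) (by filter_upwards [hae] with o ho using ho i)]
      simp
    have hz : P.real {o | σ * τ * t < |avg fun i => (U i o * V i o - ∫ o, U i o * V i o ∂P)|}
        = 0 := by
      rw [measureReal_def, measure_eq_zero_iff_ae_notMem.2, ENNReal.toReal_zero]
      filter_upwards [hae] with o ho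
      have : (0 : ℝ) ≤ σ * τ * t := by positivity
      simpa [hint, ho, avg] using this
    rw [hz]
    positivity
  · push Not at h0
    have hσ : (0 : ℝ) < σ := by exact_mod_cast pos_iff_ne_zero.2 h0.1
    have hτ : (0 : ℝ) < τ := by exact_mod_cast pos_iff_ne_zero.2 h0.2
    set c : ℝ := (σ : ℝ)⁻¹ * (τ : ℝ)⁻¹ with hc
    have hZ : ∀ i, ExpAbsBounded (fun o => c * (U i o * V i o)) P := fun i =>
      expAbsBounded_inv_mul hσ hτ (hUm i) (hVm i) (hU i) (hV i)
    have hind' : iIndepFun (fun i o => c * (U i o * V i o)) P :=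
      hind.comp (fun _ x => c * x) fun _ => by fun_prop
    refine le_trans (le_of_eq ?_) (measure_abs_sum_sub_gt_le hind' hZ ht0 ht)
    congr 1
    ext o
    simp only [Set.mem_ofPred_eq, integral_const_mul, ← mul_sub, ← Finset.mul_sum, avg, abs_mul,
      smul_eq_mul]
    have hc0 : 0 < c := by positivity
    rw [abs_of_pos (inv_pos.2 hn'), abs_of_pos hc0, lt_inv_mul_iff₀ hn', ← div_lt_iff₀' hc0]
    have : n * (σ * τ * t) = n * t / c := by rw [hc]; field_simp
    rw [this]

end Concentration

/-! ### Independence of blocks and of paired families. -/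

section Independence

variable {Ω : Type*} [MeasurableSpace Ω] {P : Measure Ω}

/-- Disjoint blocks of an independent family are independent. -/
lemma iIndepFun_curry {ι κ : Type*} {X : ι × κ → Ω → ℝ} (hX : ∀ p, Measurable (X p))
    (h : iIndepFun X P) : iIndepFun (fun i o j => X (i, j) o) P := by
  have := h.isProbabilityMeasure
  have hp : ∀ i j, IsProbabilityMeasure (P.map (X (i, j))) := fun i j =>
    Measure.isProbabilityMeasure_map (hX (i, j)).aemeasurable
  have hp' : ∀ i, IsProbabilityMeasure (P.map fun o j => X (i, j) o) := fun i =>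
    Measure.isProbabilityMeasure_map (Measurable.aemeasurable (by fun_prop))
  have hs : iIndepFun (fun (p : (_ : ι) × κ) o => X (p.1, p.2) o) P :=
    h.precomp (Equiv.sigmaEquivProd ι κ).injective
  have hr : ∀ i, iIndepFun (fun j => X (i, j)) P := fun i =>
    h.precomp (g := fun j => (i, j)) fun j j' hj => (Prod.mk.inj hj).2
  rw [iIndepFun_iff_map_fun_eq_infinitePi_map (by fun_prop)] at hs ⊢
  have e : (MeasurableEquiv.piCurry fun (_ : ι) (_ : κ) => ℝ) ∘
      (fun o (p : (_ : ι) × κ) => X (p.1, p.2) o) = fun o i j => X (i, j) o := by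
    ext; simp [Sigma.curry]
  rw [← e, ← Measure.map_map (by fun_prop) (by fun_prop), hs,
    Measure.infinitePi_map_piCurry fun i j => P.map (X (i, j))]
  congrm Measure.infinitePi fun i => ?_
  rw [(iIndepFun_iff_map_fun_eq_infinitePi_map (by fun_prop)).1 (hr i)]

/-- Independent families that are independent of each other may be paired up. -/
lemma iIndepFun_prodMk_of_indepFun {ι : Type*} [Fintype ι] {U V : ι → Ω → ℝ}
    (hU : ∀ i, Measurable (U i)) (hV : ∀ i, Measurable (V i)) (hUi : iIndepFun U P)
    (hVi : iIndepFun V P) (hUV : IndepFun (fun o i => U i o) (fun o i => V i o) P) :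
    iIndepFun (fun i o => (U i o, V i o)) P := by
  have := hUi.isProbabilityMeasure
  have hp : ∀ i, IsProbabilityMeasure (P.map (U i)) := fun i =>
    Measure.isProbabilityMeasure_map (hU i).aemeasurable
  have hp' : ∀ i, IsProbabilityMeasure (P.map (V i)) := fun i =>
    Measure.isProbabilityMeasure_map (hV i).aemeasurable
  have hpair : ∀ i, P.map (fun o => (U i o, V i o)) = (P.map (U i)).prod (P.map (V i)) := fun i =>
    (indepFun_iff_map_prod_eq_prod_map_map (hU i).aemeasurable (hV i).aemeasurable).1
      (hUV.comp (measurable_pi_apply i) (measurable_pi_apply i))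
  rw [iIndepFun_iff_map_fun_eq_pi_map (fun i => ((hU i).prodMk (hV i)).aemeasurable)]
  simp only [hpair]
  have hmp := measurePreserving_arrowProdEquivProdArrow ℝ ℝ ι (fun i => P.map (U i))
    (fun i => P.map (V i))
  have hjoint : P.map (fun o => ((fun i => U i o), fun i => V i o)) =
      (Measure.pi fun i => P.map (U i)).prod (Measure.pi fun i => P.map (V i)) := by
    rw [(indepFun_iff_map_prod_eq_prod_map_map (by fun_prop) (by fun_prop)).1 hUV,
      hUi.map_fun_eq_pi_map (fun i => (hU i).aemeasurable),
      hVi.map_fun_eq_pi_map (fun i => (hV i).aemeasurable)]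
  have e : (MeasurableEquiv.arrowProdEquivProdArrow ℝ ℝ ι).symm ∘
      (fun o => ((fun i => U i o), fun i => V i o)) = fun o i => (U i o, V i o) := rfl
  rw [← e, ← Measure.map_map (MeasurableEquiv.measurable _) (by fun_prop), hjoint,
    ← hmp.map_eq, Measure.map_map (MeasurableEquiv.measurable _) (MeasurableEquiv.measurable _)]
  simp

end Independence

/-! ### Nets of sparse unit vectors -/

section Nets

open Module

/-- The unit ball of a finite-dimensional space has a `1 / 2`-net of cardinality `5 ^ dim`. -/
lemma exists_half_net (E : Type*) [NormedAddCommGroup E] [NormedSpace ℝ E]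
    [FiniteDimensional ℝ E] : ∃ N : Finset E, N.card ≤ 5 ^ finrank ℝ E ∧ (∀ c ∈ N, ‖c‖ ≤ 1) ∧
      ∀ u : E, ‖u‖ ≤ 1 → ∃ c ∈ N, ‖u - c‖ ≤ 1 / 2 := by
  classical
  let S : Set ℕ := {j | ∃ s : Finset E, s.card = j ∧ (∀ c ∈ s, ‖c‖ ≤ 2) ∧
    ∀ c ∈ s, ∀ c' ∈ s, c ≠ c' → 1 ≤ ‖c - c'‖}
  have hbdd : BddAbove S := ⟨5 ^ finrank ℝ E, by
    rintro j ⟨s, rfl, h1, h2⟩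
    exact Besicovitch.card_le_of_separated s h1 h2⟩
  have hne : S.Nonempty := ⟨0, ∅, by simp⟩
  -- A largest `1`-separated subset of the ball of radius `2`, scaled by `1 / 2`: a point left
  -- uncovered could be doubled and added to it.
  obtain ⟨s, hs, h1, h2⟩ := Nat.sSup_mem hne hbdd
  refine ⟨s.image fun c => (1 / 2 : ℝ) • c, ?_, ?_, ?_⟩
  · exact Finset.card_image_le.trans (Besicovitch.card_le_of_separated s h1 h2)
  · intro c hc
    obtain ⟨c', hc', rfl⟩ := Finset.mem_image.1 hc
    rw [norm_smul, Real.norm_of_nonneg (by norm_num)]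
    linarith [h1 c' hc']
  · intro u hu
    by_contra! hcon
    have hu2 : ‖(2 : ℝ) • u‖ ≤ 2 := by
      rw [norm_smul, Real.norm_of_nonneg (by norm_num)]; linarith
    have hsep : ∀ c ∈ s, 1 ≤ ‖(2 : ℝ) • u - c‖ := by
      intro c hc
      have h3 := hcon _ (Finset.mem_image_of_mem _ hc)
      have h4 : (2 : ℝ) • u - c = (2 : ℝ) • (u - (1 / 2 : ℝ) • c) := by module
      rw [h4, norm_smul, Real.norm_of_nonneg (by norm_num)]
      linarith
    have hnot : (2 : ℝ) • u ∉ s := by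
      intro hmem
      have := hsep _ hmem
      simp at this
      linarith
    have hmem : (insert ((2 : ℝ) • u) s).card ∈ S := by
      refine ⟨_, rfl, ?_, ?_⟩
      · intro c hc
        rcases Finset.mem_insert.1 hc with rfl | hc
        · exact hu2
        · exact h1 c hc
      · intro c hc c' hc' hcc
        rcases Finset.mem_insert.1 hc with rfl | hc <;>
          rcases Finset.mem_insert.1 hc' with rfl | hc'
        · exact absurd rfl hcc
        · exact hsep c' hc'
        · rw [norm_sub_rev]; exact hsep c hc
        · exact h2 c hc c' hc' hcc
    have := le_csSup hbdd hmem
    rw [Finset.card_insert_of_notMem hnot, hs] at this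
    omega

variable {d : ℕ}

/-- The net is taken in `ℝ^Γ` and extended by zero, so its size is governed by `|Γ|` and not by `d`.
-/
lemma exists_sparse_half_net (Γ : Finset (Fin d)) : ∃ N : Finset (Vec d), N.card ≤ 5 ^ Γ.card ∧
    (∀ c ∈ N, ‖c‖ ≤ 1) ∧ (∀ c ∈ N, supp c ⊆ Γ) ∧
      ∀ u : Vec d, supp u ⊆ Γ → ‖u‖ ≤ 1 → ∃ c ∈ N, ‖u - c‖ ≤ 1 / 2 := by
  classical
  obtain ⟨N, hcard, hle, hnet⟩ := exists_half_net (EuclideanSpace ℝ Γ)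
  let ext : EuclideanSpace ℝ Γ → Vec d := fun v =>
    WithLp.toLp 2 fun i => if h : i ∈ Γ then v ⟨i, h⟩ else 0
  have hsupp : ∀ v, supp (ext v) ⊆ Γ := by
    intro v i hi
    by_contra h
    simp [ext, h] at hi
  have hnorm : ∀ x : Vec d, supp x ⊆ Γ → ∀ v : EuclideanSpace ℝ Γ, (∀ j : Γ, v j = x j) →
      ‖x‖ = ‖v‖ := by
    intro x hx v hv
    refine (pow_left_inj₀ (norm_nonneg _) (norm_nonneg _) two_ne_zero).1 ?_
    rw [← proj_eq_self hx, norm_sq_proj, EuclideanSpace.norm_sq_eq, ← Finset.sum_coe_sort]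
    exact Finset.sum_congr rfl fun j _ => by rw [hv j, Real.norm_eq_abs, sq_abs]
  refine ⟨N.image ext, Finset.card_image_le.trans (by simpa using hcard), ?_, ?_, ?_⟩
  · intro c hc
    obtain ⟨v, hv, rfl⟩ := Finset.mem_image.1 hc
    rw [hnorm (ext v) (hsupp v) v fun j => by simp [ext]]
    exact hle v hv
  · intro c hc
    obtain ⟨v, -, rfl⟩ := Finset.mem_image.1 hc
    exact hsupp v
  · intro u hu hu1
    let w : EuclideanSpace ℝ Γ := WithLp.toLp 2 fun j => u j
    obtain ⟨v, hv, hvw⟩ := hnet w (by rwa [← hnorm u hu w fun j => rfl])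
    refine ⟨ext v, Finset.mem_image_of_mem _ hv, ?_⟩
    rwa [hnorm (u - ext v) ((supp_sub_subset _ _).trans (Finset.union_subset hu (hsupp v))) (w - v)
      fun j => by simp [ext, w]]

/-- A finite `1 / 2`-net of the unit vectors supported on `Γ`. -/
def sparseNet (Γ : Finset (Fin d)) : Finset (Vec d) := (exists_sparse_half_net Γ).choose

lemma card_sparseNet_le (Γ : Finset (Fin d)) : (sparseNet Γ).card ≤ 5 ^ Γ.card :=
  (exists_sparse_half_net Γ).choose_spec.1

lemma norm_le_of_mem_sparseNet {Γ : Finset (Fin d)} {c : Vec d} (h : c ∈ sparseNet Γ) :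
    ‖c‖ ≤ 1 :=
  (exists_sparse_half_net Γ).choose_spec.2.1 c h

lemma supp_subset_of_mem_sparseNet {Γ : Finset (Fin d)} {c : Vec d} (h : c ∈ sparseNet Γ) :
    supp c ⊆ Γ :=
  (exists_sparse_half_net Γ).choose_spec.2.2.1 c h

lemma exists_mem_sparseNet {Γ : Finset (Fin d)} {u : Vec d} (hu : supp u ⊆ Γ) (hu1 : ‖u‖ ≤ 1) :
    ∃ c ∈ sparseNet Γ, ‖u - c‖ ≤ 1 / 2 :=
  (exists_sparse_half_net Γ).choose_spec.2.2.2 u hu hu1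

/-- The norm of a vector supported on `Γ` is controlled by its products with a net. -/
lemma norm_le_of_sparseNet {Γ : Finset (Fin d)} {b : Vec d} (hb : supp b ⊆ Γ) {τ : ℝ} (hτ : 0 ≤ τ)
    (h : ∀ c ∈ sparseNet Γ, inner ℝ c b ≤ τ) : ‖b‖ ≤ 2 * τ := by
  rcases eq_or_ne b 0 with rfl | hb0
  · simpa using hτ
  have hpos : 0 < ‖b‖ := norm_pos_iff.2 hb0
  set u := ‖b‖⁻¹ • b with hu
  have hus : supp u ⊆ Γ := fun j hj => hb (by
    simp only [hu, mem_supp, PiLp.smul_apply, smul_eq_mul] at hj ⊢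
    exact right_ne_zero_of_mul hj)
  have hu1 : ‖u‖ ≤ 1 := by
    rw [hu, norm_smul, norm_inv, norm_norm, inv_mul_cancel₀ hpos.ne']
  obtain ⟨c, hc, hcu⟩ := exists_mem_sparseNet hus hu1
  have h1 : inner ℝ u b = ‖b‖ := by
    rw [hu, real_inner_smul_left, real_inner_self_eq_norm_sq]; field_simp
  have h2 : inner ℝ u b = inner ℝ c b + inner ℝ (u - c) b := by rw [inner_sub_left]; ring
  have h3 : inner ℝ (u - c) b ≤ 1 / 2 * ‖b‖ :=
    (real_inner_le_norm _ _).trans (mul_le_mul_of_nonneg_right hcu hpos.le)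
  linarith [h c hc]

variable {n : ℕ} {a : Fin n → Vec d}

lemma gram_add (x y : Vec d) : gram a (x + y) = gram a x + gram a y := by
  simp only [gram, inner_add_right, add_smul, avg_add]

lemma gram_smul (c : ℝ) (x : Vec d) : gram a (c • x) = c • gram a x := by
  simp only [gram, inner_smul_right, mul_smul, avg_smul]

/-- The restricted deviation of the Gram matrix is controlled on a net. -/
lemma norm_proj_gram_sub_le_of_sparseNet {Γ : Finset (Fin d)} {v τ : ℝ} (hτ : 0 ≤ τ)
    (h : ∀ c ∈ sparseNet Γ, ∀ c' ∈ sparseNet Γ,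
      |inner ℝ c (gram a c') - v * inner ℝ c c'| ≤ τ)
    {z : Vec d} (hz : supp z ⊆ Γ) : ‖proj Γ (gram a z) - v • z‖ ≤ 4 * τ * ‖z‖ := by
  let B₀ : Vec d →ₗ[ℝ] Vec d :=
    { toFun := fun z => proj Γ (gram a (proj Γ z)) - v • proj Γ z
      map_add' := fun x y => by simp only [proj_add, gram_add]; module
      map_smul' := fun c x => by
        simp only [proj_smul, gram_smul, RingHom.id_apply]; module }
  let B : Vec d →L[ℝ] Vec d := LinearMap.toContinuousLinearMap B₀
  have hB : ∀ z, B z = proj Γ (gram a (proj Γ z)) - v • proj Γ z := fun z => rfl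
  have hBs : ∀ z, supp (B z) ⊆ Γ := fun z => by
    rw [hB, ← proj_smul, ← proj_sub]; exact supp_proj_subset _ _
  have hBz : ∀ z, supp z ⊆ Γ → B z = proj Γ (gram a z) - v • z := fun z hz => by
    rw [hB, proj_eq_self hz]
  have hnet : ∀ c' ∈ sparseNet Γ, ‖B c'‖ ≤ 2 * τ := by
    intro c' hc'
    refine norm_le_of_sparseNet (hBs c') hτ fun c hc => ?_
    rw [hBz c' (supp_subset_of_mem_sparseNet hc'), inner_sub_right, inner_smul_right,
      ← inner_eq_inner_proj (supp_subset_of_mem_sparseNet hc)]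
    exact (le_abs_self _).trans (h c hc c' hc')
  -- The operator norm is finite, so approximating a vector by the net leaves half of it to be
  -- absorbed. The other factor `2` in `4 τ` comes from the net for the second argument.
  have hop : ‖B‖ ≤ 2 * τ + 1 / 2 * ‖B‖ := by
    refine ContinuousLinearMap.opNorm_le_of_unit_norm (by positivity) fun z hz1 => ?_
    have hpz : ‖proj Γ z‖ ≤ 1 := (norm_proj_le _ _).trans hz1.le
    obtain ⟨c, hc, hcz⟩ := exists_mem_sparseNet (supp_proj_subset Γ z) hpz
    have e : B z = B c + B (proj Γ z - c) := by
      rw [← map_add, add_sub_cancel, hBz _ (supp_proj_subset Γ z), hB]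
    rw [e]
    refine (norm_add_le _ _).trans (add_le_add (hnet c hc) ?_)
    refine (B.le_opNorm _).trans ?_
    rw [mul_comm]
    exact mul_le_mul_of_nonneg_right hcz (norm_nonneg _)
  rw [← hBz z hz]
  exact (B.le_opNorm z).trans (mul_le_mul_of_nonneg_right (by linarith) (norm_nonneg _))

end Nets

/-! ### Concentration of the Gram matrix and of the noise -/

section Events

variable {n d : ℕ} {Ω : Type*} [MeasurableSpace Ω] {P : Measure Ω}

/-- The rows of a matrix as Euclidean vectors. -/
def row (A : Matrix (Fin n) (Fin d) ℝ) (i : Fin n) : Vec d := WithLp.toLp 2 (A i)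

lemma inner_row (A : Matrix (Fin n) (Fin d) ℝ) (i : Fin n) (x : Vec d) :
    inner ℝ (row A i) x = ∑ j, A i j * x j := inner_eq_sum _ _

variable {A : Ω → Matrix (Fin n) (Fin d) ℝ} {σ : NNReal}

lemma measurable_inner_row
    (hA : IIDSubGaussian (fun (p : Fin n × Fin d) (o : Ω) => A o p.1 p.2) σ P) (i : Fin n)
    (u : Vec d) : Measurable fun o => inner ℝ (row (A o) i) u := by
  simp only [inner_row]
  exact Finset.measurable_sum _ fun j _ => (hA.1 (i, j)).mul_const _

/-- The variance proxies of independent summands add up to `σ² ‖u‖²`, independently of the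
dimension. -/
lemma hasSubgaussianMGF_inner_row [IsProbabilityMeasure P]
    (hA : IIDSubGaussian (fun (p : Fin n × Fin d) (o : Ω) => A o p.1 p.2) σ P) (i : Fin n)
    {u : Vec d} (hu : ‖u‖ ≤ 1) :
    HasSubgaussianMGF (fun o => inner ℝ (row (A o) i) u) (σ ^ 2) P := by
  have hind : iIndepFun (fun (j : Fin d) o => u j * A o i j) P :=
    (hA.2.1.precomp (g := fun j => (i, j)) fun j j' h => (Prod.mk.inj h).2).comp
      (fun j x => u j * x) fun j => by fun_prop
  have hj : ∀ j, HasSubgaussianMGF (fun o => u j * A o i j) (‖u j‖₊ ^ 2 * σ ^ 2) P := fun j => by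
    convert! (hA.2.2.2 (i, j)).2.const_mul (u j) using 1
    apply NNReal.eq
    change ‖u j‖ ^ 2 * (σ : ℝ) ^ 2 = (u j) ^ 2 * (σ : ℝ) ^ 2
    rw [Real.norm_eq_abs, sq_abs]
  have h := HasSubgaussianMGF.sum_of_iIndepFun hind (s := Finset.univ) fun j _ => hj j
  have e : (fun o => inner ℝ (row (A o) i) u) = fun o => ∑ j, u j * A o i j := by
    ext o
    rw [inner_row]
    exact Finset.sum_congr rfl fun j _ => mul_comm _ _
  rw [e]
  refine ⟨h.integrable_exp_mul, fun t => (h.mgf_le t).trans (Real.exp_le_exp.2 ?_)⟩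
  rw [← Finset.sum_mul, NNReal.coe_mul, NNReal.coe_sum]
  have h1 : ∑ j, ((‖u j‖₊ ^ 2 : NNReal) : ℝ) ≤ 1 := by
    have : ∑ j, ((‖u j‖₊ ^ 2 : NNReal) : ℝ) = ‖u‖ ^ 2 := by
      rw [EuclideanSpace.norm_sq_eq]
      simp
    rw [this]
    exact pow_le_one₀ (norm_nonneg _) hu
  have h2 : 0 ≤ ((σ ^ 2 : NNReal) : ℝ) := NNReal.coe_nonneg _
  have h3 := mul_le_mul_of_nonneg_right (mul_le_of_le_one_left h2 h1) (sq_nonneg t)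
  linarith

lemma exists_second_moment [IsProbabilityMeasure P] (hn : 0 < n) (hd : 0 < d)
    (hA : IIDSubGaussian (fun (p : Fin n × Fin d) (o : Ω) => A o p.1 p.2) σ P) :
    ∃ v : ℝ, 0 ≤ v ∧ v ≤ 2 * (σ : ℝ) ^ 2 ∧ ∀ i j, ∫ o, A o i j ^ 2 ∂P = v := by
  let p₀ : Fin n × Fin d := (⟨0, hn⟩, ⟨0, hd⟩)
  refine ⟨∫ o, A o p₀.1 p₀.2 ^ 2 ∂P, integral_nonneg fun o => sq_nonneg _,
    integral_sq_le_of_hasSubgaussianMGF (hA.1 p₀) (hA.2.2.2 p₀).2, fun i j => ?_⟩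
  exact ((hA.2.2.1 (i, j) p₀).comp (u := fun x : ℝ => x ^ 2) (by fun_prop)).integral_eq

/-- Cross terms vanish by independence and centering, so each row has second-moment matrix `v • id`;
this identifies the mean of the Gram matrix. -/
lemma integral_inner_row_mul
    (hA : IIDSubGaussian (fun (p : Fin n × Fin d) (o : Ω) => A o p.1 p.2) σ P) {v : ℝ}
    (hv : ∀ i j, ∫ o, A o i j ^ 2 ∂P = v) (i : Fin n) (u w : Vec d) :
    ∫ o, inner ℝ (row (A o) i) u * inner ℝ (row (A o) i) w ∂P = v * inner ℝ u w := by
  have hint : ∀ j l, Integrable (fun o => (A o i j * u j) * (A o i l * w l)) P := fun j l => by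
    have h1 : MemLp (fun o => A o i j) 2 P := by
      simpa using (hA.2.2.2 (i, j)).2.memLp 2
    have h2 : MemLp (fun o => A o i l) 2 P := by
      simpa using (hA.2.2.2 (i, l)).2.memLp 2
    have h3 := (h1.integrable_mul h2).const_mul (u j * w l)
    refine h3.congr (ae_of_all _ fun o => ?_)
    simp only [Pi.mul_apply]
    ring
  simp only [inner_row, Finset.sum_mul_sum]
  rw [integral_finsetSum _ fun j _ => integrable_finsetSum _ fun l _ => hint j l, inner_eq_sum,
    Finset.mul_sum]
  refine Finset.sum_congr rfl fun j _ => ?_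
  rw [integral_finsetSum _ fun l _ => hint j l, Finset.sum_eq_single j]
  · have e : ∀ o, A o i j * u j * (A o i j * w j) = (u j * w j) * A o i j ^ 2 := fun o => by ring
    simp only [e, integral_const_mul, hv]
    ring
  · intro l _ hl
    have e : ∀ o, A o i j * u j * (A o i l * w l) = (u j * w l) * (A o i j * A o i l) :=
      fun o => by ring
    have hne : (i, j) ≠ (i, l) := fun h => hl (Prod.mk.inj h).2.symm
    have h := (hA.2.1.indepFun hne).integral_fun_mul_eq_mul_integral
      (hA.1 (i, j)).aestronglyMeasurable (hA.1 (i, l)).aestronglyMeasurable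
    simp only [e, integral_const_mul]
    rw [h, (hA.2.2.2 (i, j)).1]
    ring
  · simp

lemma inner_gram_row (A : Matrix (Fin n) (Fin d) ℝ) (u w : Vec d) :
    inner ℝ u (gram (row A) w) = avg fun i => inner ℝ (row A i) u * inner ℝ (row A i) w := by
  rw [gram, inner_avg]
  congr 1
  ext i
  rw [inner_smul_right, real_inner_comm u]
  ring

lemma measure_inner_gram_gt_le [IsProbabilityMeasure P] (hn : 0 < n)
    (hA : IIDSubGaussian (fun (p : Fin n × Fin d) (o : Ω) => A o p.1 p.2) σ P) {v : ℝ}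
    (hv : ∀ i j, ∫ o, A o i j ^ 2 ∂P = v) {u w : Vec d} (hu : ‖u‖ ≤ 1) (hw : ‖w‖ ≤ 1) {t : ℝ}
    (ht0 : 0 ≤ t) (ht : t ≤ 48) :
    P.real {o | (σ : ℝ) * σ * t < |inner ℝ u (gram (row (A o)) w) - v * inner ℝ u w|} ≤
      2 * Real.exp (-(n * t ^ 2 / 768)) := by
  have hrows : iIndepFun (fun (i : Fin n) o (j : Fin d) => A o i j) P :=
    iIndepFun_curry hA.1 hA.2.1
  have hind : iIndepFun
      (fun i o => inner ℝ (row (A o) i) u * inner ℝ (row (A o) i) w) P := by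
    have := hrows.comp (fun _ x => (∑ j, x j * u j) * ∑ j, x j * w j) fun i => by fun_prop
    simpa only [inner_row, Function.comp_def] using this
  have h := measure_abs_avg_mul_gt_le hn (fun i => measurable_inner_row hA i u)
    (fun i => measurable_inner_row hA i w) (fun i => hasSubgaussianMGF_inner_row hA i hu)
    (fun i => hasSubgaussianMGF_inner_row hA i hw) hind ht0 ht
  simp only [integral_inner_row_mul hA hv] at h
  refine le_of_eq_of_le ?_ h
  congr 1
  ext o
  simp only [Set.mem_ofPred_eq]
  rw [avg_sub, avg_const hn, inner_gram_row]

/-- A union bound over `d ^ r` lists of coordinates and over pairs from a net of size `5 ^ r`. The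
factor `272 = 4 * 68` combines the loss from the nets with the choice of `t`. -/
lemma exists_gram_event [IsProbabilityMeasure P] (hn : 0 < n) (hd : 3 ≤ d)
    (hA : IIDSubGaussian (fun (p : Fin n × Fin d) (o : Ω) => A o p.1 p.2) σ P) {v : ℝ}
    (hv : ∀ i j, ∫ o, A o i j ^ 2 ∂P = v) {r : ℕ} (hr : 1 ≤ r)
    (hrn : 4 * (r * Real.log d) ≤ n) :
    ∃ G : Set Ω, MeasurableSet G ∧ P.real Gᶜ ≤ 1 / d ∧
      ∀ o ∈ G, GramConcentrated (row (A o)) r v (272 * (σ : ℝ) ^ 2 * √(r * Real.log d / n)) := by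
  classical
  have hn' : (0 : ℝ) < n := by exact_mod_cast hn
  have hd' : (3 : ℝ) ≤ d := by exact_mod_cast hd
  have hlog : 0 ≤ Real.log d := Real.log_nonneg (by linarith)
  set s := √(r * Real.log d / n) with hs
  have hs0 : 0 ≤ s := Real.sqrt_nonneg _
  have hs2 : s ^ 2 = r * Real.log d / n := Real.sq_sqrt (by positivity)
  have hs1 : s ≤ 1 / 2 := by
    refine le_of_sq_le_sq ?_ (by norm_num)
    rw [hs2, div_le_iff₀ hn']
    linarith
  -- Since `68² / 768 > 6`, each tail is at most `2 d ^ (-6 r)`; and `s ≤ 1 / 2` gives `t ≤ 34`,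
  -- within the Bernstein range `t ≤ 48`.
  set t := 68 * s with ht
  -- Images of maps `Fin r → Fin d` exhaust the nonempty supports of size at most `r`, repetitions
  -- allowed.
  let N : (Fin r → Fin d) → Finset (Vec d) := fun φ => sparseNet (Finset.univ.image φ)
  let bad : Vec d → Vec d → Set Ω := fun c c' =>
    {o | (σ : ℝ) * σ * t < |inner ℝ c (gram (row (A o)) c') - v * inner ℝ c c'|}
  have hmeas : ∀ c c', MeasurableSet (bad c c') := by
    intro c c'
    refine measurableSet_lt measurable_const ?_
    simp only [inner_gram_row, avg, smul_eq_mul]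
    have hm := fun i => measurable_inner_row hA i c
    have hm' := fun i => measurable_inner_row hA i c'
    fun_prop
  let Bad : Set Ω := ⋃ φ ∈ (Finset.univ : Finset (Fin r → Fin d)), ⋃ c ∈ N φ, ⋃ c' ∈ N φ, bad c c'
  have hBadm : MeasurableSet Bad :=
    Finset.measurableSet_biUnion _ fun φ _ => Finset.measurableSet_biUnion _ fun c _ =>
      Finset.measurableSet_biUnion _ fun c' _ => hmeas c c'
  refine ⟨Badᶜ, hBadm.compl, ?_, ?_⟩
  · rw [compl_compl]
    set E := 2 * Real.exp (-(n * t ^ 2 / 768)) with hE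
    have hE0 : 0 ≤ E := by positivity
    have hcard : ∀ φ, ((N φ).card : ℝ) ≤ 5 ^ r := by
      intro φ
      have h1 : (N φ).card ≤ 5 ^ r := (card_sparseNet_le _).trans
        (Nat.pow_le_pow_right (by norm_num) (Finset.card_image_le.trans (by simp)))
      exact_mod_cast h1
    have h1 : P.real Bad ≤ (d : ℝ) ^ r * (5 ^ r * (5 ^ r * E)) := by
      refine (measureReal_biUnion_finset_le _ _).trans ?_
      have hφ : ∀ φ ∈ (Finset.univ : Finset (Fin r → Fin d)),
          P.real (⋃ c ∈ N φ, ⋃ c' ∈ N φ, bad c c') ≤ 5 ^ r * (5 ^ r * E) := by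
        intro φ _
        refine (measureReal_biUnion_finset_le _ _).trans ?_
        have hc : ∀ c ∈ N φ, P.real (⋃ c' ∈ N φ, bad c c') ≤ 5 ^ r * E := by
          intro c hc
          refine (measureReal_biUnion_finset_le _ _).trans ?_
          refine (Finset.sum_le_card_nsmul _ _ E fun c' hc' => ?_).trans ?_
          · exact measure_inner_gram_gt_le hn hA hv (norm_le_of_mem_sparseNet hc)
              (norm_le_of_mem_sparseNet hc') (by positivity) (by rw [ht]; linarith)
          · rw [nsmul_eq_mul]
            exact mul_le_mul_of_nonneg_right (hcard φ) hE0
        refine (Finset.sum_le_card_nsmul _ _ _ hc).trans ?_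
        rw [nsmul_eq_mul]
        exact mul_le_mul_of_nonneg_right (hcard φ) (by positivity)
      refine (Finset.sum_le_card_nsmul _ _ _ hφ).trans_eq ?_
      rw [nsmul_eq_mul]
      simp
    refine h1.trans ?_
    have hEle : E ≤ 2 * ((d : ℝ) ^ (6 * r))⁻¹ := by
      rw [hE]
      refine mul_le_mul_of_nonneg_left ?_ (by norm_num)
      have e1 : ((d : ℝ) ^ (6 * r))⁻¹ = Real.exp (-((6 * r : ℕ) * Real.log d)) := by
        rw [Real.exp_neg, ← Real.log_pow, Real.exp_log (by positivity)]
      rw [e1, Real.exp_le_exp, neg_le_neg_iff, ht, mul_pow, hs2]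
      have e2 : n * (68 ^ 2 * (r * Real.log d / n)) / 768 = 4624 / 768 * (r * Real.log d) := by
        field_simp
        ring
      rw [e2]
      push_cast
      have : 0 ≤ (r : ℝ) * Real.log d := by positivity
      linarith
    -- Here `d ≥ 3` is used: `25 ≤ 27 ≤ d³`, so the pairs of net points cost at most `d ^ (3 r)`.
    have h25 : (5 : ℝ) ^ r * 5 ^ r ≤ d ^ (3 * r) := by
      rw [← mul_pow, pow_mul]
      refine pow_le_pow_left₀ (by norm_num) ?_ r
      have : (3 : ℝ) ^ 3 ≤ d ^ 3 := pow_le_pow_left₀ (by norm_num) hd' 3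
      linarith
    have hdpos : (0 : ℝ) < d := by linarith
    calc (d : ℝ) ^ r * (5 ^ r * (5 ^ r * E)) = (d : ℝ) ^ r * (5 ^ r * 5 ^ r) * E := by ring
      _ ≤ (d : ℝ) ^ r * d ^ (3 * r) * (2 * ((d : ℝ) ^ (6 * r))⁻¹) := by gcongr
      _ = 2 / (d : ℝ) ^ (2 * r) := by
        rw [div_eq_mul_inv, ← pow_add]
        have : (d : ℝ) ^ (6 * r) = d ^ (r + 3 * r) * d ^ (2 * r) := by rw [← pow_add]; ring_nf
        rw [this]
        field_simp
      _ ≤ 1 / d := by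
        rw [div_le_div_iff₀ (by positivity) hdpos]
        have h2 : (d : ℝ) ^ 2 ≤ d ^ (2 * r) :=
          pow_le_pow_right₀ (by linarith) (by omega)
        nlinarith
  · intro o ho Γ z hΓ hz
    rcases Γ.eq_empty_or_nonempty with rfl | ⟨j₀, hj₀⟩
    · have : z = 0 := eq_zero_of_l0 (by
        have := Finset.card_le_card hz
        simpa [l0] using this)
      subst this
      have hg : gram (row (A o)) (0 : Vec d) = 0 := by simp [gram, avg]
      rw [hg, proj_eq_zero (by simp)]
      simp
    obtain ⟨φ, hφ⟩ : ∃ φ : Fin r → Fin d, Finset.univ.image φ = Γ := by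
      let ψ : Fin r → Fin d := fun l => if h : l.1 < Γ.card then Γ.equivFin.symm ⟨l.1, h⟩ else j₀
      refine ⟨ψ, ?_⟩
      ext j
      simp only [Finset.mem_image, Finset.mem_univ, true_and]
      constructor
      · rintro ⟨l, rfl⟩
        by_cases h : l.1 < Γ.card
        · simp [ψ, h]
        · simp [ψ, h, hj₀]
      · intro hj
        let l := Γ.equivFin ⟨j, hj⟩
        refine ⟨⟨l.1, l.2.trans_le hΓ⟩, ?_⟩
        simp [ψ, l]
    have h := norm_proj_gram_sub_le_of_sparseNet (a := row (A o)) (Γ := Γ) (v := v)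
      (τ := σ * σ * t) (by positivity) ?_ hz
    · refine h.trans_eq ?_
      rw [ht]; ring
    · intro c hc c' hc'
      by_contra hlt
      refine ho ?_
      simp only [Bad, Set.mem_iUnion]
      refine ⟨φ, Finset.mem_univ _, c, ?_, c', ?_, not_le.1 hlt⟩
      · simp only [N, hφ]; exact hc
      · simp only [N, hφ]; exact hc'

lemma noiseGrad_row_apply (A : Matrix (Fin n) (Fin d) ℝ) (e : Fin n → ℝ) (j : Fin d) :
    noiseGrad (row A) e j = avg fun i => A i j * e i := by
  simp [noiseGrad, avg, row, mul_comm]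

/-- No net is needed: a bound for every coordinate of `n⁻¹ Aᵀ ε` yields the Euclidean bound on `Γ`
at the cost of `√|Γ|`. -/
lemma exists_noise_event [IsProbabilityMeasure P] (hn : 0 < n) (hd : 3 ≤ d) {ε : Ω → Fin n → ℝ} {σ₀ : NNReal}
    (hA : IIDSubGaussian (fun (p : Fin n × Fin d) (o : Ω) => A o p.1 p.2) σ P)
    (hε : IIDSubGaussian (fun (i : Fin n) (o : Ω) => ε o i) σ₀ P)
    (hAε : IndepFun (fun (o : Ω) (p : Fin n × Fin d) => A o p.1 p.2) ε P)
    (hdn : 4 * Real.log d ≤ n) :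
    ∃ G : Set Ω, MeasurableSet G ∧ P.real Gᶜ ≤ 1 / d ∧
      ∀ o ∈ G, ∀ Γ : Finset (Fin d), ‖proj Γ (noiseGrad (row (A o)) (ε o))‖ ≤
        68 * (σ * σ₀) * √(Γ.card * Real.log d / n) := by
  have hn' : (0 : ℝ) < n := by exact_mod_cast hn
  have hd' : (3 : ℝ) ≤ d := by exact_mod_cast hd
  have hlog : 0 ≤ Real.log d := Real.log_nonneg (by linarith)
  set s := √(Real.log d / n) with hs
  have hs0 : 0 ≤ s := Real.sqrt_nonneg _
  have hs2 : s ^ 2 = Real.log d / n := Real.sq_sqrt (by positivity)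
  have hs1 : s ≤ 1 / 2 := by
    refine le_of_sq_le_sq ?_ (by norm_num)
    rw [hs2, div_le_iff₀ hn']
    linarith
  set t := 68 * s with ht
  let bad : Fin d → Set Ω := fun j =>
    {o | (σ : ℝ) * σ₀ * t < |noiseGrad (row (A o)) (ε o) j|}
  have hAm : ∀ i j, Measurable fun o => A o i j := fun i j => hA.1 (i, j)
  have hεm : ∀ i, Measurable fun o => ε o i := hε.1
  have hmeas : ∀ j, MeasurableSet (bad j) := by
    intro j
    refine measurableSet_lt measurable_const ?_
    simp only [noiseGrad_row_apply, avg, smul_eq_mul]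
    fun_prop
  set E := 2 * Real.exp (-(n * t ^ 2 / 768)) with hE
  have hbad : ∀ j, P.real (bad j) ≤ E := by
    intro j
    have hUV : IndepFun (fun o (i : Fin n) => A o i j) (fun o i => ε o i) P :=
      hAε.comp (φ := fun (x : Fin n × Fin d → ℝ) (i : Fin n) => x (i, j)) (ψ := id) (by fun_prop)
        measurable_id
    have hpair : iIndepFun (fun i o => (A o i j, ε o i)) P :=
      iIndepFun_prodMk_of_indepFun (fun i => hAm i j) hεm
        (hA.2.1.precomp (g := fun i => (i, j)) fun i i' h => (Prod.mk.inj h).1) hε.2.1 hUV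
    have hind : iIndepFun (fun i o => A o i j * ε o i) P :=
      hpair.comp (fun _ x => x.1 * x.2) fun i => by fun_prop
    have hmean : ∀ i, ∫ o, A o i j * ε o i ∂P = 0 := by
      intro i
      have h1 : IndepFun (fun o => A o i j) (fun o => ε o i) P :=
        hUV.comp (measurable_pi_apply i) (measurable_pi_apply i)
      rw [h1.integral_fun_mul_eq_mul_integral (hAm i j).aestronglyMeasurable
        (hεm i).aestronglyMeasurable, (hA.2.2.2 (i, j)).1, zero_mul]
    have h := measure_abs_avg_mul_gt_le hn (fun i => hAm i j) hεm
      (fun i => (hA.2.2.2 (i, j)).2) (fun i => (hε.2.2.2 i).2) hind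
      (show 0 ≤ t by positivity) (by rw [ht]; linarith)
    simp only [hmean, sub_zero] at h
    simpa only [bad, noiseGrad_row_apply] using h
  let Bad : Set Ω := ⋃ j ∈ (Finset.univ : Finset (Fin d)), bad j
  refine ⟨Badᶜ, (Finset.measurableSet_biUnion _ fun j _ => hmeas j).compl, ?_, ?_⟩
  · rw [compl_compl]
    refine (measureReal_biUnion_finset_le _ _).trans ?_
    refine (Finset.sum_le_card_nsmul _ _ E fun j _ => hbad j).trans ?_
    rw [nsmul_eq_mul, Finset.card_univ, Fintype.card_fin]
    have hEle : E ≤ 2 * ((d : ℝ) ^ 6)⁻¹ := by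
      rw [hE]
      refine mul_le_mul_of_nonneg_left ?_ (by norm_num)
      have e1 : ((d : ℝ) ^ 6)⁻¹ = Real.exp (-((6 : ℕ) * Real.log d)) := by
        rw [Real.exp_neg, ← Real.log_pow, Real.exp_log (by positivity)]
      rw [e1, Real.exp_le_exp, neg_le_neg_iff, ht, mul_pow, hs2]
      have e2 : n * (68 ^ 2 * (Real.log d / n)) / 768 = 4624 / 768 * Real.log d := by
        field_simp
        ring
      rw [e2]
      push_cast
      linarith
    have hdpos : (0 : ℝ) < d := by linarith
    refine (mul_le_mul_of_nonneg_left hEle hdpos.le).trans ?_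
    rw [le_div_iff₀ hdpos]
    have e : d * (2 * ((d : ℝ) ^ 6)⁻¹) * d = 2 / d ^ 4 := by field_simp
    rw [e, div_le_one (by positivity)]
    have : (3 : ℝ) ^ 4 ≤ d ^ 4 := pow_le_pow_left₀ (by norm_num) hd' 4
    linarith
  · intro o ho Γ
    have hb : ∀ j, |noiseGrad (row (A o)) (ε o) j| ≤ (σ : ℝ) * σ₀ * t := by
      intro j
      by_contra hlt
      refine ho ?_
      simp only [Bad, Set.mem_iUnion]
      exact ⟨j, Finset.mem_univ _, not_le.1 hlt⟩
    refine le_of_sq_le_sq ?_ (by positivity)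
    rw [norm_sq_proj, mul_pow, Real.sq_sqrt (by positivity)]
    refine (Finset.sum_le_card_nsmul _ _ ((σ * σ₀ * t) ^ 2) fun j _ => ?_).trans_eq ?_
    · rw [← sq_abs]
      exact pow_le_pow_left₀ (abs_nonneg _) (hb j) 2
    · rw [nsmul_eq_mul, ht, mul_pow, mul_pow 68 s, hs2]
      ring

lemma regLoss_eq_lsLoss (A : Matrix (Fin n) (Fin d) ℝ) (xstar : Vec d) (e : Fin n → ℝ) (γ : ℝ) :
    regLoss A (A.mulVec xstar.ofLp + e) γ = lsLoss γ (row A) (response (row A) xstar e) := by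
  have h : ∀ i (x : Vec d), inner ℝ (row A i) x = A.mulVec x.ofLp i := fun i x => by
    rw [inner_row]; rfl
  ext i x
  simp only [regLoss, lsLoss, response, h, Pi.add_apply]

lemma gramConcentrated_zero (a : Fin n → Vec d) (v p : ℝ) : GramConcentrated a 0 v p := by
  intro Γ z hΓ hz
  have hz0 : z = 0 := eq_zero_of_l0 ((Finset.card_le_card hz).trans hΓ)
  have hg : gram a (0 : Vec d) = 0 := by simp [gram, avg]
  rw [hz0, hg, proj_eq_self (by simp [supp])]
  simp

/-- With probability at least `1 - 2 / d`, both the Gram matrix and the noise are concentrated on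
sparse vectors. -/
lemma exists_concentration_event [IsProbabilityMeasure P] (hn : 0 < n) (hd : 3 ≤ d) {ε : Ω → Fin n → ℝ} {σ₀ : NNReal}
    (hA : IIDSubGaussian (fun (p : Fin n × Fin d) (o : Ω) => A o p.1 p.2) σ P)
    (hε : IIDSubGaussian (fun (i : Fin n) (o : Ω) => ε o i) σ₀ P)
    (hAε : IndepFun (fun (o : Ω) (p : Fin n × Fin d) => A o p.1 p.2) ε P) {v : ℝ}
    (hv : ∀ i j, ∫ o, A o i j ^ 2 ∂P = v) {r : ℕ} (hrn : 8 * (r * Real.log d) ≤ n) :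
    ∃ G : Set Ω, MeasurableSet G ∧ 1 - 2 / (d : ℝ) ≤ P.real G ∧ ∀ o ∈ G,
      GramConcentrated (row (A o)) (2 * r) v (400 * (σ : ℝ) ^ 2 * √(r * Real.log d / n)) ∧
      ∀ Γ : Finset (Fin d), Γ.card ≤ r → ‖proj Γ (noiseGrad (row (A o)) (ε o))‖ ≤
        400 * (σ * σ₀) * √(r * Real.log d / n) := by
  have hd' : (3 : ℝ) ≤ d := by exact_mod_cast hd
  have hlog : 0 ≤ Real.log d := Real.log_nonneg (by linarith)
  rcases Nat.eq_zero_or_pos r with rfl | hr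
  · refine ⟨Set.univ, MeasurableSet.univ, ?_, fun o _ => ⟨gramConcentrated_zero _ _ _, ?_⟩⟩
    · rw [probReal_univ]
      have : 0 ≤ 2 / (d : ℝ) := by positivity
      linarith
    · intro Γ hΓ
      rw [Finset.card_eq_zero.1 (Nat.le_zero.1 hΓ), proj_eq_zero (by simp)]
      simp
  have hr' : (1 : ℝ) ≤ r := by exact_mod_cast hr
  have hrlog : Real.log d ≤ r * Real.log d := le_mul_of_one_le_left hlog hr'
  -- Level `2 r` leaves room for a test set of size `r` together with the support of the vector.
  -- Below, `272 * √2 ≤ 400`.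
  obtain ⟨G₁, hG₁m, hG₁, hG₁c⟩ := exists_gram_event (r := 2 * r) hn hd hA hv (by omega)
    (by push_cast; linarith)
  obtain ⟨G₂, hG₂m, hG₂, hG₂c⟩ := exists_noise_event hn hd hA hε hAε (by linarith)
  set s := √(r * Real.log d / n) with hs
  have hs0 : 0 ≤ s := Real.sqrt_nonneg _
  refine ⟨G₁ ∩ G₂, hG₁m.inter hG₂m, ?_, fun o ho => ⟨?_, ?_⟩⟩
  · have h1 : P.real (G₁ ∩ G₂)ᶜ ≤ 1 / d + 1 / d := by
      rw [Set.compl_inter]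
      exact (measureReal_union_le _ _).trans (add_le_add hG₁ hG₂)
    rw [probReal_compl_eq_one_sub (hG₁m.inter hG₂m)] at h1
    have : 2 / (d : ℝ) = 1 / d + 1 / d := by ring
    linarith
  · intro Γ z hΓ hz
    refine (hG₁c o ho.1 Γ z hΓ hz).trans (mul_le_mul_of_nonneg_right ?_ (norm_nonneg _))
    have e : √(((2 * r : ℕ) : ℝ) * Real.log d / n) = √2 * s := by
      rw [hs, ← Real.sqrt_mul (by norm_num)]
      congr 1
      push_cast
      ring
    rw [e]
    have h2 : √2 ≤ 1.45 := by
      rw [Real.sqrt_le_left (by norm_num)]; norm_num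
    have h3 := mul_le_mul_of_nonneg_right h2 (show 0 ≤ (σ : ℝ) ^ 2 * s by positivity)
    have h4 : 0 ≤ (σ : ℝ) ^ 2 * s := by positivity
    nlinarith
  · intro Γ hΓ
    refine (hG₂c o ho.2 Γ).trans ?_
    have h1 : √(Γ.card * Real.log d / n) ≤ s := by
      refine Real.sqrt_le_sqrt ?_
      have : (Γ.card : ℝ) ≤ r := by exact_mod_cast hΓ
      gcongr
    calc 68 * ((σ : ℝ) * σ₀) * √(Γ.card * Real.log d / n)
        ≤ 400 * ((σ : ℝ) * σ₀) * s := by gcongr; norm_num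
      _ = _ := rfl

end Events

end HTSVRG

end

theorem proposition9 :
    ∃ C₀ : ℝ, 0 < C₀ ∧
    ∀ R Cγ α L η β : ℝ, 0 < R → 0 < Cγ → 0 < α → 0 < L →
      0 < η → η < 1 / (4 * L) → 0 < β → β < 1 →
    ∃ C : ℝ, 0 < C ∧
    ∀ (n d k K m : ℕ), 0 < n → 0 < d → 0 < m → K ≤ k → k ≤ d →
      HTSVRG.expansiveness d k K < 4 * L / (4 * L - α) →
      HTSVRG.convCoeff (HTSVRG.expansiveness d k K) η α L m = β →
    ∀ (σ σ₀ : NNReal) (γ : ℝ), 0 ≤ γ →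
      C₀ * (3 * k + K) * Real.log d ≤ n →
      γ ≤ Cγ * Real.sqrt ((3 * k + K) * Real.log d / n) →
    ∀ (Ω : Type*) [MeasurableSpace Ω] (P : Measure Ω) [IsProbabilityMeasure P]
      (A : Ω → Matrix (Fin n) (Fin d) ℝ) (ε : Ω → Fin n → ℝ) (xstar : HTSVRG.Vec d),
      HTSVRG.IIDSubGaussian (fun (p : Fin n × Fin d) (o : Ω) => A o p.1 p.2) σ P →
      HTSVRG.IIDSubGaussian (fun (i : Fin n) (o : Ω) => ε o i) σ₀ P →
      IndepFun (fun (o : Ω) (p : Fin n × Fin d) => A o p.1 p.2) ε P →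
      HTSVRG.l0 xstar ≤ K → ‖xstar‖ ≤ R →
    ∃ G : Set Ω, MeasurableSet G ∧ 1 - 2 / (d : ℝ) ≤ P.real G ∧
    ∀ o ∈ G, ∀ f : Fin n → HTSVRG.Vec d → ℝ,
      f = HTSVRG.regLoss (A o) ((A o).mulVec xstar.ofLp + ε o) γ →
      HTSVRG.RSC (HTSVRG.objective f) (k + K) α →
      (∀ i, HTSVRG.RSS (f i) (3 * k + K) L) →
    ∀ xhat x0 : HTSVRG.Vec d,
      HTSVRG.IsGlobalOptimum (HTSVRG.objective f) K R xhat →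
      HTSVRG.l0 x0 ≤ k → ‖x0‖ ≤ R →
    ∃ τ : ℝ, HTSVRG.ConvergesLinearly f k m R η x0 xhat β τ ∧
      τ ≤ C * (max (σ : ℝ) σ₀ * σ * Real.sqrt ((3 * k + K) * Real.log d / n)) := by
  refine ⟨8, by norm_num, fun R Cγ α L η β hR hCγ hα hL hη hηL hβ0 hβ1 => ?_⟩
  have h1β : 0 < 1 - β := by linarith
  refine ⟨HTSVRG.errorConst R Cγ α L η β 400, ?_, ?_⟩
  · unfold HTSVRG.errorConst HTSVRG.stageError HTSVRG.stepError HTSVRG.gradConst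
    positivity
  intro n d k K m hn hd hm hK hk hν hβ σ σ₀ γ hγ hnC hγC Ω _ P _ A ε xstar hA hε hAε hsK hsR
  -- For `d ≤ 2` the required probability `1 - 2 / d` is at most zero and the empty event suffices.
  rcases lt_or_ge d 3 with hd3 | hd3
  · refine ⟨∅, MeasurableSet.empty, ?_, fun o ho => absurd ho (Set.notMem_empty o)⟩
    have hd0 : (0 : ℝ) < d := by exact_mod_cast hd
    have hd2 : (d : ℝ) ≤ 2 := by exact_mod_cast Nat.lt_succ_iff.1 hd3
    have : 1 ≤ 2 / (d : ℝ) := by rw [le_div_iff₀ hd0]; linarith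
    rw [measureReal_empty]
    linarith
  have hn' : (0 : ℝ) < n := by exact_mod_cast hn
  have hlog : 0 ≤ Real.log d := Real.log_natCast_nonneg d
  have hcast : ((3 * k + K : ℕ) : ℝ) = 3 * k + K := by push_cast; ring
  obtain ⟨v, hv0, hvσ, hv⟩ := HTSVRG.exists_second_moment hn hd hA
  obtain ⟨G, hGm, hGP, hG⟩ := HTSVRG.exists_concentration_event (r := 3 * k + K) hn hd3 hA hε hAε hv
    (by rw [hcast]; linarith)
  rw [hcast] at hG
  refine ⟨G, hGm, hGP, fun o ho f hf hRSC hRSS xhat x0 hopt hx0 hx0R => ?_⟩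
  rw [HTSVRG.regLoss_eq_lsLoss] at hf
  subst hf
  have hs1 : √((3 * k + K) * Real.log d / n) ≤ 1 := by
    rw [Real.sqrt_le_one, div_le_one hn']
    have : 0 ≤ (3 * (k : ℝ) + K) * Real.log d := by positivity
    linarith
  exact HTSVRG.convergesLinearly_of_concentrated hn hm hK hk hγ hR hCγ.le hη hα hL hηL hν hβ hβ0 hβ1
    (Real.sqrt_nonneg _) hs1 (by norm_num) hγC σ.2 σ₀.2 hv0 hvσ (hG o ho).1 (hG o ho).2 hRSC hRSS
    hsK hsR hopt hx0 hx0R
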